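/- **Theorem 1 (Uniqueness).** *Conventions.* Latin indices range over $1,2,3$, repeated indices are summed, a subscript $,i$ denotes $\partial/\partial x_i$ and a dot denotes $\partial/\partial t$. Let $B\subset\mathbb R^3$ be a bounded region (nonempty, open, connected) whose boundary $\partial B$ is a smooth (class $C^3$) surface with outward unit normal $n$, and let $I=[0,t_0)$ with $0<t_0\le+\infty$. For fields $u_i,\theta,\varphi$ on $\bar B\times I$ put $$e_{ij}=\tfrac12(u_{i,j}+u_{j,i}),\quad \kappa_{ijk}=u_{k,ij},\quad E_i=-\varphi_{,i},\quad V_{ij}=E_{i,j},\quad \chi=\theta+\beta\dot\theta,$$ and, with constant coefficients and $\gamma=a^{(55)}-\beta^2a^{(44)}-\alpha^{(4)}b^{(55)}$, $$\begin{aligned} \tau_{ij}&=a^{(11)}_{ijkl}e_{kl}+a^{(12)}_{ijklh}\kappa_{klh}+a^{(13)}_{ijk}E_k+a^{(14)}_{ij}\chi+a^{(17)}_{ijkl}V_{kl},\\ \mu_{ijk}&=a^{(12)}_{lhijk}e_{lh}+a^{(22)}_{ijklhm}\kappa_{lhm}+a^{(23)}_{ijkl}E_l+a^{(24)}_{ijk}\chi+a^{(27)}_{ijklh}V_{lh},\\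 -\sigma_i&=a^{(13)}_{jki}e_{jk}+a^{(23)}_{jkli}\kappa_{jkl}+a^{(33)}_{ij}E_j+a^{(34)}_i\chi+a^{(37)}_{ijk}V_{jk},\\ -\rho\eta&=a^{(14)}_{ij}e_{ij}+a^{(24)}_{ijk}\kappa_{ijk}+a^{(34)}_iE_i+a^{(44)}\chi+a^{(47)}_{ij}V_{ij}+\tfrac1\beta\big(\gamma\dot\theta+a^{(56)}_i\theta_{,i}\big)+\alpha^{(4)},\\ -Q_{ij}&=a^{(17)}_{klij}e_{kl}+a^{(27)}_{klmij}\kappa_{klm}+a^{(37)}_{kij}E_k+a^{(47)}_{ij}\chi+a^{(77)}_{ijkl}V_{kl},\\ -q_i/T_0&=\tfrac1\beta\big(a^{(56)}_i\dot\theta+a^{(66)}_{ij}\theta_{,j}\big). \end{aligned}$$ With $\mathcal D=n_i\,\partial/\partial x_i$ and $\mathcal D_i=(\delta_{ij}-n_in_j)\,\partial/\partial x_j$ put, on $\partial B$, $$\begin{aligned} P_i&=(\tau_{ji}-\mu_{kji,k})n_j-\mathcal D_j(\mu_{kji}n_k)+(\mathcal D_ln_l)\mu_{kji}n_kn_j,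 & R_i&=\mu_{kji}n_kn_j,\\ \Lambda&=(\sigma_j-Q_{kj,k})n_j-\mathcal D_j(Q_{kj}n_k)+(\mathcal D_ln_l)Q_{kj}n_kn_j, & H&=Q_{kj}n_kn_j. \end{aligned}$$ *Problem $\Pi$.* Let $S_i,\Sigma_i\subset\partial B$ satisfy $\bar S_i\cup\Sigma_i=\partial B$ and $S_i\cap\Sigma_i=\varnothing$ $(i=1,\dots,5)$. Given $f_i,g,r$, initial data $u_i^0,v_i^0,\theta^0,\eta^0$ and boundary data $\hat u_i,\hat d_i,\hat\theta,\hat\varphi,\hat\xi,\hat P_i,\hat R_i,\hat q,\hat\Lambda,\hat H$, a solution is a triple $(u_i,\theta,\varphi)$ with $u_i,\varphi$ of class $C^4$ and $\theta$ of class $C^3$ on $\bar B\times I$, such that on $B\times I$ $$\tau_{ji,j}-\mu_{kji,kj}+\rho f_i=\rho\ddot u_i,\qquad \sigma_{i,i}-Q_{ji,ji}=g,\qquad \rho T_0\dot\eta+q_{i,i}-\rho r=0,$$ on $\bar B$: $u_i(0)=u_i^0$, $\dot u_i(0)=v_i^0$, $\theta(0)=\theta^0$, $\eta(0)=\eta^0$,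 and $$\begin{aligned} u_i&=\hat u_i\text{ on }S_1\times I, & P_i&=\hat P_i\text{ on }\Sigma_1\times I,\\ \mathcal Du_i&=\hat d_i\text{ on }S_2\times I, & R_i&=\hat R_i\text{ on }\Sigma_2\times I,\\ \theta&=\hat\theta\text{ on }S_3\times I, & q_in_i&=\hat q\text{ on }\Sigma_3\times I,\\ \varphi&=\hat\varphi\text{ on }S_4\times I, & \Lambda&=\hat\Lambda\text{ on }\Sigma_4\times I,\\ \mathcal D\varphi&=\hat\xi\text{ on }S_5\times I, & H&=\hat H\text{ on }\Sigma_5\times I. \end{aligned}$$ *Quadratic forms.* Let $$\begin{aligned} W&=\tfrac12a^{(11)}_{ijkl}e_{ij}e_{kl}+\tfrac12a^{(22)}_{ijklhm}\kappa_{ijk}\kappa_{lhm}+a^{(12)}_{ijklh}e_{ij}\kappa_{klh},\\ G&=-\tfrac12a^{(33)}_{ij}E_iE_j-\tfrac12a^{(77)}_{ijkl}V_{ij}V_{kl}-a^{(37)}_{ijk}E_iV_{jk}-a^{(34)}_iE_i\chi-a^{(47)}_{ij}V_{ij}\chi-\tfrac12\Big(a^{(44)}+\frac{\gamma}{\beta^2}\Big)\chi^2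 . \end{aligned}$$ The coefficients obey the restriction imposed by the dissipation inequality, $$\tfrac1\beta\big(\gamma\xi^2+2a^{(56)}_i\xi\eta_i+a^{(66)}_{ij}\eta_i\eta_j\big)\ge0\qquad\text{for all real }\xi,\eta_i .$$ *Statement.* Assume that i) $\rho,\beta,T_0>0$; ii) $a^{(11)}_{ijkl}=a^{(11)}_{jikl}=a^{(11)}_{klij}$, $a^{(22)}_{ijklhm}=a^{(22)}_{jiklhm}=a^{(22)}_{lhmijk}$, $a^{(33)}_{ij}=a^{(33)}_{ji}$, $a^{(66)}_{ij}=a^{(66)}_{ji}$, $a^{(77)}_{ijkl}=a^{(77)}_{jikl}=a^{(77)}_{klij}$, $a^{(12)}_{ijklh}=a^{(12)}_{jiklh}=a^{(12)}_{ijlkh}$, $a^{(13)}_{ijk}=a^{(13)}_{jik}$, $a^{(14)}_{ij}=a^{(14)}_{ji}$, $a^{(17)}_{ijkl}=a^{(17)}_{jikl}=a^{(17)}_{klij}$, $a^{(23)}_{ijkl}=a^{(23)}_{jikl}$, $a^{(24)}_{ijk}=a^{(24)}_{jik}$, $a^{(27)}_{ijkhl}=a^{(27)}_{jikhl}=a^{(27)}_{ijklh}$,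 $a^{(37)}_{ijk}=a^{(37)}_{ikj}$, $a^{(47)}_{ij}=a^{(47)}_{ji}$; iii) $W$ is positive semi-definite in $e_{ij}=e_{ji}$, $\kappa_{ijk}=\kappa_{jik}$; iv) $G$ is positive definite in $E_i$, $V_{ij}=V_{ji}$, $\chi$. If $S_4\neq\varnothing$, then the mixed initial-boundary value problem $\Pi$ has at most one solution on $\bar B\times I$. -/

import Mathlib

open Topology

noncomputable section

namespace Thermopiezo

/-- Three-dimensional Euclidean space with fixed rectangular Cartesian axes. -/
abbrev E3 : Type := EuclideanSpace ℝ (Fin 3)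

/-- The spatial partial derivative `f_{,i}`. -/
def pd (i : Fin 3) (f : E3 → ℝ) (x : E3) : ℝ :=
  fderiv ℝ f x (EuclideanSpace.single i 1)

/-- The time derivative (superposed dot) of a scalar field depending on time and place. -/
def dot (f : ℝ → E3 → ℝ) (t : ℝ) (x : E3) : ℝ :=
  deriv (fun s => f s x) t

/-! ### The region -/

/-- `ψ` is a defining function of class `C³` for the set `B` near the point `x`. -/
structure IsLocalDefiningFunction (B : Set E3) (x : E3) (ψ : E3 → ℝ) : Prop where
  contDiffAt : ContDiffAt ℝ 3 ψ x
  gradient_ne_zero : gradient ψ x ≠ 0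
  mem_iff : ∀ᶠ y in 𝓝 x, (y ∈ B ↔ ψ y < 0)

/-- `B` is a bounded region (a nonempty connected open set) whose boundary is a smooth surface
(class `C³`), and `n` restricts on `∂B` to the outward unit normal. The values of `n` away from
`∂B` are an arbitrary extension of class `C²` near `∂B`; they are only used to write down
tangential derivatives on `∂B`, which do not depend on the extension. -/
structure IsRegularRegion (B : Set E3) (n : E3 → E3) : Prop where
  isOpen : IsOpen B
  isConnected : IsConnected B
  isBounded : Bornology.IsBounded B
  normal_contDiffAt : ∀ x ∈ frontier B, ContDiffAt ℝ 2 n x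
  normal_eq : ∀ x ∈ frontier B, ∃ ψ : E3 → ℝ, IsLocalDefiningFunction B x ψ ∧
    n x = ‖gradient ψ x‖⁻¹ • gradient ψ x

/-- The normal derivative `n_i ∂/∂x_i`. -/
def normalDeriv (n : E3 → E3) (f : E3 → ℝ) (x : E3) : ℝ :=
  ∑ i, n x i * pd i f x

/-- The `i`-th component `(δ_ij - n_i n_j) ∂/∂x_j` of the surface gradient. -/
def surfDeriv (n : E3 → E3) (i : Fin 3) (f : E3 → ℝ) (x : E3) : ℝ :=
  ∑ j, ((if i = j then 1 else 0) - n x i * n x j) * pd j f x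

/-- The time interval `I = [0, t₀)`, where `t₀ ≤ +∞`. -/
def timeInterval (t₀ : EReal) : Set ℝ := {t | 0 ≤ t ∧ (t : EReal) < t₀}

/-! ### Constitutive coefficients -/

/-- The (constant) coefficients of the linear theory of a homogeneous body. -/
structure Coefficients where
  rho : ℝ
  T0 : ℝ
  beta : ℝ
  alpha4 : ℝ
  b55 : ℝ
  a11 : Fin 3 → Fin 3 → Fin 3 → Fin 3 → ℝ
  a22 : Fin 3 → Fin 3 → Fin 3 → Fin 3 → Fin 3 → Fin 3 → ℝ
  a33 : Fin 3 → Fin 3 → ℝ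
  a44 : ℝ
  a55 : ℝ
  a66 : Fin 3 → Fin 3 → ℝ
  a77 : Fin 3 → Fin 3 → Fin 3 → Fin 3 → ℝ
  a12 : Fin 3 → Fin 3 → Fin 3 → Fin 3 → Fin 3 → ℝ
  a13 : Fin 3 → Fin 3 → Fin 3 → ℝ
  a14 : Fin 3 → Fin 3 → ℝ
  a17 : Fin 3 → Fin 3 → Fin 3 → Fin 3 → ℝ
  a23 : Fin 3 → Fin 3 → Fin 3 → Fin 3 → ℝ
  a24 : Fin 3 → Fin 3 → Fin 3 → ℝ
  a27 : Fin 3 → Fin 3 → Fin 3 → Fin 3 → Fin 3 → ℝ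
  a34 : Fin 3 → ℝ
  a37 : Fin 3 → Fin 3 → Fin 3 → ℝ
  a47 : Fin 3 → Fin 3 → ℝ
  a56 : Fin 3 → ℝ

namespace Coefficients

variable (c : Coefficients)

/-- `γ = a⁽⁵⁵⁾ - β² a⁽⁴⁴⁾ - α⁽⁴⁾ b⁽⁵⁵⁾`. -/
def gamma : ℝ := c.a55 - c.beta ^ 2 * c.a44 - c.alpha4 * c.b55

/-- The symmetry relations of the constitutive coefficients. -/
structure Symmetric : Prop where
  a11 : ∀ i j k l, c.a11 i j k l = c.a11 j i k l ∧ c.a11 j i k l = c.a11 k l i j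
  a22 : ∀ i j k l h m, c.a22 i j k l h m = c.a22 j i k l h m ∧
    c.a22 j i k l h m = c.a22 l h m i j k
  a33 : ∀ i j, c.a33 i j = c.a33 j i
  a66 : ∀ i j, c.a66 i j = c.a66 j i
  a77 : ∀ i j k l, c.a77 i j k l = c.a77 j i k l ∧ c.a77 j i k l = c.a77 k l i j
  a12 : ∀ i j k l h, c.a12 i j k l h = c.a12 j i k l h ∧ c.a12 j i k l h = c.a12 i j l k h
  a13 : ∀ i j k, c.a13 i j k = c.a13 j i k
  a14 : ∀ i j, c.a14 i j = c.a14 j i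
  a17 : ∀ i j k l, c.a17 i j k l = c.a17 j i k l ∧ c.a17 j i k l = c.a17 k l i j
  a23 : ∀ i j k l, c.a23 i j k l = c.a23 j i k l
  a24 : ∀ i j k, c.a24 i j k = c.a24 j i k
  a27 : ∀ i j k h l, c.a27 i j k h l = c.a27 j i k h l ∧ c.a27 j i k h l = c.a27 i j k l h
  a37 : ∀ i j k, c.a37 i j k = c.a37 i k j
  a47 : ∀ i j, c.a47 i j = c.a47 j i

/-- The quadratic form `W` in the strain measures `e_ij`, `κ_ijk`. -/
def W (e : Fin 3 → Fin 3 → ℝ) (κ : Fin 3 → Fin 3 → Fin 3 → ℝ) : ℝ :=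
  1 / 2 * (∑ i, ∑ j, ∑ k, ∑ l, c.a11 i j k l * e i j * e k l)
  + 1 / 2 * (∑ i, ∑ j, ∑ k, ∑ l, ∑ h, ∑ m, c.a22 i j k l h m * κ i j k * κ l h m)
  + ∑ i, ∑ j, ∑ k, ∑ l, ∑ h, c.a12 i j k l h * e i j * κ k l h

/-- The quadratic form `F` in `E_i`, `V_ij` and `χ = θ + β θ̇`. -/
def F (E : Fin 3 → ℝ) (V : Fin 3 → Fin 3 → ℝ) (χ : ℝ) : ℝ :=
  - (1 / 2) * (∑ i, ∑ j, c.a33 i j * E i * E j)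
  - 1 / 2 * (∑ i, ∑ j, ∑ k, ∑ l, c.a77 i j k l * V i j * V k l)
  - (∑ i, ∑ j, ∑ k, c.a37 i j k * E i * V j k)
  - (∑ i, c.a34 i * E i * χ)
  - ∑ i, ∑ j, c.a47 i j * V i j * χ

/-- The quadratic form `G` in `E_i`, `V_ij` and `χ = θ + β θ̇`. -/
def G (E : Fin 3 → ℝ) (V : Fin 3 → Fin 3 → ℝ) (χ : ℝ) : ℝ :=
  c.F E V χ - 1 / 2 * (c.a44 + c.gamma / c.beta ^ 2) * χ ^ 2

/-- The quadratic form `𝒫(ξ, η_i)` of the dissipation inequality. -/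
def dissipation (ξ : ℝ) (η : Fin 3 → ℝ) : ℝ :=
  1 / c.beta * (c.gamma * ξ ^ 2 + 2 * (∑ i, c.a56 i * ξ * η i)
    + ∑ i, ∑ j, c.a66 i j * η i * η j)

/-- `W` is positive semi-definite on the strain measures, i.e. on arrays with
`e_ij = e_ji` and `κ_ijk = κ_jik`. -/
def WPosSemidef : Prop :=
  ∀ (e : Fin 3 → Fin 3 → ℝ) (κ : Fin 3 → Fin 3 → Fin 3 → ℝ),
    (∀ i j, e i j = e j i) → (∀ i j k, κ i j k = κ j i k) → 0 ≤ c.W e κ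

/-- `G` is positive definite in the variables `E_i`, `V_ij = V_ji`, `χ`. -/
def GPosDef : Prop :=
  ∀ (E : Fin 3 → ℝ) (V : Fin 3 → Fin 3 → ℝ) (χ : ℝ),
    (∀ i j, V i j = V j i) → ¬(E = 0 ∧ V = 0 ∧ χ = 0) → 0 < c.G E V χ

/-- The restriction imposed by the dissipation inequality: `𝒫(ξ, η_i) ≥ 0` for all `ξ`, `η_i`. -/
def DissipationInequality : Prop :=
  ∀ (ξ : ℝ) (η : Fin 3 → ℝ), 0 ≤ c.dissipation ξ η

end Coefficients

/-! ### Fields, geometrical and constitutive equations -/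

/-- The unknowns `(u_i, θ, φ)`: displacement, temperature difference, electric potential. -/
structure Fields where
  u : Fin 3 → ℝ → E3 → ℝ
  θ : ℝ → E3 → ℝ
  φ : ℝ → E3 → ℝ

namespace Fields

variable (c : Coefficients) (n : E3 → E3) (U : Fields)

/-- `e_ij = (u_{i,j} + u_{j,i}) / 2`. -/
def e (i j : Fin 3) (t : ℝ) (x : E3) : ℝ :=
  1 / 2 * (pd j (U.u i t) x + pd i (U.u j t) x)

/-- `κ_ijk = u_{k,ij}`. -/
def κ (i j k : Fin 3) (t : ℝ) (x : E3) : ℝ := pd j (pd i (U.u k t)) x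

/-- `E_i = - φ_{,i}`. -/
def E (i : Fin 3) (t : ℝ) (x : E3) : ℝ := - pd i (U.φ t) x

/-- `V_ij = E_{i,j}`. -/
def V (i j : Fin 3) (t : ℝ) (x : E3) : ℝ := pd j (U.E i t) x

/-- `χ = θ + β θ̇`. -/
def χ (t : ℝ) (x : E3) : ℝ := U.θ t x + c.beta * dot U.θ t x

/-- The tensor `τ_ij`. -/
def τ (i j : Fin 3) (t : ℝ) (x : E3) : ℝ :=
  (∑ k, ∑ l, c.a11 i j k l * U.e k l t x)
  + (∑ k, ∑ l, ∑ h, c.a12 i j k l h * U.κ k l h t x)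
  + (∑ k, c.a13 i j k * U.E k t x)
  + c.a14 i j * U.χ c t x
  + ∑ k, ∑ l, c.a17 i j k l * U.V k l t x

/-- The hyperstress tensor `μ_ijk`. -/
def μ (i j k : Fin 3) (t : ℝ) (x : E3) : ℝ :=
  (∑ l, ∑ h, c.a12 l h i j k * U.e l h t x)
  + (∑ l, ∑ h, ∑ m, c.a22 i j k l h m * U.κ l h m t x)
  + (∑ l, c.a23 i j k l * U.E l t x)
  + c.a24 i j k * U.χ c t x
  + ∑ l, ∑ h, c.a27 i j k l h * U.V l h t x

/-- The vector `σ_i`. -/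
def σ (i : Fin 3) (t : ℝ) (x : E3) : ℝ :=
  - ((∑ j, ∑ k, c.a13 j k i * U.e j k t x)
    + (∑ j, ∑ k, ∑ l, c.a23 j k l i * U.κ j k l t x)
    + (∑ j, c.a33 i j * U.E j t x)
    + c.a34 i * U.χ c t x
    + ∑ j, ∑ k, c.a37 i j k * U.V j k t x)

/-- The entropy `η` per unit mass, given through `-ρ η`. -/
def η (t : ℝ) (x : E3) : ℝ :=
  - (1 / c.rho) *
    ((∑ i, ∑ j, c.a14 i j * U.e i j t x)
    + (∑ i, ∑ j, ∑ k, c.a24 i j k * U.κ i j k t x)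
    + (∑ i, c.a34 i * U.E i t x)
    + c.a44 * U.χ c t x
    + (∑ i, ∑ j, c.a47 i j * U.V i j t x)
    + 1 / c.beta * (c.gamma * dot U.θ t x + ∑ i, c.a56 i * pd i (U.θ t) x)
    + c.alpha4)

/-- The electric quadrupole `Q_ij`. -/
def Q (i j : Fin 3) (t : ℝ) (x : E3) : ℝ :=
  - ((∑ k, ∑ l, c.a17 k l i j * U.e k l t x)
    + (∑ k, ∑ l, ∑ m, c.a27 k l m i j * U.κ k l m t x)
    + (∑ k, c.a37 k i j * U.E k t x)
    + c.a47 i j * U.χ c t x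
    + ∑ k, ∑ l, c.a77 i j k l * U.V k l t x)

/-- The heat flux vector `q_i`. -/
def q (i : Fin 3) (t : ℝ) (x : E3) : ℝ :=
  - c.T0 * (1 / c.beta * (c.a56 i * dot U.θ t x + ∑ j, c.a66 i j * pd j (U.θ t) x))

/-- `P_i = (τ_ji - μ_{kji,k}) n_j - 𝒟_j (μ_kji n_k) + (𝒟_l n_l) μ_kji n_k n_j`. -/
def P (i : Fin 3) (t : ℝ) (x : E3) : ℝ :=
  (∑ j, (U.τ c j i t x - ∑ k, pd k (U.μ c k j i t) x) * n x j)
  - (∑ j, surfDeriv n j (fun y => ∑ k, U.μ c k j i t y * n y k) x)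
  + (∑ l, surfDeriv n l (fun y => n y l) x) * ∑ k, ∑ j, U.μ c k j i t x * n x k * n x j

/-- `R_i = μ_kji n_k n_j`. -/
def R (i : Fin 3) (t : ℝ) (x : E3) : ℝ :=
  ∑ k, ∑ j, U.μ c k j i t x * n x k * n x j

/-- `Λ = (σ_j - Q_{kj,k}) n_j - 𝒟_j (Q_kj n_k) + (𝒟_l n_l) Q_kj n_k n_j`. -/
def Λ (t : ℝ) (x : E3) : ℝ :=
  (∑ j, (U.σ c j t x - ∑ k, pd k (U.Q c k j t) x) * n x j)
  - (∑ j, surfDeriv n j (fun y => ∑ k, U.Q c k j t y * n y k) x)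
  + (∑ l, surfDeriv n l (fun y => n y l) x) * ∑ k, ∑ j, U.Q c k j t x * n x k * n x j

/-- `H = Q_kj n_k n_j`. -/
def H (t : ℝ) (x : E3) : ℝ :=
  ∑ k, ∑ j, U.Q c k j t x * n x k * n x j

end Fields

/-! ### The mixed initial-boundary value problem -/

/-- The parts `S_i` and `Σ_i` of the boundary (the latter written `C_i`). -/
structure BoundaryParts where
  S₁ : Set E3
  S₂ : Set E3
  S₃ : Set E3
  S₄ : Set E3
  S₅ : Set E3
  C₁ : Set E3
  C₂ : Set E3
  C₃ : Set E3
  C₄ : Set E3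
  C₅ : Set E3

/-- `closure S ∪ C = ∂B` and `S ∩ C = ∅`. -/
def IsSplitting (B S C : Set E3) : Prop :=
  closure S ∪ C = frontier B ∧ S ∩ C = ∅

/-- Each of the five pairs `(S_i, Σ_i)` splits the boundary of `B`. -/
def BoundaryParts.Valid (B : Set E3) (p : BoundaryParts) : Prop :=
  IsSplitting B p.S₁ p.C₁ ∧ IsSplitting B p.S₂ p.C₂ ∧ IsSplitting B p.S₃ p.C₃ ∧
    IsSplitting B p.S₄ p.C₄ ∧ IsSplitting B p.S₅ p.C₅

/-- The external data of the problem. -/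
structure Data where
  f : Fin 3 → ℝ → E3 → ℝ
  g : ℝ → E3 → ℝ
  r : ℝ → E3 → ℝ
  u₀ : Fin 3 → E3 → ℝ
  v₀ : Fin 3 → E3 → ℝ
  θ₀ : E3 → ℝ
  η₀ : E3 → ℝ
  uHat : Fin 3 → ℝ → E3 → ℝ
  dHat : Fin 3 → ℝ → E3 → ℝ
  θHat : ℝ → E3 → ℝ
  φHat : ℝ → E3 → ℝ
  ξHat : ℝ → E3 → ℝ
  PHat : Fin 3 → ℝ → E3 → ℝ
  RHat : Fin 3 → ℝ → E3 → ℝ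
  qHat : ℝ → E3 → ℝ
  ΛHat : ℝ → E3 → ℝ
  HHat : ℝ → E3 → ℝ

/-- `f` is of class `C^k` on `closure B × I`, as the restriction of a function of class `C^k` on a
neighbourhood of that set in space-time. -/
def SmoothUpToBoundary (k : ℕ) (B : Set E3) (I : Set ℝ) (f : ℝ → E3 → ℝ) : Prop :=
  ∀ t ∈ I, ∀ x ∈ closure B, ContDiffAt ℝ k (fun p : ℝ × E3 => f p.1 p.2) (t, x)

/-- `U` is a (classical) solution of the mixed initial-boundary value problem `Π`. -/
structure IsSolution (c : Coefficients) (B : Set E3) (n : E3 → E3) (I : Set ℝ)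
    (p : BoundaryParts) (d : Data) (U : Fields) : Prop where
  smooth_u : ∀ i, SmoothUpToBoundary 4 B I (U.u i)
  smooth_θ : SmoothUpToBoundary 3 B I U.θ
  smooth_φ : SmoothUpToBoundary 4 B I U.φ
  /-- `τ_{ji,j} - μ_{kji,kj} + ρ f_i = ρ ü_i` -/
  motion : ∀ t ∈ I, ∀ x ∈ B, ∀ i,
    (∑ j, pd j (U.τ c j i t) x) - (∑ k, ∑ j, pd j (pd k (U.μ c k j i t)) x)
      + c.rho * d.f i t x = c.rho * dot (dot (U.u i)) t x
  /-- `σ_{i,i} - Q_{ji,ji} = g` -/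
  electric : ∀ t ∈ I, ∀ x ∈ B,
    (∑ i, pd i (U.σ c i t) x) - (∑ j, ∑ i, pd i (pd j (U.Q c j i t)) x) = d.g t x
  /-- `ρ T₀ η̇ + q_{i,i} - ρ r = 0` -/
  energy : ∀ t ∈ I, ∀ x ∈ B,
    c.rho * c.T0 * dot (U.η c) t x + (∑ i, pd i (U.q c i t) x) - c.rho * d.r t x = 0
  init_u : ∀ x ∈ closure B, ∀ i, U.u i 0 x = d.u₀ i x
  init_v : ∀ x ∈ closure B, ∀ i, dot (U.u i) 0 x = d.v₀ i x
  init_θ : ∀ x ∈ closure B, U.θ 0 x = d.θ₀ x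
  init_η : ∀ x ∈ closure B, U.η c 0 x = d.η₀ x
  bdry_u : ∀ t ∈ I, ∀ x ∈ p.S₁, ∀ i, U.u i t x = d.uHat i t x
  bdry_P : ∀ t ∈ I, ∀ x ∈ p.C₁, ∀ i, U.P c n i t x = d.PHat i t x
  bdry_Du : ∀ t ∈ I, ∀ x ∈ p.S₂, ∀ i, normalDeriv n (U.u i t) x = d.dHat i t x
  bdry_R : ∀ t ∈ I, ∀ x ∈ p.C₂, ∀ i, U.R c n i t x = d.RHat i t x
  bdry_θ : ∀ t ∈ I, ∀ x ∈ p.S₃, U.θ t x = d.θHat t x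
  bdry_q : ∀ t ∈ I, ∀ x ∈ p.C₃, ∑ i, U.q c i t x * n x i = d.qHat t x
  bdry_φ : ∀ t ∈ I, ∀ x ∈ p.S₄, U.φ t x = d.φHat t x
  bdry_Λ : ∀ t ∈ I, ∀ x ∈ p.C₄, U.Λ c n t x = d.ΛHat t x
  bdry_Dφ : ∀ t ∈ I, ∀ x ∈ p.S₅, normalDeriv n (U.φ t) x = d.ξHat t x
  bdry_H : ∀ t ∈ I, ∀ x ∈ p.C₅, U.H c n t x = d.HHat t x

end Thermopiezo

end

noncomputable section

namespace Thermopiezo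

open MeasureTheory Set Filter

/-! The problem is linear, so the difference of two solutions has zero loads and zero data
(`IsSolution.isNullSolution_diff`), and an energy argument shows that it vanishes
(`IsNullSolution.eq_zero`).

The density `storedEnergy` is the sum of the kinetic energy, W, G and β/2 times the dissipation form
at (-θ/β, ∇θ). The hypotheses make every summand nonnegative. G carries the electric self-coupling
terms with the sign opposite to the one they have in the free energy; adding `elecPower` = -(E_i σ_i
+ V_ij Q_ij) restores that sign and gives `energyDensity`, whose time derivative is computed in
`hasDerivAt_energyDensity`. Testing the equation of motion with u̇, the electric equation with φ̇
and the energy equation with χ removes everything from the integrated derivative except minus the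
dissipation, so ∫ `energyDensity` does not increase (`integral_rate`). Testing the electric equation
with φ gives ∫ `elecPower` = 0 at every time, so the integrals of the two densities coincide.

Neither θ̇ nor φ is prescribed at time 0, yet the initial energy vanishes: zero initial entropy
relates θ̇ to the electric field so that `energyDensity` is half of `elecPower` there
(`energyDensity_zero`), which has zero integral. Hence `storedEnergy` vanishes identically, and with
it u̇, E and χ. Then u is constant in time, θ solves θ + βθ̇ = 0 with zero initial value, and φ is
constant in space and vanishes at a point of S₄.

The integrations by parts avoid surface integrals. The divergence of a field tangential to ∂B has
zero integral over B (`integral_div_eq_zero`), proved with cutoffs built from the distance to the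
complement. In the second gradient theory the natural flux is the sum of the working of the
tractions and a surface divergence. Subtracting the divergence of an antisymmetric tensor, which is
itself divergence free, cancels the surface divergence pointwise and leaves a field that is
tangential under the boundary conditions (`integral_green`). -/

/-! ### The divergence theorem for tangential fields, by distance cutoffs. -/

/-- Multiply by a smooth function that is 1 near K and vanishes off a compact subset of the open set
where f is smooth. This makes fields on the closed region globally Lipschitz, and globalises the
normal, which is smooth only near ∂B. -/
theorem exists_contDiff_eq_near {k : ℕ} {K : Set E3} (hK : IsCompact K) {f : E3 → ℝ}
    (hf : ∀ x ∈ K, ContDiffAt ℝ k f x) :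
    ∃ g : E3 → ℝ, ContDiff ℝ k g ∧ HasCompactSupport g ∧ ∀ x ∈ K, g =ᶠ[𝓝 x] f := by
  have hU : IsOpen {x | ContDiffAt ℝ k f x} := by
    rw [isOpen_iff_mem_nhds]
    intro x hx
    exact ContDiffAt.eventually hx (by simp)
  obtain ⟨L, hL, hKL, hLU⟩ := exists_compact_between hK hU hf
  obtain ⟨ζ, h1, h0, -⟩ := exists_contMDiffMap_one_nhds_of_subset_interior (n := k)
    (modelWithCornersSelf ℝ E3) hK.isClosed hKL
  have hζ : ContDiff ℝ k ζ := ζ.contMDiff.contDiff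
  have hsub : tsupport (fun x => ζ x * f x) ⊆ L := by
    refine closure_minimal (fun x hx => ?_) hL.isClosed
    by_contra hxL
    exact hx (by simp [h0 x hxL])
  refine ⟨fun x => ζ x * f x, ?_, HasCompactSupport.of_support_subset_isCompact hL
    (subset_closure.trans hsub), ?_⟩
  · refine contDiff_iff_contDiffAt.2 fun x => ?_
    by_cases hx : x ∈ tsupport (fun x => ζ x * f x)
    · exact hζ.contDiffAt.mul (hLU (hsub hx))
    · exact (contDiffAt_const (c := (0 : ℝ))).congr_of_eventuallyEq
        (notMem_tsupport_iff_eventuallyEq.1 hx)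
  · intro x hx
    have := (eventually_nhdsSet_iff_forall.1 h1) x hx
    filter_upwards [this] with y hy
    simp [hy]

/-- Duality for a half-space: by perturbation the inequality persists on the bounding hyperplane,
and applied to the component of g in that hyperplane it forces this component to vanish. -/
theorem eq_smul_of_forall_inner_nonpos {a g : E3}
    (h : ∀ v, 0 < inner ℝ a v → inner ℝ g v ≤ 0) (ha : a ≠ 0) :
    ∃ r : ℝ, 0 ≤ r ∧ g = -(r • a) := by
  have haa : 0 < inner ℝ a a := real_inner_self_pos.2 ha
  have key : ∀ v, inner ℝ a v = 0 → inner ℝ g v ≤ 0 := by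
    intro v hv
    by_contra! hlt
    -- The step s is so small that the perturbation along a consumes at most half of the positive
    -- number ⟨g, v⟩.
    obtain ⟨s, hs, hs'⟩ : ∃ s : ℝ, 0 < s ∧ 0 < inner ℝ g v + s * inner ℝ g a := by
      refine ⟨inner ℝ g v / (2 * (|inner ℝ g a| + 1)), by positivity, ?_⟩
      have h1 : inner ℝ g v / (2 * (|inner ℝ g a| + 1)) * inner ℝ g a
          ≥ - (inner ℝ g v / (2 * (|inner ℝ g a| + 1)) * (|inner ℝ g a| + 1)) := by
        have h2 : 0 < inner ℝ g v / (2 * (|inner ℝ g a| + 1)) := by positivity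
        nlinarith [neg_abs_le (inner ℝ g a : ℝ)]
      have h3 : inner ℝ g v / (2 * (|inner ℝ g a| + 1)) * (|inner ℝ g a| + 1)
          = inner ℝ g v / 2 := by
        have : |(inner ℝ g a : ℝ)| + 1 ≠ 0 := by positivity
        field_simp
      linarith
    have := h (v + s • a) (by rw [inner_add_right, inner_smul_right, hv]; positivity)
    rw [inner_add_right, inner_smul_right] at this
    linarith
  set r : ℝ := inner ℝ a g / inner ℝ a a with hr
  have hperp : inner ℝ a (g - r • a) = 0 := by
    rw [inner_sub_right, inner_smul_right, hr]
    field_simp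
    ring
  have h1 := key _ hperp
  have h3 : inner ℝ (g - r • a) (g - r • a) ≤ 0 := by
    rw [inner_sub_left, inner_smul_left, hperp]
    simpa using h1
  have h4 : g = r • a := sub_eq_zero.1 (by
    rw [real_inner_self_eq_norm_sq] at h3
    exact norm_eq_zero.1 (by nlinarith [norm_nonneg (g - r • a)]))
  have h5 : inner ℝ g a ≤ 0 := h a haa
  refine ⟨-r, ?_, by rw [h4]; simp⟩
  rw [h4, inner_smul_left] at h5
  simp only [conj_trivial] at h5
  nlinarith

theorem fderiv_apply_nonpos_of_right {f : E3 → ℝ} {x v : E3} {c : ℝ} (hf : DifferentiableAt ℝ f x)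
    (h : ∀ᶠ s in 𝓝[>] (0 : ℝ), f (x + s • v) ≤ f x + s * c) : fderiv ℝ f x v ≤ c := by
  have h1 := (hf.hasFDerivAt.hasLineDerivAt v).tendsto_slope_zero_right
  refine le_of_tendsto h1 ?_
  filter_upwards [h, self_mem_nhdsWithin] with s hs hs0
  have hs0' : (0 : ℝ) < s := hs0
  simp only [smul_eq_mul]
  rw [inv_mul_le_iff₀ hs0']
  linarith

/-- An interior ball touching ∂B at p determines the normal there: directions pointing strictly into
the ball enter B, where ψ < 0 ≤ ψ(p), so ∇ψ is nonpositive on an open half-space and must be a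
multiple of p - x. -/
theorem IsRegularRegion.normal_eq_of_ball {B : Set E3} {n : E3 → E3} (hB : IsRegularRegion B n)
    {x p : E3} (hp : p ∈ frontier B) (hne : x ≠ p) (hball : Metric.ball x (dist x p) ⊆ B) :
    n p = ‖p - x‖⁻¹ • (p - x) := by
  obtain ⟨ψ, hψ, hn⟩ := hB.normal_eq p hp
  have hpB : p ∉ B := fun h => by
    have := hB.isOpen.frontier_eq ▸ hp
    exact this.2 h
  have hψp : 0 ≤ ψ p := by
    by_contra! h
    exact hpB (hψ.mem_iff.self_of_nhds.2 h)
  have hd : DifferentiableAt ℝ ψ p := hψ.contDiffAt.differentiableAt (by norm_num)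
  obtain ⟨r, hr0, hr⟩ := eq_smul_of_forall_inner_nonpos (a := x - p) (g := gradient ψ p) (by
    intro v hv
    rw [gradient, InnerProductSpace.toDual_symm_apply]
    refine fderiv_apply_nonpos_of_right hd ?_
    have hcont : Tendsto (fun s : ℝ => p + s • v) (𝓝[>] 0) (𝓝 p) := by
      have : Continuous fun s : ℝ => p + s • v := by fun_prop
      have := this.tendsto 0
      simp only [zero_smul, add_zero] at this
      exact this.mono_left nhdsWithin_le_nhds
    -- For s > 0, expanding |s v - (x - p)|² shows that this is exactly the condition for p + s v to
    -- lie in the ball.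
    have hsmall : ∀ᶠ s in 𝓝[>] (0 : ℝ), s * ‖v‖ ^ 2 < 2 * inner ℝ (x - p) v := by
      have : Continuous fun s : ℝ => s * ‖v‖ ^ 2 := by fun_prop
      have := this.tendsto 0
      rw [zero_mul] at this
      exact (this.mono_left nhdsWithin_le_nhds).eventually (gt_mem_nhds (by positivity))
    filter_upwards [hcont.eventually hψ.mem_iff, hsmall, self_mem_nhdsWithin] with s h1 h2 h3
    have hs : (0 : ℝ) < s := h3
    have : p + s • v ∈ B := hball (by
      rw [Metric.mem_ball, dist_eq_norm, dist_eq_norm]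
      refine lt_of_pow_lt_pow_left₀ 2 (norm_nonneg _) ?_
      have : p + s • v - x = s • v - (x - p) := by abel
      rw [this, norm_sub_sq_real, norm_smul, inner_smul_left, real_inner_comm]
      simp only [conj_trivial, mul_pow, Real.norm_eq_abs, sq_abs]
      nlinarith)
    have := h1.1 this
    linarith) (sub_ne_zero.2 hne)
  have hg := hψ.gradient_ne_zero
  have hrpos : 0 < r := hr0.lt_of_ne (by rintro rfl; simp [hr] at hg)
  have hne' : ‖p - x‖ ≠ 0 := norm_ne_zero_iff.2 (sub_ne_zero.2 hne.symm)
  have hr' : gradient ψ p = r • (p - x) := by rw [hr, ← smul_neg, neg_sub]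
  rw [hn, hr', norm_smul, smul_smul, Real.norm_of_nonneg hr0]
  congr 1
  field_simp

/-- The distance is 1-Lipschitz, so its gradient g has norm at most 1, while moving along the unit
vector ω towards p decreases it at rate at least 1. This is the equality case of Cauchy–Schwarz: |g
+ ω|² ≤ 1 - 2 + 1 = 0. -/
theorem fderiv_infDist_apply {S : Set E3} {x p : E3} (hp : p ∈ S) (hne : x ≠ p)
    (hmin : Metric.infDist x S = dist x p)
    (hd : DifferentiableAt ℝ (fun y => Metric.infDist y S) x) (v : E3) :
    fderiv ℝ (fun y => Metric.infDist y S) x v = - inner ℝ (‖p - x‖⁻¹ • (p - x)) v := by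
  set ω : E3 := ‖p - x‖⁻¹ • (p - x) with hω
  have hr : 0 < ‖p - x‖ := norm_pos_iff.2 (sub_ne_zero.2 hne.symm)
  have hω1 : ‖ω‖ = 1 := by
    rw [hω, norm_smul, norm_inv, norm_norm, inv_mul_cancel₀ hr.ne']
  set L := fderiv ℝ (fun y => Metric.infDist y S) x with hL
  have hL1 : ‖L‖ ≤ 1 := by
    have := norm_fderiv_le_of_lipschitz ℝ (Metric.lipschitz_infDist_pt S) (x₀ := x)
    simpa using this
  have hLω : L ω ≤ -1 := by
    refine fderiv_apply_nonpos_of_right hd ?_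
    have : Set.Ioo (0 : ℝ) ‖p - x‖ ∈ 𝓝[>] (0 : ℝ) := Ioo_mem_nhdsGT hr
    filter_upwards [this] with s hs
    refine (Metric.infDist_le_dist_of_mem hp).trans ?_
    rw [hmin, dist_eq_norm, dist_eq_norm, norm_sub_rev x p]
    have : x + s • ω - p = -((1 - s * ‖p - x‖⁻¹) • (p - x)) := by
      rw [hω, smul_smul, sub_smul, one_smul]; abel
    rw [this, norm_neg, norm_smul, Real.norm_of_nonneg]
    · rw [sub_mul, mul_assoc, inv_mul_cancel₀ hr.ne']; linarith
    · rw [← div_eq_mul_inv, sub_nonneg, div_le_one hr]; exact hs.2.le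
  set g : E3 := (InnerProductSpace.toDual ℝ E3).symm L with hg
  have hgL : ∀ w, inner ℝ g w = L w := fun w => InnerProductSpace.toDual_symm_apply
  have hg1 : ‖g‖ ≤ 1 := by rw [hg, LinearIsometryEquiv.norm_map]; exact hL1
  have h0 : ‖g + ω‖ ^ 2 ≤ 0 := by
    rw [norm_add_sq_real, hgL, hω1]
    nlinarith [norm_nonneg g]
  have h1 : g + ω = 0 := by
    have : ‖g + ω‖ = 0 := by nlinarith [norm_nonneg (g + ω)]
    exact norm_eq_zero.1 this
  rw [← hgL, eq_neg_of_add_eq_zero_left h1, inner_neg_left]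

/-- A Lipschitz approximation of the indicator function of the complement of `S`. -/
def interiorCutoff (S : Set E3) (ε : ℝ) (x : E3) : ℝ := min 1 (ε⁻¹ * Metric.infDist x S)

theorem interiorCutoff_nonneg (S : Set E3) {ε : ℝ} (hε : 0 < ε) (x : E3) :
    0 ≤ interiorCutoff S ε x :=
  le_min zero_le_one (mul_nonneg (inv_nonneg.2 hε.le) Metric.infDist_nonneg)

theorem interiorCutoff_le_one (S : Set E3) (ε : ℝ) (x : E3) : interiorCutoff S ε x ≤ 1 :=
  min_le_left _ _

theorem interiorCutoff_of_mem {S : Set E3} (ε : ℝ) {x : E3} (hx : x ∈ S) :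
    interiorCutoff S ε x = 0 := by
  simp [interiorCutoff, Metric.infDist_zero_of_mem hx]

theorem interiorCutoff_of_le {S : Set E3} {ε : ℝ} (hε : 0 < ε) {x : E3}
    (hx : ε ≤ Metric.infDist x S) : interiorCutoff S ε x = 1 := by
  refine min_eq_left ?_
  rw [inv_mul_eq_div, le_div_iff₀ hε]
  linarith

theorem interiorCutoff_lipschitz (S : Set E3) (ε : ℝ) :
    ∃ C, LipschitzWith C (interiorCutoff S ε) := by
  have h : LipschitzWith (‖ε⁻¹‖₊ * 1) fun x => ε⁻¹ • Metric.infDist x S :=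
    (lipschitzWith_smul ε⁻¹).comp (Metric.lipschitz_infDist_pt S)
  exact ⟨_, h.const_min 1⟩

/-- No differentiability is needed: at an extremum `fderiv` is zero whether or not the function is
differentiable. The next lemma uses a maximum in the same way. -/
theorem fderiv_interiorCutoff_of_mem {S : Set E3} {ε : ℝ} (hε : 0 < ε) {x : E3} (hx : x ∈ S) :
    fderiv ℝ (interiorCutoff S ε) x = 0 := by
  refine IsLocalMin.fderiv_eq_zero (Eventually.of_forall fun y => ?_)
  rw [interiorCutoff_of_mem ε hx]
  exact interiorCutoff_nonneg S hε y

theorem fderiv_interiorCutoff_of_le {S : Set E3} {ε : ℝ} (hε : 0 < ε) {x : E3}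
    (hx : ε ≤ Metric.infDist x S) : fderiv ℝ (interiorCutoff S ε) x = 0 := by
  refine IsLocalMax.fderiv_eq_zero (Eventually.of_forall fun y => ?_)
  rw [interiorCutoff_of_le hε hx]
  exact interiorCutoff_le_one S ε y

theorem fderiv_interiorCutoff_of_lt {S : Set E3} {ε : ℝ} (hε : 0 < ε) {x : E3}
    (hx : Metric.infDist x S < ε) (hd : DifferentiableAt ℝ (fun y => Metric.infDist y S) x) :
    fderiv ℝ (interiorCutoff S ε) x = ε⁻¹ • fderiv ℝ (fun y => Metric.infDist y S) x := by
  have h : interiorCutoff S ε =ᶠ[𝓝 x] fun y => ε⁻¹ • Metric.infDist y S := by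
    have hc : Continuous fun y => Metric.infDist y S := Metric.continuous_infDist_pt S
    filter_upwards [hc.continuousAt.eventually (gt_mem_nhds hx)] with y hy
    refine min_eq_right ?_
    rw [inv_mul_eq_div, div_le_one hε]
    exact hy.le
  rw [h.fderiv_eq, fderiv_fun_const_smul hd]

theorem IsRegularRegion.exists_nearest {B : Set E3} {n : E3 → E3} (hB : IsRegularRegion B n)
    {x : E3} (hx : x ∈ B) : ∃ p ∈ frontier B, x ≠ p ∧ Metric.infDist x Bᶜ = dist x p ∧
      n p = ‖p - x‖⁻¹ • (p - x) := by
  -- A bounded set cannot be the whole noncompact space.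
  have hne : (Bᶜ).Nonempty := by
    rw [nonempty_compl]
    rintro rfl
    exact (NormedSpace.noncompactSpace ℝ E3).noncompact_univ
      (Metric.isCompact_of_isClosed_isBounded isClosed_univ hB.isBounded)
  obtain ⟨p, hp, hd⟩ := hB.isOpen.isClosed_compl.exists_infDist_eq_dist hne x
  have hxp : x ≠ p := by rintro rfl; exact hp hx
  have hball : Metric.ball x (dist x p) ⊆ B := by
    intro y hy
    by_contra hyB
    have := Metric.infDist_le_dist_of_mem (x := x) (show y ∈ Bᶜ from hyB)
    rw [hd] at this
    rw [Metric.mem_ball, dist_comm] at hy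
    linarith
  have hpf : p ∈ frontier B := by
    rw [hB.isOpen.frontier_eq]
    refine ⟨?_, hp⟩
    have h1 : p ∈ closure (Metric.ball x (dist x p)) := by
      rw [closure_ball x (dist_ne_zero.2 hxp), Metric.mem_closedBall, dist_comm]
    exact closure_mono hball h1
  exact ⟨p, hpf, hxp, hd, hB.normal_eq_of_ball hpf hxp hball⟩

theorem IsRegularRegion.frontier_eq {B : Set E3} {n : E3 → E3} (hB : IsRegularRegion B n) :
    frontier B = closure B \ B := hB.isOpen.frontier_eq

theorem IsRegularRegion.isCompact_closure {B : Set E3} {n : E3 → E3} (hB : IsRegularRegion B n) :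
    IsCompact (closure B) := hB.isBounded.isCompact_closure

theorem fderiv_eq_sum_pd (f : E3 → ℝ) (x v : E3) :
    fderiv ℝ f x v = ∑ i, v i * pd i f x := by
  conv_lhs => rw [← (EuclideanSpace.basisFun (Fin 3) ℝ).sum_repr v]
  simp [pd, map_sum]

theorem inner_eq_sum (v w : E3) : inner ℝ v w = ∑ i, v i * w i := by
  simp [PiLp.inner_apply, mul_comm]

/-- The flux of a field that is tangential on the boundary through the level sets of the distance
to the boundary is controlled by the Lipschitz constants of the field. -/
theorem IsRegularRegion.abs_flux_le {B : Set E3} {n : E3 → E3} (hB : IsRegularRegion B n)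
    {X : Fin 3 → E3 → ℝ} {C : Fin 3 → NNReal} (hX : ∀ i, LipschitzWith (C i) (X i))
    (hXn : ∀ x ∈ frontier B, ∑ i, X i x * n x i = 0) {ε : ℝ} (hε : 0 < ε) {x : E3}
    (hd : DifferentiableAt ℝ (fun y => Metric.infDist y Bᶜ) x) :
    |∑ i, pd i (interiorCutoff Bᶜ ε) x * X i x|
      ≤ {y | y ∈ B ∧ Metric.infDist y Bᶜ < ε}.indicator (fun _ => ∑ i, (C i : ℝ)) x := by
  by_cases hxB : x ∈ B
  swap
  · have h0 : fderiv ℝ (interiorCutoff Bᶜ ε) x = 0 := fderiv_interiorCutoff_of_mem hε hxB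
    have : x ∉ {y | y ∈ B ∧ Metric.infDist y Bᶜ < ε} := fun h => hxB h.1
    simp [pd, h0, indicator_of_notMem this]
  by_cases hlt : Metric.infDist x Bᶜ < ε
  swap
  · have h0 : fderiv ℝ (interiorCutoff Bᶜ ε) x = 0 :=
      fderiv_interiorCutoff_of_le hε (not_lt.1 hlt)
    have : x ∉ {y | y ∈ B ∧ Metric.infDist y Bᶜ < ε} := fun h => hlt h.2
    simp [pd, h0, indicator_of_notMem this]
  have hmem : x ∈ {y | y ∈ B ∧ Metric.infDist y Bᶜ < ε} := ⟨hxB, hlt⟩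
  rw [indicator_of_mem hmem]
  obtain ⟨p, hpf, hxp, hdist, hn⟩ := hB.exists_nearest hxB
  have hpB : p ∈ Bᶜ := by rw [hB.frontier_eq] at hpf; exact hpf.2
  have hpd : ∀ i, pd i (interiorCutoff Bᶜ ε) x = - (ε⁻¹ * n p i) := by
    intro i
    rw [pd, fderiv_interiorCutoff_of_lt hε hlt hd, smul_apply,
      fderiv_infDist_apply hpB hxp hdist hd, ← hn, smul_eq_mul, mul_neg,
      EuclideanSpace.inner_single_right]
    simp
  have hn1 : ‖n p‖ = 1 := by
    rw [hn, norm_smul, norm_inv, norm_norm, inv_mul_cancel₀]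
    exact norm_ne_zero_iff.2 (sub_ne_zero.2 hxp.symm)
  have hni : ∀ i, |n p i| ≤ 1 := fun i => by
    rw [← hn1, ← Real.norm_eq_abs]; exact PiLp.norm_apply_le (n p) i
  -- Since X · n vanishes at the nearest boundary point p, X(p) may be subtracted for free. The
  -- Lipschitz bound then yields a factor ε that cancels the ε⁻¹ in the gradient of the cutoff.
  have hsum : ∑ i, pd i (interiorCutoff Bᶜ ε) x * X i x
      = ∑ i, -(ε⁻¹ * n p i * (X i x - X i p)) := by
    have := hXn p hpf
    have h2 : ∑ i, -(ε⁻¹ * n p i * (X i x - X i p))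
      = ∑ i, pd i (interiorCutoff Bᶜ ε) x * X i x + ε⁻¹ * ∑ i, X i p * n p i := by
      rw [Finset.mul_sum, ← Finset.sum_add_distrib]
      refine Finset.sum_congr rfl fun i _ => ?_
      rw [hpd]; ring
    rw [h2, this]; ring
  rw [hsum]
  refine (Finset.abs_sum_le_sum_abs _ _).trans (Finset.sum_le_sum fun i _ => ?_)
  have h1 : |X i x - X i p| ≤ C i * ε := by
    have := (hX i).dist_le_mul x p
    rw [Real.dist_eq] at this
    refine this.trans (mul_le_mul_of_nonneg_left ?_ (C i).2)
    rw [← hdist]; exact hlt.le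
  rw [abs_neg, abs_mul, abs_mul, abs_of_pos (inv_pos.2 hε)]
  calc ε⁻¹ * |n p i| * |X i x - X i p| ≤ ε⁻¹ * 1 * (C i * ε) := by
        gcongr
        exact hni i
    _ = C i := by field_simp

theorem lineDeriv_single (f : E3 → ℝ) (hf : Differentiable ℝ f) (i : Fin 3) (x : E3) :
    lineDeriv ℝ f x (EuclideanSpace.single i 1) = pd i f x :=
  (hf x).lineDeriv_eq_fderiv

/-- Integrate div X against the cutoff and move the derivative onto the cutoff, which is legitimate
for Lipschitz functions. As ε → 0 one side tends to the integral over B and the other to zero by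
`abs_flux_le`. -/
theorem IsRegularRegion.integral_div_eq_zero_of_compactSupport {B : Set E3} {n : E3 → E3}
    (hB : IsRegularRegion B n) {X : Fin 3 → E3 → ℝ} (hX : ∀ i, ContDiff ℝ 1 (X i))
    (hXc : ∀ i, HasCompactSupport (X i)) (hXn : ∀ x ∈ frontier B, ∑ i, X i x * n x i = 0) :
    ∫ x in B, ∑ i, pd i (X i) x = 0 := by
  choose C hC using fun i => (hX i).lipschitzWith_of_hasCompactSupport (hXc i) (by norm_num)
  have hpdc : ∀ i, Continuous (pd i (X i)) := fun i =>
    ((hX i).continuous_fderiv (by norm_num)).clm_apply continuous_const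
  have hpds : ∀ i, HasCompactSupport (pd i (X i)) := fun i =>
    (hXc i).fderiv_apply (𝕜 := ℝ) _
  set ε : ℕ → ℝ := fun k => 1 / ((k : ℝ) + 1) with hεdef
  have hε : ∀ k, 0 < ε k := fun k => by positivity
  have hε0 : Tendsto ε atTop (𝓝 0) := tendsto_one_div_add_atTop_nhds_zero_nat
  set G : ℕ → E3 → ℝ := fun k x => ∑ i, lineDeriv ℝ (interiorCutoff Bᶜ (ε k)) x
    (EuclideanSpace.single i 1) * X i x with hG
  set F : ℕ → E3 → ℝ := fun k x => (∑ i, pd i (X i) x) * interiorCutoff Bᶜ (ε k) x with hF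
  have hlip : ∀ k, ∃ D, LipschitzWith D (interiorCutoff Bᶜ (ε k)) := fun k =>
    interiorCutoff_lipschitz _ _
  choose D hD using hlip
  have hparts : ∀ k, ∫ x, F k x = - ∫ x, G k x := by
    intro k
    have h1 : ∀ i, ∫ x, lineDeriv ℝ (interiorCutoff Bᶜ (ε k)) x (EuclideanSpace.single i 1) * X i x
        = - ∫ x, pd i (X i) x * interiorCutoff Bᶜ (ε k) x := by
      intro i
      rw [(hD k).integral_lineDeriv_mul_eq (hC i) (hXc i), ← integral_neg]
      refine integral_congr_ae (Eventually.of_forall fun x => ?_)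
      simp only [lineDeriv_neg, lineDeriv_single _ ((hX i).differentiable (by norm_num))]
      ring
    have i1 : ∀ i, Integrable fun x => pd i (X i) x * interiorCutoff Bᶜ (ε k) x := fun i =>
      ((hpdc i).mul (hD k).continuous).integrable_of_hasCompactSupport (hpds i).mul_right
    have i2 : ∀ i, Integrable fun x => lineDeriv ℝ (interiorCutoff Bᶜ (ε k)) x
        (EuclideanSpace.single i 1) * X i x := fun i =>
      ((hD k).locallyIntegrable_lineDeriv (μ := volume) _).integrable_smul_right_of_hasCompactSupport
        (hX i).continuous (hXc i)
    simp only [hF, hG, Finset.sum_mul]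
    rw [integral_finsetSum _ fun i _ => i1 i, integral_finsetSum _ fun i _ => i2 i,
      ← Finset.sum_neg_distrib]
    exact Finset.sum_congr rfl fun i _ => by rw [h1, neg_neg]
  have hdivc : Continuous fun x => ∑ i, pd i (X i) x := continuous_finsetSum _ fun i _ => hpdc i
  have hdivint : Integrable fun x => ∑ i, pd i (X i) x := integrable_finsetSum _ fun i _ =>
    (hpdc i).integrable_of_hasCompactSupport (hpds i)
  have hposB : ∀ x ∈ B, 0 < Metric.infDist x Bᶜ := by
    intro x hx
    obtain ⟨p, -, hxp, hd, -⟩ := hB.exists_nearest hx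
    rw [hd]; exact dist_pos.2 hxp
  have hlimF : Tendsto (fun k => ∫ x, F k x) atTop (𝓝 (∫ x in B, ∑ i, pd i (X i) x)) := by
    rw [← integral_indicator hB.isOpen.measurableSet]
    refine tendsto_integral_of_dominated_convergence (fun x => ‖∑ i, pd i (X i) x‖)
      (fun k => (hdivc.mul (hD k).continuous).aestronglyMeasurable) hdivint.norm
      (fun k => Eventually.of_forall fun x => ?_) (Eventually.of_forall fun x => ?_)
    · rw [hF, norm_mul, Real.norm_of_nonneg (interiorCutoff_nonneg _ (hε k) x)]
      exact mul_le_of_le_one_right (norm_nonneg _) (interiorCutoff_le_one _ _ _)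
    · by_cases hx : x ∈ B
      · rw [indicator_of_mem hx]
        refine tendsto_const_nhds.congr' ?_
        filter_upwards [hε0.eventually (gt_mem_nhds (hposB x hx))] with k hk
        simp only [hF]
        rw [interiorCutoff_of_le (hε k) hk.le, mul_one]
      · rw [indicator_of_notMem hx]
        refine tendsto_const_nhds.congr fun k => ?_
        simp only [hF]
        rw [interiorCutoff_of_mem _ (show x ∈ Bᶜ from hx), mul_zero]
  -- The flux densities are bounded by a constant independent of k and live on collars that
  -- eventually exclude each point, so dominated convergence applies with a constant on the bounded
  -- set B.
  have hlimG : Tendsto (fun k => ∫ x, G k x) atTop (𝓝 (∫ _ : E3, (0 : ℝ))) := by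
    have hae : ∀ᵐ x : E3, DifferentiableAt ℝ (fun y => Metric.infDist y Bᶜ) x :=
      (Metric.lipschitz_infDist_pt Bᶜ).ae_differentiableAt
    have hae2 : ∀ᵐ x : E3, ∀ k, DifferentiableAt ℝ (interiorCutoff Bᶜ (ε k)) x :=
      ae_all_iff.2 fun k => (hD k).ae_differentiableAt
    have hbound : ∀ᵐ x : E3, ∀ k, ‖G k x‖
        ≤ {y | y ∈ B ∧ Metric.infDist y Bᶜ < ε k}.indicator (fun _ => ∑ i, (C i : ℝ)) x := by
      filter_upwards [hae, hae2] with x h1 h2 k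
      have h3 := hB.abs_flux_le hC hXn (hε k) h1
      simp only [hG, (h2 k).lineDeriv_eq_fderiv]
      exact h3
    have hCn : 0 ≤ ∑ i, (C i : ℝ) := Finset.sum_nonneg fun i _ => (C i).2
    refine tendsto_integral_of_dominated_convergence (B.indicator fun _ => ∑ i, (C i : ℝ))
      (fun k => ?_) ?_ (fun k => ?_) ?_
    · refine Finset.aestronglyMeasurable_fun_sum _ fun i _ => ?_
      exact (aestronglyMeasurable_lineDeriv (hD k).continuous _).mul
        (hX i).continuous.aestronglyMeasurable
    · rw [integrable_indicator_iff hB.isOpen.measurableSet]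
      exact integrableOn_const hB.isBounded.measure_lt_top.ne
    · filter_upwards [hbound] with x hx
      refine (hx k).trans (indicator_le_indicator_of_subset (fun y hy => hy.1) (fun _ => hCn) x)
    · filter_upwards [hbound] with x hx
      refine tendsto_const_nhds.congr' ?_
      have : ∀ᶠ k in atTop, x ∉ {y | y ∈ B ∧ Metric.infDist y Bᶜ < ε k} := by
        by_cases hxB : x ∈ B
        · filter_upwards [hε0.eventually (gt_mem_nhds (hposB x hxB))] with k hk h
          exact lt_asymm hk h.2
        · exact Eventually.of_forall fun k h => hxB h.1
      filter_upwards [this] with k hk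
      have := hx k
      rw [indicator_of_notMem (s := {y | y ∈ B ∧ Metric.infDist y Bᶜ < ε k}) hk, norm_le_zero_iff] at this
      exact this.symm
  have := tendsto_nhds_unique hlimF (by simpa only [hparts] using hlimG.neg)
  simpa using this

theorem pd_congr {f g : E3 → ℝ} {x : E3} (h : f =ᶠ[𝓝 x] g) (i : Fin 3) : pd i f x = pd i g x := by
  rw [pd, pd, h.fderiv_eq]

/-- The divergence theorem for fields that are tangential on the boundary. -/
theorem IsRegularRegion.integral_div_eq_zero {B : Set E3} {n : E3 → E3}
    (hB : IsRegularRegion B n) {X : Fin 3 → E3 → ℝ}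
    (hX : ∀ i, ∀ x ∈ closure B, ContDiffAt ℝ 1 (X i) x)
    (hXn : ∀ x ∈ frontier B, ∑ i, X i x * n x i = 0) :
    ∫ x in B, ∑ i, pd i (X i) x = 0 := by
  choose Y hY hYc hYX using fun i => exists_contDiff_eq_near (k := 1) hB.isCompact_closure
    (f := X i) (fun x hx => by exact_mod_cast hX i x hx)
  rw [← hB.integral_div_eq_zero_of_compactSupport (X := Y) (fun i => by exact_mod_cast hY i) hYc]
  · refine setIntegral_congr_fun hB.isOpen.measurableSet fun x hx => ?_
    exact Finset.sum_congr rfl fun i _ => (pd_congr (hYX i x (subset_closure hx)) i).symm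
  · intro x hx
    rw [← hXn x hx]
    exact Finset.sum_congr rfl fun i _ => by
      rw [(hYX i x (frontier_subset_closure hx)).self_of_nhds]

/-! ### Calculus of partial derivatives -/

section pd
variable {f g : E3 → ℝ} {x : E3} (i j : Fin 3)

theorem pd_fun_add (hf : DifferentiableAt ℝ f x) (hg : DifferentiableAt ℝ g x) :
    pd i (fun y => f y + g y) x = pd i f x + pd i g x := by
  simp [pd, fderiv_fun_add hf hg]

theorem pd_fun_sub (hf : DifferentiableAt ℝ f x) (hg : DifferentiableAt ℝ g x) :
    pd i (fun y => f y - g y) x = pd i f x - pd i g x := by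
  simp [pd, fderiv_fun_sub hf hg]

theorem pd_fun_mul (hf : DifferentiableAt ℝ f x) (hg : DifferentiableAt ℝ g x) :
    pd i (fun y => f y * g y) x = pd i f x * g x + f x * pd i g x := by
  simp [pd, fderiv_fun_mul hf hg]
  ring

theorem pd_fun_neg : pd i (fun y => -f y) x = -pd i f x := by
  simp [pd, fderiv_fun_neg]

theorem pd_fun_const_mul (a : ℝ) (hf : DifferentiableAt ℝ f x) :
    pd i (fun y => a * f y) x = a * pd i f x := by
  simp [pd, fderiv_const_mul hf]

theorem pd_fun_sum {ι : Type*} {s : Finset ι} {F : ι → E3 → ℝ}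
    (hF : ∀ k ∈ s, DifferentiableAt ℝ (F k) x) :
    pd i (fun y => ∑ k ∈ s, F k y) x = ∑ k ∈ s, pd i (F k) x := by
  simp [pd, fderiv_fun_sum hF]

theorem contDiffAt_pd {k : ℕ} (hf : ContDiffAt ℝ (k + 1 : ℕ) f x) : ContDiffAt ℝ k (pd i f) x :=
  (hf.fderiv_right (m := k) (by norm_cast)).clm_apply contDiffAt_const

theorem pd_comm (hf : ContDiffAt ℝ 2 f x) : pd i (pd j f) x = pd j (pd i f) x := by
  have h : IsSymmSndFDerivAt ℝ f x := hf.isSymmSndFDerivAt (by simp)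
  have hd : DifferentiableAt ℝ (fderiv ℝ f) x :=
    (hf.fderiv_right (m := 1) (by norm_num)).differentiableAt (by norm_num)
  have key : ∀ a b : Fin 3, pd a (pd b f) x = fderiv ℝ (fderiv ℝ f) x
      (EuclideanSpace.single a 1) (EuclideanSpace.single b 1) := by
    intro a b
    change fderiv ℝ (fun y => fderiv ℝ f y (EuclideanSpace.single b 1)) x _ = _
    rw [fderiv_clm_apply hd (differentiableAt_const _)]
    simp
  rw [key, key, h.eq]

end pd

/-! ### Operators of the second gradient theory -/

/-- `S_{j,j} - M_{kj,kj}`. -/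
def bodyForce (S : Fin 3 → E3 → ℝ) (M : Fin 3 → Fin 3 → E3 → ℝ) (x : E3) : ℝ :=
  (∑ j, pd j (S j) x) - ∑ k, ∑ j, pd j (pd k (M k j)) x

/-- `(S_j - M_{kj,k}) n_j - 𝒟_j (M_kj n_k) + (𝒟_l n_l) M_kj n_k n_j`. -/
def surfaceForce (n : E3 → E3) (S : Fin 3 → E3 → ℝ) (M : Fin 3 → Fin 3 → E3 → ℝ) (x : E3) : ℝ :=
  (∑ j, (S j x - ∑ k, pd k (M k j) x) * n x j)
  - (∑ j, surfDeriv n j (fun y => ∑ k, M k j y * n y k) x)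
  + (∑ l, surfDeriv n l (fun y => n y l) x) * ∑ k, ∑ j, M k j x * n x k * n x j

/-- `M_kj n_k n_j`. -/
def surfaceMoment (n : E3 → E3) (M : Fin 3 → Fin 3 → E3 → ℝ) (x : E3) : ℝ :=
  ∑ k, ∑ j, M k j x * n x k * n x j

/-! ### The unit normal -/

theorem IsRegularRegion.sum_normal_sq {B : Set E3} {n : E3 → E3} (hB : IsRegularRegion B n)
    {x : E3} (hx : x ∈ frontier B) : ∑ i, n x i * n x i = 1 := by
  obtain ⟨ψ, hψ, hn⟩ := hB.normal_eq x hx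
  rw [← inner_eq_sum, real_inner_self_eq_norm_sq, hn, norm_smul, norm_inv, norm_norm,
    inv_mul_cancel₀ (norm_ne_zero_iff.2 hψ.gradient_ne_zero), one_pow]

theorem IsLocalDefiningFunction.apply_eq_zero {B : Set E3} {x : E3} {ψ : E3 → ℝ}
    (hψ : IsLocalDefiningFunction B x ψ) (hB : IsOpen B) (hx : x ∈ frontier B) : ψ x = 0 := by
  rw [hB.frontier_eq] at hx
  refine le_antisymm ?_ ?_
  · have h1 : ∃ᶠ y in 𝓝 x, y ∈ B := mem_closure_iff_frequently.1 hx.1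
    have h2 : ∃ᶠ y in 𝓝 x, ψ y ≤ 0 :=
      (h1.and_eventually hψ.mem_iff).mono fun y hy => (hy.2.1 hy.1).le
    by_contra! h
    exact h2 ((hψ.contDiffAt.continuousAt.eventually (lt_mem_nhds h)).mono fun y hy => not_le.2 hy)
  · by_contra! h
    exact hx.2 (hψ.mem_iff.self_of_nhds.2 h)

/-- Near x the gradient of ψ does not vanish. A zero of ψ outside the closure of B would be a local
minimum, because ψ ≥ 0 off B, and so a critical point. -/
theorem IsLocalDefiningFunction.eventually_mem_frontier {B : Set E3} {x : E3} {ψ : E3 → ℝ}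
    (hψ : IsLocalDefiningFunction B x ψ) (hB : IsOpen B) :
    ∀ᶠ y in 𝓝 x, ψ y = 0 → y ∈ frontier B := by
  have h1 : ∀ᶠ y in 𝓝 x, fderiv ℝ ψ y ≠ 0 := by
    have hc : ContinuousAt (fderiv ℝ ψ) x :=
      (hψ.contDiffAt.fderiv_right (m := 2) (by norm_num)).continuousAt
    refine hc.eventually_ne fun h => hψ.gradient_ne_zero ?_
    rw [gradient, h, map_zero]
  filter_upwards [h1, eventually_eventually_nhds.2 hψ.mem_iff] with y hy1 hy2 hy0
  rw [hB.frontier_eq]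
  refine ⟨?_, fun h => ?_⟩
  · by_contra hyc
    refine hy1 (IsLocalMin.fderiv_eq_zero ?_)
    filter_upwards [hy2, isClosed_closure.isOpen_compl.mem_nhds hyc] with z hz1 hz2
    rw [hy0]
    by_contra! hz
    exact hz2 (subset_closure (hz1.2 hz))
  · have := hy2.self_of_nhds.1 h
    linarith

theorem IsRegularRegion.contDiffAt_normal {B : Set E3} {n : E3 → E3} (hB : IsRegularRegion B n)
    {x : E3} (hx : x ∈ frontier B) (i : Fin 3) : ContDiffAt ℝ 2 (fun y => n y i) x :=
  contDiffAt_euclidean.1 (hB.normal_contDiffAt x hx) i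

/-- The gradient of `n_i n_i` is normal to the boundary. -/
theorem IsRegularRegion.exists_normal_mul_pd {B : Set E3} {n : E3 → E3}
    (hB : IsRegularRegion B n) {x : E3} (hx : x ∈ frontier B) :
    ∃ r : ℝ, ∀ j, ∑ i, n x i * pd j (fun y => n y i) x = r * n x j := by
  obtain ⟨ψ, hψ, hn⟩ := hB.normal_eq x hx
  have hψ0 := hψ.apply_eq_zero hB.isOpen hx
  have hnc : ∀ i, ContDiffAt ℝ 2 (fun y => n y i) x := hB.contDiffAt_normal hx
  set φ : E3 → ℝ := fun y => ∑ i, n y i * n y i with hφ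
  have hφc : ContDiffAt ℝ 2 φ x := ContDiffAt.sum fun i _ => (hnc i).mul (hnc i)
  -- Near x the function |n|² equals 1 on the level set of ψ, so x is trivially a constrained
  -- extremum and Lagrange multipliers make the two gradients parallel. Off ∂B the extension n need
  -- not have unit length, so the gradient of |n|² need not vanish.
  have hext : IsLocalExtrOn φ {y | ψ y = ψ x} x := by
    refine Or.inl ?_
    have h1 : ∀ᶠ y in 𝓝[{y | ψ y = ψ x}] x, ψ y = 0 → y ∈ frontier B :=
      (hψ.eventually_mem_frontier hB.isOpen).filter_mono nhdsWithin_le_nhds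
    filter_upwards [h1, self_mem_nhdsWithin] with y hy1 hy2
    have hy : ψ y = ψ x := hy2
    simp only [hφ]
    rw [hB.sum_normal_sq hx, hB.sum_normal_sq (hy1 (hy.trans hψ0))]
  obtain ⟨a, b, hab, heq⟩ := hext.exists_multipliers_of_hasStrictFDerivAt_1d
    (hψ.contDiffAt.hasStrictFDerivAt (by norm_num)) (hφc.hasStrictFDerivAt (by norm_num))
  have hg : ‖gradient ψ x‖ ≠ 0 := norm_ne_zero_iff.2 hψ.gradient_ne_zero
  have hpdψ : ∀ j, pd j ψ x = ‖gradient ψ x‖ * n x j := by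
    intro j
    have : gradient ψ x = ‖gradient ψ x‖ • n x := by
      rw [hn, smul_smul, mul_inv_cancel₀ hg, one_smul]
    have h2 : pd j ψ x = inner ℝ (gradient ψ x) (EuclideanSpace.single j 1) := by
      rw [gradient, InnerProductSpace.toDual_symm_apply, pd]
    rw [h2, EuclideanSpace.inner_single_right]
    conv_lhs => rw [this]
    simp
  have hpd : ∀ j, a * pd j ψ x + b * pd j φ x = 0 := by
    intro j
    have := congrArg (fun L : E3 →L[ℝ] ℝ => L (EuclideanSpace.single j 1)) heq
    simpa [pd] using this
  -- If b vanished, a nonzero multiple of ∇ψ would be zero, contradicting |n| = 1.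
  have hb : b ≠ 0 := by
    rintro rfl
    have ha : a ≠ 0 := by rintro rfl; exact hab rfl
    have h0 : ∀ j, n x j = 0 := by
      intro j
      have := hpd j
      rw [hpdψ] at this
      simpa [ha, hg] using this
    have := hB.sum_normal_sq hx
    simp [h0] at this
  refine ⟨-(a * ‖gradient ψ x‖) / (2 * b), fun j => ?_⟩
  have hnd : ∀ i, DifferentiableAt ℝ (fun y => n y i) x := fun i =>
    (hnc i).differentiableAt (by norm_num)
  have h1 : pd j φ x = 2 * ∑ i, n x i * pd j (fun y => n y i) x := by
    rw [hφ, pd_fun_sum j fun i _ => (hnd i).fun_mul (hnd i), Finset.mul_sum]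
    refine Finset.sum_congr rfl fun i _ => ?_
    rw [pd_fun_mul j (hnd i) (hnd i)]; ring
  have h2 := hpd j
  rw [h1, hpdψ] at h2
  field_simp
  linarith

/-! ### Green's formula -/

/-- Mixed partial derivatives commute, so exchanging the two indices changes the sign of the sum. -/
theorem sum_pd_pd_eq_zero_of_antisymm {N : Fin 3 → Fin 3 → E3 → ℝ} {x : E3}
    (hN : ∀ i j, ContDiffAt ℝ 2 (N i j) x) (hanti : ∀ i j y, N i j y = -N j i y) :
    ∑ j, pd j (fun y => ∑ i, pd i (N j i) y) x = 0 := by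
  have h1 : ∀ j, pd j (fun y => ∑ i, pd i (N j i) y) x = ∑ i, pd j (pd i (N j i)) x := fun j =>
    pd_fun_sum j fun i _ =>
      (contDiffAt_pd (k := 1) i (by exact_mod_cast hN j i)).differentiableAt (by norm_num)
  have h2 : ∀ i j, pd j (pd i (N j i)) x = -pd i (pd j (N i j)) x := by
    intro i j
    rw [pd_comm j i (hN j i)]
    have : pd j (N j i) = fun y => - pd j (N i j) y := by
      funext y
      rw [← pd_fun_neg]
      congr 1
      funext z
      exact hanti j i z
    rw [this, pd_fun_neg]
  have h3 : ∑ j, ∑ i, pd j (pd i (N j i)) x = -∑ j, ∑ i, pd j (pd i (N j i)) x := by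
    conv_lhs => rw [Finset.sum_comm]
    simp only [← Finset.sum_neg_distrib]
    exact Finset.sum_congr rfl fun i _ => Finset.sum_congr rfl fun j _ => h2 i j
  simp only [h1]
  linarith

/-- The pointwise algebra behind Green's formula at a boundary point. Here a_j stands for M_kj n_k,
and `dn`, `da` for the gradients of n and a, with the differentiation index first. The left side is
the natural flux minus the normal component of ∂_i N_ji; on the right only surface force times w and
surface moment times normal derivative remain. The two sides agree modulo |n|² = 1 and the fact that
∇|n|² is normal. -/
theorem surface_flux_identity (s n a w' : Fin 3 → ℝ) (dn da : Fin 3 → Fin 3 → ℝ) (w r : ℝ)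
    (hn : ∑ i, n i * n i = 1) (hr : ∀ j, ∑ i, n i * dn j i = r * n j) :
    (∑ j, s j * n j) * w + ∑ k, a k * w' k - ∑ j, n j * ∑ i,
      ((dn i j * (a i * w) + n j * (da i i * w + a i * w' i))
        - (dn i i * (a j * w) + n i * (da i j * w + a j * w' i)))
    = ((∑ j, s j * n j) - (∑ j, ∑ l, ((if j = l then 1 else 0) - n j * n l) * da l j)
      + (∑ l, ∑ j, ((if l = j then 1 else 0) - n l * n j) * dn j l) * ∑ j, a j * n j) * w
      + (∑ j, a j * n j) * ∑ i, n i * w' i := by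
  have h0 := hr 0
  have h1 := hr 1
  have h2 := hr 2
  simp only [Fin.sum_univ_three] at hn h0 h1 h2 ⊢
  simp only [Fin.isValue, if_true, if_false, Fin.reduceEq]
  linear_combination (-(w * (da 0 0 + da 1 1 + da 2 2) + a 0 * w' 0 + a 1 * w' 1 + a 2 * w' 2)
      + r * (a 0 * n 0 + a 1 * n 1 + a 2 * n 2) * w) * hn
    + (-(a 0 * w) + n 0 * (a 0 * n 0 + a 1 * n 1 + a 2 * n 2) * w) * h0
    + (-(a 1 * w) + n 1 * (a 0 * n 0 + a 1 * n 1 + a 2 * n 2) * w) * h1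
    + (-(a 2 * w) + n 2 * (a 0 * n 0 + a 1 * n 1 + a 2 * n 2) * w) * h2

/-- Green's formula of the second gradient theory, for a field `w` that annihilates the boundary
tractions. -/
theorem IsRegularRegion.integral_green {B : Set E3} {n : E3 → E3} (hB : IsRegularRegion B n)
    {S : Fin 3 → E3 → ℝ} {M : Fin 3 → Fin 3 → E3 → ℝ} {w : E3 → ℝ}
    (hS : ∀ j, ∀ x ∈ closure B, ContDiffAt ℝ 1 (S j) x)
    (hM : ∀ k j, ∀ x ∈ closure B, ContDiffAt ℝ 2 (M k j) x)
    (hw : ∀ x ∈ closure B, ContDiffAt ℝ 2 w x)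
    (h0 : ∀ x ∈ frontier B, surfaceForce n S M x * w x = 0)
    (h1 : ∀ x ∈ frontier B, surfaceMoment n M x * normalDeriv n w x = 0) :
    ∫ x in B, (bodyForce S M x * w x + ∑ j, S j x * pd j w x
      + ∑ k, ∑ j, M k j x * pd j (pd k w) x) = 0 := by
  -- The normal is replaced by an everywhere C² field agreeing with it near ∂B, since the correction
  -- below must be smooth on the whole closed region.
  choose ν hν _ hνn using fun i => exists_contDiff_eq_near (k := 2) (K := frontier B)
    (f := fun y => n y i)
    (hB.isCompact_closure.of_isClosed_subset isClosed_frontier frontier_subset_closure)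
    (fun x hx => by exact_mod_cast hB.contDiffAt_normal hx i)
  have hν' : ∀ i x, ContDiffAt ℝ 2 (ν i) x := fun i x => by exact_mod_cast (hν i).contDiffAt
  set a : Fin 3 → E3 → ℝ := fun i y => ∑ k, M k i y * ν k y with ha
  have hac : ∀ i, ∀ x ∈ closure B, ContDiffAt ℝ 2 (a i) x := fun i x hx =>
    ContDiffAt.sum fun k _ => (hM k i x hx).mul (hν' k x)
  -- The antisymmetric corrector. Its divergence ∂_i N_ji contributes nothing in the interior, while
  -- on ∂B its normal component supplies the tangential derivative terms that a surface divergence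
  -- theorem would otherwise remove.
  set N : Fin 3 → Fin 3 → E3 → ℝ := fun j i y =>
    ν j y * (a i y * w y) - ν i y * (a j y * w y) with hN
  have hNc : ∀ j i, ∀ x ∈ closure B, ContDiffAt ℝ 2 (N j i) x := fun j i x hx =>
    ((hν' j x).mul ((hac i x hx).mul (hw x hx))).sub ((hν' i x).mul ((hac j x hx).mul (hw x hx)))
  have hpd2 : ∀ {f : E3 → ℝ} {x : E3} (i : Fin 3), ContDiffAt ℝ 2 f x →
      ContDiffAt ℝ 1 (pd i f) x := fun i hf => by
    exact_mod_cast contDiffAt_pd (k := 1) i (by exact_mod_cast hf)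
  have hd1 : ∀ {f : E3 → ℝ} {x : E3}, ContDiffAt ℝ 1 f x → DifferentiableAt ℝ f x :=
    fun hf => hf.differentiableAt (by norm_num)
  have hd2 : ∀ {f : E3 → ℝ} {x : E3}, ContDiffAt ℝ 2 f x → DifferentiableAt ℝ f x :=
    fun hf => hf.differentiableAt (by norm_num)
  have h12 : ∀ {f : E3 → ℝ} {x : E3}, ContDiffAt ℝ 2 f x → ContDiffAt ℝ 1 f x :=
    fun hf => hf.of_le (by norm_num)
  set T : Fin 3 → E3 → ℝ := fun j y => S j y - ∑ k, pd k (M k j) y with hT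
  have hTc : ∀ j, ∀ x ∈ closure B, ContDiffAt ℝ 1 (T j) x := fun j x hx =>
    (hS j x hx).sub (ContDiffAt.sum fun k _ => hpd2 k (hM k j x hx))
  -- The natural flux: its divergence is the integrand, because the two terms containing first
  -- derivatives of M cancel after relabelling indices.
  set Y : Fin 3 → E3 → ℝ := fun j y => T j y * w y + ∑ k, M j k y * pd k w y with hY
  have hYc : ∀ j, ∀ x ∈ closure B, ContDiffAt ℝ 1 (Y j) x := fun j x hx =>
    ((hTc j x hx).mul (h12 (hw x hx))).add
      (ContDiffAt.sum fun k _ => (h12 (hM j k x hx)).mul (hpd2 k (hw x hx)))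
  have hZc : ∀ j, ∀ x ∈ closure B, ContDiffAt ℝ 1 (fun y => ∑ i, pd i (N j i) y) x :=
    fun j x hx => ContDiffAt.sum fun i _ => hpd2 i (hNc j i x hx)
  rw [← hB.integral_div_eq_zero (X := fun j y => Y j y - ∑ i, pd i (N j i) y)
    (fun j x hx => (hYc j x hx).sub (hZc j x hx))]
  · refine setIntegral_congr_fun hB.isOpen.measurableSet fun x hxB => ?_
    have hx := subset_closure hxB
    have e1 : ∀ j, pd j (fun y => Y j y - ∑ i, pd i (N j i) y) x
        = pd j (Y j) x - pd j (fun y => ∑ i, pd i (N j i) y) x := fun j =>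
      pd_fun_sub j (hd1 (hYc j x hx)) (hd1 (hZc j x hx))
    have e2 : ∀ j, pd j (T j) x = pd j (S j) x - ∑ k, pd j (pd k (M k j)) x := fun j => by
      rw [hT, pd_fun_sub j (hd1 (hS j x hx))
        (DifferentiableAt.fun_sum fun k _ => hd1 (hpd2 k (hM k j x hx))),
        pd_fun_sum j fun k _ => hd1 (hpd2 k (hM k j x hx))]
    have e3 : ∀ j, pd j (Y j) x = (pd j (S j) x - ∑ k, pd j (pd k (M k j)) x) * w x
        + T j x * pd j w x
        + ∑ k, (pd j (M j k) x * pd k w x + M j k x * pd j (pd k w) x) := fun j => by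
      have d1 : ∀ k, DifferentiableAt ℝ (fun y => M j k y * pd k w y) x := fun k =>
        (hd2 (hM j k x hx)).fun_mul (hd1 (hpd2 k (hw x hx)))
      rw [hY, pd_fun_add j ((hd1 (hTc j x hx)).fun_mul (hd2 (hw x hx)))
        (DifferentiableAt.fun_sum fun k _ => d1 k), pd_fun_mul j (hd1 (hTc j x hx))
        (hd2 (hw x hx)), pd_fun_sum j fun k _ => d1 k, e2]
      congr 1
      exact Finset.sum_congr rfl fun k _ => pd_fun_mul j (hd2 (hM j k x hx))
        (hd1 (hpd2 k (hw x hx)))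
    have e4 := sum_pd_pd_eq_zero_of_antisymm (N := N) (x := x) (fun i j => hNc i j x hx)
      (fun i j y => by simp only [hN]; ring)
    have e5 : ∀ j k, pd j (pd k w) x = pd k (pd j w) x := fun j k => pd_comm j k (hw x hx)
    simp only [e1, Finset.sum_sub_distrib, e4, e3, bodyForce, sub_zero, hT]
    simp only [Fin.sum_univ_three]
    rw [e5 1 0, e5 2 0, e5 2 1]
    ring
  · intro x hx
    have hxc := frontier_subset_closure hx
    obtain ⟨r, hr⟩ := hB.exists_normal_mul_pd hx
    have hνx : ∀ i, ν i x = n x i := fun i => (hνn i x hx).self_of_nhds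
    have hνpd : ∀ i j, pd j (fun y => n y i) x = pd j (ν i) x := fun i j =>
      (pd_congr (hνn i x hx) j).symm
    have e1 : ∀ j i, pd i (N j i) x
        = (pd i (ν j) x * (a i x * w x) + n x j * (pd i (a i) x * w x + a i x * pd i w x))
          - (pd i (ν i) x * (a j x * w x)
            + n x i * (pd i (a j) x * w x + a j x * pd i w x)) := fun j i => by
      have da : ∀ i, DifferentiableAt ℝ (a i) x := fun i => hd2 (hac i x hxc)
      have dw := hd2 (hw x hxc)
      have dν : ∀ i, DifferentiableAt ℝ (ν i) x := fun i => hd2 (hν' i x)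
      rw [hN, pd_fun_sub i ((dν j).fun_mul ((da i).fun_mul dw))
        ((dν i).fun_mul ((da j).fun_mul dw)), pd_fun_mul i (dν j) ((da i).fun_mul dw),
        pd_fun_mul i (dν i) ((da j).fun_mul dw), pd_fun_mul i (da i) dw, pd_fun_mul i (da j) dw,
        hνx, hνx]
    have e2 : ∀ j l, pd l (fun y => ∑ k, M k j y * n y k) x = pd l (a j) x := fun j l => by
      refine pd_congr ?_ l
      have : ∀ᶠ y in 𝓝 x, ∀ k, ν k y = n y k := eventually_all.2 fun k => hνn k x hx
      filter_upwards [this] with y hy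
      simp only [ha, hy]
    have e3 : ∀ j, a j x = ∑ k, M k j x * n x k := fun j => by simp only [ha, hνx]
    have e4 : ∑ k, ∑ j, M k j x * n x k * n x j = ∑ j, a j x * n x j := by
      simp only [e3, Finset.sum_mul]
      exact Finset.sum_comm
    have e5 : ∑ j, (Y j x - ∑ i, pd i (N j i) x) * n x j
        = (∑ j, T j x * n x j) * w x + ∑ k, a k x * pd k w x
          - ∑ j, n x j * ∑ i, pd i (N j i) x := by
      simp only [hY, e3, Fin.sum_univ_three]
      ring
    have key := surface_flux_identity (fun j => T j x) (fun j => n x j) (fun j => a j x)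
      (fun j => pd j w x) (fun j i => pd j (ν i) x) (fun j i => pd j (a i) x) (w x) r
      (hB.sum_normal_sq hx) (fun j => by simpa only [hνpd] using hr j)
    have f0 := h0 x hx
    have f1 := h1 x hx
    simp only [surfaceForce, surfaceMoment, normalDeriv, surfDeriv, e2, e4, hνpd] at f0 f1
    refine e5.trans ?_
    simp only [e1]
    refine key.trans ?_
    simp only [hT]
    rw [f0, f1, add_zero]

/-! ### Fields on space-time -/

/-- The space-time field `f` is of class `C^k` at `(t, x)`. -/
def SpaceTimeC (k : ℕ) (f : ℝ → E3 → ℝ) (t : ℝ) (x : E3) : Prop :=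
  ContDiffAt ℝ k (fun p : ℝ × E3 => f p.1 p.2) (t, x)

namespace SpaceTimeC
variable {k m : ℕ} {f g : ℝ → E3 → ℝ} {t : ℝ} {x : E3}

theorem of_le (h : SpaceTimeC k f t x) (hm : m ≤ k) : SpaceTimeC m f t x :=
  ContDiffAt.of_le h (by exact_mod_cast hm)

theorem eventually (h : SpaceTimeC k f t x) : ∀ᶠ p : ℝ × E3 in 𝓝 (t, x), SpaceTimeC k f p.1 p.2 :=
  ContDiffAt.eventually h (by simp)

theorem eventually_space (h : SpaceTimeC k f t x) : ∀ᶠ y in 𝓝 x, SpaceTimeC k f t y :=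
  (by fun_prop : Continuous fun y : E3 => (t, y)).continuousAt.eventually h.eventually

theorem slice (h : SpaceTimeC k f t x) : ContDiffAt ℝ k (f t) x :=
  ContDiffAt.comp (f := fun y : E3 => (t, y)) x h (contDiffAt_const.prodMk contDiffAt_id)

theorem add (hf : SpaceTimeC k f t x) (hg : SpaceTimeC k g t x) :
    SpaceTimeC k (fun s y => f s y + g s y) t x := ContDiffAt.add hf hg

theorem sub (hf : SpaceTimeC k f t x) (hg : SpaceTimeC k g t x) :
    SpaceTimeC k (fun s y => f s y - g s y) t x := ContDiffAt.sub hf hg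

theorem neg (hf : SpaceTimeC k f t x) : SpaceTimeC k (fun s y => -f s y) t x := ContDiffAt.neg hf

theorem mul (hf : SpaceTimeC k f t x) (hg : SpaceTimeC k g t x) :
    SpaceTimeC k (fun s y => f s y * g s y) t x := ContDiffAt.mul hf hg

theorem const_mul (a : ℝ) (hf : SpaceTimeC k f t x) : SpaceTimeC k (fun s y => a * f s y) t x :=
  ContDiffAt.mul contDiffAt_const hf

theorem sum {ι : Type*} {s : Finset ι} {F : ι → ℝ → E3 → ℝ}
    (h : ∀ i ∈ s, SpaceTimeC k (F i) t x) : SpaceTimeC k (fun r y => ∑ i ∈ s, F i r y) t x :=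
  ContDiffAt.sum h

/-- Expressing slice derivatives as components of the space-time derivative is what transfers
regularity to `pd` and `dot` and lets them be interchanged. -/
theorem pd_eq (h : SpaceTimeC 1 f t x) (i : Fin 3) :
    pd i (f t) x = fderiv ℝ (fun p : ℝ × E3 => f p.1 p.2) (t, x)
      (0, EuclideanSpace.single i 1) := by
  have h1 : HasFDerivAt (fun p : ℝ × E3 => f p.1 p.2) _ (t, x) :=
    (ContDiffAt.differentiableAt h (by norm_num)).hasFDerivAt
  have h2 : HasFDerivAt (fun y : E3 => (t, y)) (ContinuousLinearMap.inr ℝ ℝ E3) x :=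
    hasFDerivAt_prodMk_right t x
  have h3 := h1.comp x h2
  rw [pd]
  erw [h3.fderiv]
  simp

theorem hasDerivAt (h : SpaceTimeC 1 f t x) : HasDerivAt (fun s => f s x) (dot f t x) t := by
  have h1 : DifferentiableAt ℝ (fun p : ℝ × E3 => f p.1 p.2) (t, x) :=
    ContDiffAt.differentiableAt h (by norm_num)
  have h2 : DifferentiableAt ℝ (fun s : ℝ => f s x) t :=
    DifferentiableAt.comp (f := fun s : ℝ => (s, x)) t h1 (by fun_prop)
  exact h2.hasDerivAt

theorem dot_eq (h : SpaceTimeC 1 f t x) :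
    dot f t x = fderiv ℝ (fun p : ℝ × E3 => f p.1 p.2) (t, x) (1, 0) := by
  have h1 : HasFDerivAt (fun p : ℝ × E3 => f p.1 p.2) _ (t, x) :=
    (ContDiffAt.differentiableAt h (by norm_num)).hasFDerivAt
  have h2 : HasFDerivAt (fun s : ℝ => (s, x)) (ContinuousLinearMap.inl ℝ ℝ E3) t :=
    hasFDerivAt_prodMk_left t x
  have h3 := (HasFDerivAt.comp t h1 h2).hasDerivAt
  rw [dot]
  erw [h3.deriv]
  simp

theorem pd (h : SpaceTimeC (k + 1) f t x) (i : Fin 3) :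
    SpaceTimeC k (fun s => pd i (f s)) t x := by
  have h1 : ContDiffAt ℝ k (fun p => fderiv ℝ (fun p : ℝ × E3 => f p.1 p.2) p
      (0, EuclideanSpace.single i 1)) (t, x) :=
    (ContDiffAt.fderiv_right h (m := k) (by norm_cast)).clm_apply contDiffAt_const
  refine h1.congr_of_eventuallyEq ?_
  filter_upwards [(h.of_le (m := 1) (by omega)).eventually] with p hp
  exact hp.pd_eq i

theorem dot (h : SpaceTimeC (k + 1) f t x) : SpaceTimeC k (dot f) t x := by
  have h1 : ContDiffAt ℝ k (fun p => fderiv ℝ (fun p : ℝ × E3 => f p.1 p.2) p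
      (1, 0)) (t, x) :=
    (ContDiffAt.fderiv_right h (m := k) (by norm_cast)).clm_apply contDiffAt_const
  refine h1.congr_of_eventuallyEq ?_
  filter_upwards [(h.of_le (m := 1) (by omega)).eventually] with p hp
  exact hp.dot_eq

/-- Symmetry of the second derivative in space-time, applied to the time direction and a space
direction. -/
theorem dot_pd (h : SpaceTimeC 2 f t x) (i : Fin 3) :
    Thermopiezo.dot (fun s => Thermopiezo.pd i (f s)) t x
      = Thermopiezo.pd i (Thermopiezo.dot f t) x := by
  set F : ℝ × E3 → ℝ := fun p => f p.1 p.2 with hF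
  have hs : IsSymmSndFDerivAt ℝ F (t, x) := ContDiffAt.isSymmSndFDerivAt (n := 2) h (by simp)
  have hd : DifferentiableAt ℝ (fderiv ℝ F) (t, x) :=
    (ContDiffAt.fderiv_right (n := 2) h (m := 1) (by norm_num)).differentiableAt (by norm_num)
  have hev : ∀ᶠ p : ℝ × E3 in 𝓝 (t, x), SpaceTimeC 1 f p.1 p.2 :=
    (h.of_le (by norm_num)).eventually
  have e1 : (fun p : ℝ × E3 => Thermopiezo.pd i (f p.1) p.2) =ᶠ[𝓝 (t, x)]
      fun p => fderiv ℝ F p (0, EuclideanSpace.single i 1) := by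
    filter_upwards [hev] with p hp using hp.pd_eq i
  have e2 : (fun p : ℝ × E3 => Thermopiezo.dot f p.1 p.2) =ᶠ[𝓝 (t, x)]
      fun p => fderiv ℝ F p (1, 0) := by
    filter_upwards [hev] with p hp using hp.dot_eq
  rw [((h.pd (k := 1) i)).dot_eq, (h.dot (k := 1)).pd_eq i, e1.fderiv_eq, e2.fderiv_eq,
    fderiv_clm_apply hd (differentiableAt_const _), fderiv_clm_apply hd (differentiableAt_const _)]
  simpa using hs.eq (1, 0) (0, EuclideanSpace.single i 1)

theorem hasDerivAt_pd (h : SpaceTimeC 2 f t x) (i : Fin 3) :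
    HasDerivAt (fun s => Thermopiezo.pd i (f s) x)
      (Thermopiezo.pd i (Thermopiezo.dot f t) x) t := by
  rw [← h.dot_pd]
  exact (h.pd (k := 1) i).hasDerivAt

theorem hasDerivAt_pd_pd (h : SpaceTimeC 3 f t x) (i j : Fin 3) :
    HasDerivAt (fun s => Thermopiezo.pd i (Thermopiezo.pd j (f s)) x)
      (Thermopiezo.pd i (Thermopiezo.pd j (Thermopiezo.dot f t)) x) t := by
  have h1 := (h.pd (k := 2) j).hasDerivAt_pd i
  have h2 : Thermopiezo.dot (fun s => Thermopiezo.pd j (f s)) t =ᶠ[𝓝 x]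
      Thermopiezo.pd j (Thermopiezo.dot f t) := by
    filter_upwards [(h.of_le (m := 2) (by norm_num)).eventually_space] with y hy
    exact hy.dot_pd j
  rwa [pd_congr h2] at h1

end SpaceTimeC

/-- Differentiation under the integral sign. -/
theorem hasDerivAt_setIntegral {B : Set E3} (hBo : IsOpen B) (hBb : Bornology.IsBounded B)
    {f : ℝ → E3 → ℝ} {t : ℝ} (hf : ∀ x ∈ closure B, SpaceTimeC 1 f t x) :
    HasDerivAt (fun s => ∫ x in B, f s x) (∫ x in B, dot f t x) t := by
  have hK : IsCompact (closure B) := hBb.isCompact_closure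
  have hU : IsOpen {p : ℝ × E3 | SpaceTimeC 1 f p.1 p.2} := by
    rw [isOpen_iff_mem_nhds]
    intro p hp
    exact SpaceTimeC.eventually hp
  -- Compactness of the closed region gives a single time window around t on which f is C¹ at all
  -- its points. The time derivative is then bounded on a compact cylinder, which provides the
  -- dominating constant.
  obtain ⟨u, v, hu, -, htu, hBv, huv⟩ := generalized_tube_lemma (s := {t}) isCompact_singleton hK hU
    (by rintro ⟨s, y⟩ ⟨hs, hy⟩; obtain rfl : s = t := hs; exact hf y hy)
  obtain ⟨ε, hε, hεu⟩ := Metric.nhds_basis_closedBall.mem_iff.1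
    (hu.mem_nhds (htu (mem_singleton t)))
  have hgood : ∀ s ∈ Metric.closedBall t ε, ∀ x ∈ closure B, SpaceTimeC 1 f s x :=
    fun s hs x hx => huv (mk_mem_prod (hεu hs) (hBv hx))
  have hcompact : IsCompact (Metric.closedBall t ε ×ˢ closure B) :=
    (isCompact_closedBall t ε).prod hK
  have hcdot : ContinuousOn (fun p : ℝ × E3 => dot f p.1 p.2)
      (Metric.closedBall t ε ×ˢ closure B) := fun p hp =>
    (ContDiffAt.continuousAt (SpaceTimeC.dot (k := 0) (hgood p.1 hp.1 p.2 hp.2))).continuousWithinAt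
  obtain ⟨C, hC⟩ := hcompact.exists_bound_of_continuousOn hcdot
  have hcont : ∀ s ∈ Metric.closedBall t ε, ContinuousOn (f s) (closure B) := fun s hs x hx =>
    ((hgood s hs x hx).slice).continuousAt.continuousWithinAt
  have hcontdot : ContinuousOn (dot f t) (closure B) := fun x hx =>
    (SpaceTimeC.slice (SpaceTimeC.dot (k := 0)
      (hgood t (Metric.mem_closedBall_self hε.le) x hx))).continuousAt.continuousWithinAt
  have hm : MeasurableSet B := hBo.measurableSet
  refine (hasDerivAt_integral_of_dominated_loc_of_deriv_le (μ := volume.restrict B)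
    (F := f) (F' := fun s x => dot f s x) (bound := fun _ => C) (Metric.closedBall_mem_nhds t hε)
    ?_ ?_ ?_ ?_ ?_ ?_).2
  · filter_upwards [Metric.closedBall_mem_nhds t hε] with s hs
    exact ((hcont s hs).mono subset_closure).aestronglyMeasurable hm
  · exact ((hcont t (Metric.mem_closedBall_self hε.le)).integrableOn_compact hK).mono_set
      subset_closure
  · exact (hcontdot.mono subset_closure).aestronglyMeasurable hm
  · filter_upwards [ae_restrict_mem hm] with x hx s hs
    exact hC (s, x) (mk_mem_prod hs (subset_closure hx))
  · exact integrableOn_const hBb.measure_lt_top.ne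
  · filter_upwards [ae_restrict_mem hm] with x hx s hs
    exact (hgood s hs x (subset_closure hx)).hasDerivAt

/-! ### Bilinear sums -/

section bilinear
variable {ι κ : Type*} [Fintype ι] [Fintype κ]

/-- The bilinear form with coefficients `A`. -/
def bilin (A : ι → κ → ℝ) (x : ι → ℝ) (y : κ → ℝ) : ℝ := ∑ p, ∑ q, A p q * x p * y q

/-- The linear form with coefficients `A`. -/
def lin (A : ι → ℝ) (x : ι → ℝ) : ℝ := ∑ p, A p * x p

theorem bilin_eq_left (A : ι → κ → ℝ) (x : ι → ℝ) (y : κ → ℝ) :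
    bilin A x y = ∑ p, (∑ q, A p q * y q) * x p := by
  simp only [bilin, Finset.sum_mul]
  exact Finset.sum_congr rfl fun p _ => Finset.sum_congr rfl fun q _ => by ring

theorem bilin_eq_right (A : ι → κ → ℝ) (x : ι → ℝ) (y : κ → ℝ) :
    bilin A x y = ∑ q, (∑ p, A p q * x p) * y q := by
  simp only [bilin, Finset.sum_mul]
  exact Finset.sum_comm

theorem bilin_comm {A : ι → ι → ℝ} (hA : ∀ p q, A p q = A q p) (x y : ι → ℝ) :
    bilin A x y = bilin A y x := by
  simp only [bilin]
  rw [Finset.sum_comm]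
  exact Finset.sum_congr rfl fun p _ => Finset.sum_congr rfl fun q _ => by rw [hA]; ring

theorem bilin_add_smul_left (A : ι → κ → ℝ) (x z : ι → ℝ) (y : κ → ℝ) (r : ℝ) :
    bilin A (fun p => x p + r * z p) y = bilin A x y + r * bilin A z y := by
  simp only [bilin, Finset.mul_sum, ← Finset.sum_add_distrib]
  exact Finset.sum_congr rfl fun p _ => Finset.sum_congr rfl fun q _ => by ring

theorem lin_add_smul (A : ι → ℝ) (x z : ι → ℝ) (r : ℝ) :
    lin A (fun p => x p + r * z p) = lin A x + r * lin A z := by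
  simp only [lin, Finset.mul_sum, ← Finset.sum_add_distrib]
  exact Finset.sum_congr rfl fun p _ => by ring

theorem hasDerivAt_bilin (A : ι → κ → ℝ) {x : ℝ → ι → ℝ} {y : ℝ → κ → ℝ} {x' : ι → ℝ}
    {y' : κ → ℝ} {t : ℝ} (hx : ∀ p, HasDerivAt (fun s => x s p) (x' p) t)
    (hy : ∀ q, HasDerivAt (fun s => y s q) (y' q) t) :
    HasDerivAt (fun s => bilin A (x s) (y s)) (bilin A x' (y t) + bilin A (x t) y') t := by
  have h : HasDerivAt (fun s => bilin A (x s) (y s))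
      (∑ p, ∑ q, (A p q * x' p * y t q + A p q * x t p * y' q)) t :=
    HasDerivAt.fun_sum fun p _ => HasDerivAt.fun_sum fun q _ => ((hx p).const_mul _).mul (hy q)
  simpa only [bilin, Finset.sum_add_distrib] using h

theorem hasDerivAt_lin (A : ι → ℝ) {x : ℝ → ι → ℝ} {x' : ι → ℝ} {t : ℝ}
    (hx : ∀ p, HasDerivAt (fun s => x s p) (x' p) t) :
    HasDerivAt (fun s => lin A (x s)) (lin A x') t :=
  HasDerivAt.fun_sum fun p _ => (hx p).const_mul _

theorem SpaceTimeC.bilin (A : ι → κ → ℝ) {X : ι → ℝ → E3 → ℝ} {Y : κ → ℝ → E3 → ℝ} {k : ℕ}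
    {t : ℝ} {x : E3} (hX : ∀ p, SpaceTimeC k (X p) t x) (hY : ∀ q, SpaceTimeC k (Y q) t x) :
    SpaceTimeC k (fun s y => Thermopiezo.bilin A (fun p => X p s y) (fun q => Y q s y)) t x :=
  .sum fun p _ => .sum fun q _ => ((hX p).const_mul _).mul (hY q)

theorem SpaceTimeC.lin (A : ι → ℝ) {X : ι → ℝ → E3 → ℝ} {k : ℕ}
    {t : ℝ} {x : E3} (hX : ∀ p, SpaceTimeC k (X p) t x) :
    SpaceTimeC k (fun s y => Thermopiezo.lin A (fun p => X p s y)) t x :=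
  .sum fun p _ => (hX p).const_mul _

end bilinear

/-! ### The coefficients as bilinear forms -/

namespace Coefficients
variable (c : Coefficients)

def B11 (p q : Fin 3 × Fin 3) : ℝ := c.a11 p.1 p.2 q.1 q.2
def B12 (p : Fin 3 × Fin 3) (q : Fin 3 × Fin 3 × Fin 3) : ℝ := c.a12 p.1 p.2 q.1 q.2.1 q.2.2
def B13 (p : Fin 3 × Fin 3) (q : Fin 3) : ℝ := c.a13 p.1 p.2 q
def B14 (p : Fin 3 × Fin 3) : ℝ := c.a14 p.1 p.2
def B17 (p q : Fin 3 × Fin 3) : ℝ := c.a17 p.1 p.2 q.1 q.2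
def B22 (p q : Fin 3 × Fin 3 × Fin 3) : ℝ := c.a22 p.1 p.2.1 p.2.2 q.1 q.2.1 q.2.2
def B23 (p : Fin 3 × Fin 3 × Fin 3) (q : Fin 3) : ℝ := c.a23 p.1 p.2.1 p.2.2 q
def B24 (p : Fin 3 × Fin 3 × Fin 3) : ℝ := c.a24 p.1 p.2.1 p.2.2
def B27 (p : Fin 3 × Fin 3 × Fin 3) (q : Fin 3 × Fin 3) : ℝ := c.a27 p.1 p.2.1 p.2.2 q.1 q.2
def B37 (p : Fin 3) (q : Fin 3 × Fin 3) : ℝ := c.a37 p q.1 q.2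
def B47 (p : Fin 3 × Fin 3) : ℝ := c.a47 p.1 p.2
def B77 (p q : Fin 3 × Fin 3) : ℝ := c.a77 p.1 p.2 q.1 q.2

theorem W_eq (e : Fin 3 → Fin 3 → ℝ) (κ : Fin 3 → Fin 3 → Fin 3 → ℝ) :
    c.W e κ = 1 / 2 * bilin c.B11 (fun p => e p.1 p.2) (fun p => e p.1 p.2)
      + 1 / 2 * bilin c.B22 (fun p => κ p.1 p.2.1 p.2.2) (fun p => κ p.1 p.2.1 p.2.2)
      + bilin c.B12 (fun p => e p.1 p.2) (fun p => κ p.1 p.2.1 p.2.2) := by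
  simp only [W, bilin, Fintype.sum_prod_type, B11, B22, B12]

theorem F_eq (E : Fin 3 → ℝ) (V : Fin 3 → Fin 3 → ℝ) (χ : ℝ) :
    c.F E V χ = -(1 / 2) * bilin c.a33 E E
      - 1 / 2 * bilin c.B77 (fun p => V p.1 p.2) (fun p => V p.1 p.2)
      - bilin c.B37 E (fun p => V p.1 p.2) - lin c.a34 E * χ
      - lin c.B47 (fun p => V p.1 p.2) * χ := by
  simp only [F, bilin, lin, Fintype.sum_prod_type, B77, B37, B47, Finset.sum_mul]

theorem dissipation_eq (ξ : ℝ) (η : Fin 3 → ℝ) :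
    c.dissipation ξ η = 1 / c.beta * (c.gamma * ξ ^ 2 + 2 * (ξ * lin c.a56 η)
      + bilin c.a66 η η) := by
  simp only [dissipation, bilin, lin, Finset.mul_sum]
  congr 4
  funext i
  ring

end Coefficients

namespace Fields
variable (c : Coefficients) (U : Fields)

/-- The strain as an array indexed by pairs. -/
def strain (t : ℝ) (x : E3) (p : Fin 3 × Fin 3) : ℝ := U.e p.1 p.2 t x

/-- The strain gradient as an array indexed by triples. -/
def strainGrad (t : ℝ) (x : E3) (p : Fin 3 × Fin 3 × Fin 3) : ℝ := U.κ p.1 p.2.1 p.2.2 t x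

/-- The electric field as an array. -/
def elec (t : ℝ) (x : E3) (i : Fin 3) : ℝ := U.E i t x

/-- The gradient of the electric field as an array indexed by pairs. -/
def elecGrad (t : ℝ) (x : E3) (p : Fin 3 × Fin 3) : ℝ := U.V p.1 p.2 t x

/-- The temperature gradient. -/
def tempGrad (t : ℝ) (x : E3) (i : Fin 3) : ℝ := pd i (U.θ t) x

/-- The linear part of `-ρ η`. -/
def entropyPart (t : ℝ) (x : E3) : ℝ :=
  lin c.B14 (U.strain t x) + lin c.B24 (U.strainGrad t x) + lin c.a34 (U.elec t x)
    + c.a44 * U.χ c t x + lin c.B47 (U.elecGrad t x)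
    + 1 / c.beta * (c.gamma * dot U.θ t x + lin c.a56 (U.tempGrad t x))

theorem η_eq (t : ℝ) (x : E3) :
    U.η c t x = -(1 / c.rho) * (U.entropyPart c t x + c.alpha4) := by
  simp only [η, entropyPart, lin, Fintype.sum_prod_type, Coefficients.B14, Coefficients.B24,
    Coefficients.B47, strain, strainGrad, elec, elecGrad, tempGrad]

/-- This and its companions contract the constitutive tensors with an arbitrary array, always
placing arguments in the same slots of the shared coupling forms. The couplings can then be matched
term by term when the energy is differentiated. -/
theorem sum_τ_mul (t : ℝ) (x : E3) (z : Fin 3 → Fin 3 → ℝ) :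
    ∑ i, ∑ j, U.τ c i j t x * z i j
      = bilin c.B11 (fun p => z p.1 p.2) (U.strain t x)
        + bilin c.B12 (fun p => z p.1 p.2) (U.strainGrad t x)
        + bilin c.B13 (fun p => z p.1 p.2) (U.elec t x)
        + lin c.B14 (fun p => z p.1 p.2) * U.χ c t x
        + bilin c.B17 (fun p => z p.1 p.2) (U.elecGrad t x) := by
  simp only [bilin_eq_left, lin, Finset.sum_mul _ _ (U.χ c t x), Fintype.sum_prod_type,
    ← Finset.sum_add_distrib, Coefficients.B11, Coefficients.B12, Coefficients.B13,
    Coefficients.B14, Coefficients.B17, τ, strain, strainGrad, elec, elecGrad]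
  exact Finset.sum_congr rfl fun i _ => Finset.sum_congr rfl fun j _ => by
      simp only [Finset.sum_add_distrib]; ring

theorem sum_μ_mul (t : ℝ) (x : E3) (z : Fin 3 → Fin 3 → Fin 3 → ℝ) :
    ∑ i, ∑ j, ∑ k, U.μ c i j k t x * z i j k
      = bilin c.B12 (U.strain t x) (fun p => z p.1 p.2.1 p.2.2)
        + bilin c.B22 (fun p => z p.1 p.2.1 p.2.2) (U.strainGrad t x)
        + bilin c.B23 (fun p => z p.1 p.2.1 p.2.2) (U.elec t x)
        + lin c.B24 (fun p => z p.1 p.2.1 p.2.2) * U.χ c t x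
        + bilin c.B27 (fun p => z p.1 p.2.1 p.2.2) (U.elecGrad t x) := by
  simp only [bilin_eq_left c.B22, bilin_eq_left c.B23, bilin_eq_left c.B27, bilin_eq_right c.B12,
    lin, Finset.sum_mul _ _ (U.χ c t x), Fintype.sum_prod_type,
    ← Finset.sum_add_distrib, Coefficients.B12, Coefficients.B22, Coefficients.B23,
    Coefficients.B24, Coefficients.B27, μ, strain, strainGrad, elec, elecGrad]
  exact Finset.sum_congr rfl fun i _ => Finset.sum_congr rfl fun j _ =>
    Finset.sum_congr rfl fun k _ => by
      simp only [Finset.sum_add_distrib]; ring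

theorem sum_σ_mul (t : ℝ) (x : E3) (z : Fin 3 → ℝ) :
    ∑ i, U.σ c i t x * z i
      = -(bilin c.B13 (U.strain t x) z + bilin c.B23 (U.strainGrad t x) z
        + bilin c.a33 z (U.elec t x) + lin c.a34 z * U.χ c t x
        + bilin c.B37 z (U.elecGrad t x)) := by
  simp only [bilin_eq_left c.a33, bilin_eq_left c.B37, bilin_eq_right c.B13, bilin_eq_right c.B23,
    lin, Finset.sum_mul _ _ (U.χ c t x), Fintype.sum_prod_type,
    ← Finset.sum_add_distrib, ← Finset.sum_neg_distrib, Coefficients.B13, Coefficients.B23,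
    Coefficients.B37, σ, strain, strainGrad, elec, elecGrad]
  exact Finset.sum_congr rfl fun i _ => by
      simp only [Finset.sum_add_distrib]; ring

theorem sum_Q_mul (t : ℝ) (x : E3) (z : Fin 3 → Fin 3 → ℝ) :
    ∑ i, ∑ j, U.Q c i j t x * z i j
      = -(bilin c.B17 (U.strain t x) (fun p => z p.1 p.2)
        + bilin c.B27 (U.strainGrad t x) (fun p => z p.1 p.2)
        + bilin c.B37 (U.elec t x) (fun p => z p.1 p.2)
        + lin c.B47 (fun p => z p.1 p.2) * U.χ c t x
        + bilin c.B77 (fun p => z p.1 p.2) (U.elecGrad t x)) := by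
  simp only [bilin_eq_left c.B77, bilin_eq_right c.B37, bilin_eq_right c.B17, bilin_eq_right c.B27,
    lin, Finset.sum_mul _ _ (U.χ c t x), Fintype.sum_prod_type,
    ← Finset.sum_add_distrib, ← Finset.sum_neg_distrib, Coefficients.B17, Coefficients.B27,
    Coefficients.B37, Coefficients.B47, Coefficients.B77, Q, strain, strainGrad, elec, elecGrad]
  exact Finset.sum_congr rfl fun i _ => Finset.sum_congr rfl fun j _ => by
      simp only [Finset.sum_add_distrib]; ring

theorem sum_q_mul (t : ℝ) (x : E3) (z : Fin 3 → ℝ) :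
    ∑ i, U.q c i t x * z i
      = -c.T0 * (1 / c.beta * (lin c.a56 z * dot U.θ t x + bilin c.a66 z (U.tempGrad t x))) := by
  simp only [bilin_eq_left c.a66, lin, Finset.sum_mul _ _ (dot U.θ t x), Finset.mul_sum,
    ← Finset.sum_add_distrib, q, tempGrad]
  exact Finset.sum_congr rfl fun i _ => by ring

/-- Lets the symmetrised velocity gradient in the stress power be replaced by the full one that
Green's formula produces. -/
theorem τ_symm (hc : c.Symmetric) (i j : Fin 3) (t : ℝ) (x : E3) :
    U.τ c i j t x = U.τ c j i t x := by
  simp only [τ, fun k l => (hc.a11 i j k l).1, fun k l h => (hc.a12 i j k l h).1,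
    hc.a13 i j, hc.a14 i j, fun k l => (hc.a17 i j k l).1]

end Fields

/-! ### Regularity and time rates of the derived fields. -/

namespace Fields
variable (c : Coefficients) (U : Fields)

/-- The regularity required of a solution, at a single point of space-time. -/
structure SmoothAt (t : ℝ) (x : E3) : Prop where
  u : ∀ i, SpaceTimeC 4 (U.u i) t x
  θ : SpaceTimeC 3 U.θ t x
  φ : SpaceTimeC 4 U.φ t x

/-- The rates of the fields. -/
def rate : Fields where
  u i := dot (U.u i)
  θ := dot U.θ
  φ := dot U.φ

variable {U} {t : ℝ} {x : E3}

theorem V_eq (i j : Fin 3) (t : ℝ) (x : E3) : U.V i j t x = -pd j (pd i (U.φ t)) x := pd_fun_neg j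

namespace SmoothAt

theorem smooth_e (h : U.SmoothAt t x) (i j : Fin 3) : SpaceTimeC 3 (U.e i j) t x :=
  (((h.u i).pd j).add ((h.u j).pd i)).const_mul _

theorem smooth_κ (h : U.SmoothAt t x) (i j k : Fin 3) : SpaceTimeC 2 (U.κ i j k) t x :=
  ((h.u k).pd i).pd j

theorem smooth_E (h : U.SmoothAt t x) (i : Fin 3) : SpaceTimeC 3 (U.E i) t x := (h.φ.pd i).neg

theorem smooth_V (h : U.SmoothAt t x) (i j : Fin 3) : SpaceTimeC 2 (U.V i j) t x :=
  (h.smooth_E i).pd j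

theorem smooth_χ (h : U.SmoothAt t x) : SpaceTimeC 2 (U.χ c) t x :=
  (h.θ.of_le (by norm_num)).add (h.θ.dot.const_mul _)

theorem smooth_τ (h : U.SmoothAt t x) (i j : Fin 3) : SpaceTimeC 2 (U.τ c i j) t x := by
  have he := fun k l => (h.smooth_e k l).of_le (m := 2) (by norm_num)
  have hE := fun k => (h.smooth_E k).of_le (m := 2) (by norm_num)
  exact ((((SpaceTimeC.sum fun k _ => .sum fun l _ => (he k l).const_mul _).add
    (.sum fun k _ => .sum fun l _ => .sum fun m _ => (h.smooth_κ k l m).const_mul _)).add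
    (.sum fun k _ => (hE k).const_mul _)).add ((h.smooth_χ c).const_mul _)).add
    (.sum fun k _ => .sum fun l _ => (h.smooth_V k l).const_mul _)

theorem smooth_μ (h : U.SmoothAt t x) (i j k : Fin 3) : SpaceTimeC 2 (U.μ c i j k) t x := by
  have he := fun k l => (h.smooth_e k l).of_le (m := 2) (by norm_num)
  have hE := fun k => (h.smooth_E k).of_le (m := 2) (by norm_num)
  exact ((((SpaceTimeC.sum fun k _ => .sum fun l _ => (he k l).const_mul _).add
    (.sum fun k _ => .sum fun l _ => .sum fun m _ => (h.smooth_κ k l m).const_mul _)).add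
    (.sum fun k _ => (hE k).const_mul _)).add ((h.smooth_χ c).const_mul _)).add
    (.sum fun k _ => .sum fun l _ => (h.smooth_V k l).const_mul _)

theorem smooth_σ (h : U.SmoothAt t x) (i : Fin 3) : SpaceTimeC 2 (U.σ c i) t x := by
  have he := fun k l => (h.smooth_e k l).of_le (m := 2) (by norm_num)
  have hE := fun k => (h.smooth_E k).of_le (m := 2) (by norm_num)
  exact (((((SpaceTimeC.sum fun k _ => .sum fun l _ => (he k l).const_mul _).add
    (.sum fun k _ => .sum fun l _ => .sum fun m _ => (h.smooth_κ k l m).const_mul _)).add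
    (.sum fun k _ => (hE k).const_mul _)).add ((h.smooth_χ c).const_mul _)).add
    (.sum fun k _ => .sum fun l _ => (h.smooth_V k l).const_mul _)).neg

theorem smooth_Q (h : U.SmoothAt t x) (i j : Fin 3) : SpaceTimeC 2 (U.Q c i j) t x := by
  have he := fun k l => (h.smooth_e k l).of_le (m := 2) (by norm_num)
  have hE := fun k => (h.smooth_E k).of_le (m := 2) (by norm_num)
  exact (((((SpaceTimeC.sum fun k _ => .sum fun l _ => (he k l).const_mul _).add
    (.sum fun k _ => .sum fun l _ => .sum fun m _ => (h.smooth_κ k l m).const_mul _)).add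
    (.sum fun k _ => (hE k).const_mul _)).add ((h.smooth_χ c).const_mul _)).add
    (.sum fun k _ => .sum fun l _ => (h.smooth_V k l).const_mul _)).neg

theorem smooth_q (h : U.SmoothAt t x) (i : Fin 3) : SpaceTimeC 2 (U.q c i) t x :=
  (((h.θ.dot.const_mul _).add (.sum fun j _ => (h.θ.pd j).const_mul _)).const_mul _).const_mul _

theorem smooth_entropyPart (h : U.SmoothAt t x) : SpaceTimeC 2 (U.entropyPart c) t x := by
  have he := fun k l => (h.smooth_e k l).of_le (m := 2) (by norm_num)
  have hE := fun k => (h.smooth_E k).of_le (m := 2) (by norm_num)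
  exact (((((SpaceTimeC.lin c.B14 fun p => he p.1 p.2).add
    (.lin c.B24 fun p => h.smooth_κ p.1 p.2.1 p.2.2)).add (.lin c.a34 hE)).add
    ((h.smooth_χ c).const_mul _)).add (.lin c.B47 fun p => h.smooth_V p.1 p.2)).add
    (((h.θ.dot.const_mul _).add (.lin c.a56 fun i => h.θ.pd i)).const_mul _)

theorem hasDerivAt_e (h : U.SmoothAt t x) (i j : Fin 3) :
    HasDerivAt (fun s => U.e i j s x) (U.rate.e i j t x) t :=
  ((((h.u i).of_le (by norm_num)).hasDerivAt_pd j).add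
    (((h.u j).of_le (by norm_num)).hasDerivAt_pd i)).const_mul _

theorem hasDerivAt_κ (h : U.SmoothAt t x) (i j k : Fin 3) :
    HasDerivAt (fun s => U.κ i j k s x) (U.rate.κ i j k t x) t :=
  ((h.u k).of_le (by norm_num)).hasDerivAt_pd_pd j i

theorem hasDerivAt_E (h : U.SmoothAt t x) (i : Fin 3) :
    HasDerivAt (fun s => U.E i s x) (U.rate.E i t x) t :=
  ((h.φ.of_le (by norm_num)).hasDerivAt_pd i).neg

theorem hasDerivAt_V (h : U.SmoothAt t x) (i j : Fin 3) :
    HasDerivAt (fun s => U.V i j s x) (U.rate.V i j t x) t := by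
  simp only [V_eq]
  exact ((h.φ.of_le (by norm_num)).hasDerivAt_pd_pd j i).neg

theorem hasDerivAt_χ (h : U.SmoothAt t x) :
    HasDerivAt (fun s => U.χ c s x) (U.rate.χ c t x) t :=
  (h.θ.of_le (by norm_num)).hasDerivAt.add
    (((h.θ.dot (k := 2)).of_le (by norm_num)).hasDerivAt.const_mul _)

theorem hasDerivAt_tempGrad (h : U.SmoothAt t x) (i : Fin 3) :
    HasDerivAt (fun s => U.tempGrad s x i) (U.rate.tempGrad t x i) t :=
  (h.θ.of_le (by norm_num)).hasDerivAt_pd i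

theorem hasDerivAt_entropyPart (h : U.SmoothAt t x) :
    HasDerivAt (fun s => U.entropyPart c s x) (U.rate.entropyPart c t x) t :=
  (((((hasDerivAt_lin c.B14 fun p => h.hasDerivAt_e p.1 p.2).add
    (hasDerivAt_lin c.B24 fun p => h.hasDerivAt_κ p.1 p.2.1 p.2.2)).add
    (hasDerivAt_lin c.a34 h.hasDerivAt_E)).add ((h.hasDerivAt_χ c).const_mul _)).add
    (hasDerivAt_lin c.B47 fun p => h.hasDerivAt_V p.1 p.2)).add
    (((((h.θ.dot (k := 2)).of_le (by norm_num)).hasDerivAt.const_mul _).add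
      (hasDerivAt_lin c.a56 h.hasDerivAt_tempGrad)).const_mul _)

end SmoothAt

/-! ### The energy density and its time derivative. -/

variable (U)

theorem strain_def (t : ℝ) (x : E3) :
    (fun p : Fin 3 × Fin 3 => U.e p.1 p.2 t x) = U.strain t x := rfl

theorem strainGrad_def (t : ℝ) (x : E3) :
    (fun p : Fin 3 × Fin 3 × Fin 3 => U.κ p.1 p.2.1 p.2.2 t x) = U.strainGrad t x := rfl

theorem elec_def (t : ℝ) (x : E3) : (fun i => U.E i t x) = U.elec t x := rfl

theorem elecGrad_def (t : ℝ) (x : E3) :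
    (fun p : Fin 3 × Fin 3 => U.V p.1 p.2 t x) = U.elecGrad t x := rfl

/-- The density of `-(E_i σ_i + V_ij Q_ij)`. -/
def elecPower (t : ℝ) (x : E3) : ℝ :=
  -(∑ i, U.σ c i t x * U.E i t x + ∑ i, ∑ j, U.Q c i j t x * U.V i j t x)

/-- The positive part of the energy density. -/
def storedEnergy (t : ℝ) (x : E3) : ℝ :=
  c.rho / 2 * (∑ i, dot (U.u i) t x * dot (U.u i) t x)
  + c.W (fun i j => U.e i j t x) (fun i j k => U.κ i j k t x)
  + c.G (fun i => U.E i t x) (fun i j => U.V i j t x) (U.χ c t x)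
  + c.beta / 2 * c.dissipation (-(U.θ t x) / c.beta) (U.tempGrad t x)

/-- The energy density. -/
def energyDensity (t : ℝ) (x : E3) : ℝ := U.storedEnergy c t x + U.elecPower c t x

/-- The energy density in terms of bilinear forms. -/
theorem energyDensity_eq (hβ : c.beta ≠ 0) (t : ℝ) (x : E3) :
    U.energyDensity c t x = c.rho / 2 * (∑ i, dot (U.u i) t x * dot (U.u i) t x)
      + 1 / 2 * bilin c.B11 (U.strain t x) (U.strain t x)
      + 1 / 2 * bilin c.B22 (U.strainGrad t x) (U.strainGrad t x)
      + bilin c.B12 (U.strain t x) (U.strainGrad t x)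
      + 1 / 2 * bilin c.a33 (U.elec t x) (U.elec t x)
      + 1 / 2 * bilin c.B77 (U.elecGrad t x) (U.elecGrad t x)
      + bilin c.B37 (U.elec t x) (U.elecGrad t x)
      + bilin c.B13 (U.strain t x) (U.elec t x)
      + bilin c.B23 (U.strainGrad t x) (U.elec t x)
      + bilin c.B17 (U.strain t x) (U.elecGrad t x)
      + bilin c.B27 (U.strainGrad t x) (U.elecGrad t x)
      - 1 / 2 * (c.a44 + c.gamma / c.beta ^ 2) * (U.χ c t x * U.χ c t x)
      + (c.gamma / (2 * c.beta ^ 2) * (U.θ t x * U.θ t x)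
        - 1 / c.beta * (U.θ t x * lin c.a56 (U.tempGrad t x))
        + 1 / 2 * bilin c.a66 (U.tempGrad t x) (U.tempGrad t x)) := by
  have h1 := U.sum_σ_mul c t x (fun i => U.E i t x)
  have h2 := U.sum_Q_mul c t x (fun i j => U.V i j t x)
  simp only [energyDensity, storedEnergy, elecPower, h1, h2, c.W_eq, c.F_eq, c.dissipation_eq,
    Coefficients.G]
  simp only [U.strain_def, U.strainGrad_def, U.elec_def, U.elecGrad_def]
  field_simp
  ring

/-- `energyDensity` acts as a potential for τ, μ, -σ and -Q, so these are paired with the rates of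
e, κ, E and V. Symmetry of the five self-coupling forms turns each ½ d/dt A(x, x) into A(ẋ, x). The
purely thermal terms are arranged so that, once -χ times the entropy rate and the heat flux term are
split off, exactly minus the dissipation form at (θ̇, ∇θ) is left. -/
theorem hasDerivAt_energyDensity (hc : c.Symmetric) (hβ : c.beta ≠ 0) (hT : c.T0 ≠ 0)
    (h : U.SmoothAt t x) :
    HasDerivAt (fun s => U.energyDensity c s x)
      (c.rho * (∑ i, dot (dot (U.u i)) t x * dot (U.u i) t x)
        + ∑ i, ∑ j, U.τ c i j t x * U.rate.e i j t x
        + ∑ i, ∑ j, ∑ k, U.μ c i j k t x * U.rate.κ i j k t x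
        - (∑ i, U.σ c i t x * U.rate.E i t x + ∑ i, ∑ j, U.Q c i j t x * U.rate.V i j t x)
        - U.χ c t x * U.rate.entropyPart c t x
        - 1 / c.T0 * ∑ i, U.q c i t x * (U.tempGrad t x i + c.beta * U.rate.tempGrad t x i)
        - c.dissipation (dot U.θ t x) (U.tempGrad t x)) t := by
  simp only [U.energyDensity_eq c hβ]
  have de : ∀ p, HasDerivAt (fun s => U.strain s x p) (U.rate.strain t x p) t :=
    fun p => h.hasDerivAt_e p.1 p.2
  have dκ : ∀ p, HasDerivAt (fun s => U.strainGrad s x p) (U.rate.strainGrad t x p) t :=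
    fun p => h.hasDerivAt_κ p.1 p.2.1 p.2.2
  have dE : ∀ p, HasDerivAt (fun s => U.elec s x p) (U.rate.elec t x p) t := h.hasDerivAt_E
  have dV : ∀ p, HasDerivAt (fun s => U.elecGrad s x p) (U.rate.elecGrad t x p) t :=
    fun p => h.hasDerivAt_V p.1 p.2
  have dg := h.hasDerivAt_tempGrad
  have dχ := h.hasDerivAt_χ c
  have dθ : HasDerivAt (fun s => U.θ s x) (dot U.θ t x) t := (h.θ.of_le (by norm_num)).hasDerivAt
  have du : ∀ i, HasDerivAt (fun s => dot (U.u i) s x) (dot (dot (U.u i)) t x) t := fun i =>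
    (((h.u i).dot (k := 3)).of_le (by norm_num)).hasDerivAt
  have key := (((((((((((((HasDerivAt.fun_sum (u := Finset.univ)
    fun i _ => (du i).mul (du i)).const_mul (c.rho / 2)).add
    ((hasDerivAt_bilin c.B11 de de).const_mul (1 / 2))).add
    ((hasDerivAt_bilin c.B22 dκ dκ).const_mul (1 / 2))).add
    (hasDerivAt_bilin c.B12 de dκ)).add
    ((hasDerivAt_bilin c.a33 dE dE).const_mul (1 / 2))).add
    ((hasDerivAt_bilin c.B77 dV dV).const_mul (1 / 2))).add
    (hasDerivAt_bilin c.B37 dE dV)).add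
    (hasDerivAt_bilin c.B13 de dE)).add
    (hasDerivAt_bilin c.B23 dκ dE)).add
    (hasDerivAt_bilin c.B17 de dV)).add
    (hasDerivAt_bilin c.B27 dκ dV)).sub
    ((dχ.mul dχ).const_mul (1 / 2 * (c.a44 + c.gamma / c.beta ^ 2)))).add
    ((((dθ.mul dθ).const_mul (c.gamma / (2 * c.beta ^ 2))).sub
      ((dθ.mul (hasDerivAt_lin c.a56 dg)).const_mul (1 / c.beta))).add
      ((hasDerivAt_bilin c.a66 dg dg).const_mul (1 / 2)))
  refine key.congr_deriv ?_
  have hu : ∑ i, (dot (dot (U.u i)) t x * dot (U.u i) t x + dot (U.u i) t x * dot (dot (U.u i)) t x)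
      = 2 * ∑ i, dot (dot (U.u i)) t x * dot (U.u i) t x := by
    rw [Finset.mul_sum]
    exact Finset.sum_congr rfl fun i _ => by ring
  have s11 := bilin_comm (A := c.B11) (fun p q => (hc.a11 _ _ _ _).1.trans (hc.a11 _ _ _ _).2)
    (U.strain t x) (U.rate.strain t x)
  have s22 := bilin_comm (A := c.B22)
    (fun p q => (hc.a22 _ _ _ _ _ _).1.trans (hc.a22 _ _ _ _ _ _).2)
    (U.strainGrad t x) (U.rate.strainGrad t x)
  have s33 := bilin_comm (A := c.a33) hc.a33 (U.elec t x) (U.rate.elec t x)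
  have s77 := bilin_comm (A := c.B77) (fun p q => (hc.a77 _ _ _ _).1.trans (hc.a77 _ _ _ _).2)
    (U.elecGrad t x) (U.rate.elecGrad t x)
  have s66 := bilin_comm (A := c.a66) hc.a66 (U.tempGrad t x) (U.rate.tempGrad t x)
  have hχ : U.χ c t x = U.θ t x + c.beta * dot U.θ t x := rfl
  have hχ' : U.rate.χ c t x = dot U.θ t x + c.beta * dot (dot U.θ) t x := rfl
  have hr : dot U.rate.θ t x = dot (dot U.θ) t x := rfl
  rw [hu, U.sum_τ_mul c t x, U.sum_μ_mul c t x, U.sum_σ_mul c t x, U.sum_Q_mul c t x,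
    U.sum_q_mul c t x, lin_add_smul, bilin_add_smul_left, c.dissipation_eq, s11, s22, s33, s77,
    s66, entropyPart, hr]
  simp only [U.rate.strain_def, U.rate.strainGrad_def, U.rate.elec_def, U.rate.elecGrad_def]
  simp only [hχ', hχ]
  field_simp
  ring

end Fields

/-- A solution of the problem with vanishing body loads, initial data and boundary data. The
constant part of the entropy is dropped. -/
structure IsNullSolution (c : Coefficients) (B : Set E3) (n : E3 → E3) (I : Set ℝ)
    (U : Fields) : Prop where
  smooth : ∀ t ∈ I, ∀ x ∈ closure B, U.SmoothAt t x
  motion : ∀ t ∈ I, ∀ x ∈ B, ∀ i, bodyForce (fun j => U.τ c j i t) (fun k j => U.μ c k j i t) x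
    = c.rho * dot (dot (U.u i)) t x
  electric : ∀ t ∈ I, ∀ x ∈ B, bodyForce (fun i => U.σ c i t) (fun j i => U.Q c j i t) x = 0
  energy : ∀ t ∈ I, ∀ x ∈ B, ∑ i, pd i (U.q c i t) x = c.T0 * dot (U.entropyPart c) t x
  init_u : ∀ x ∈ closure B, ∀ i, U.u i 0 x = 0
  init_v : ∀ x ∈ closure B, ∀ i, dot (U.u i) 0 x = 0
  init_θ : ∀ x ∈ closure B, U.θ 0 x = 0
  init_entropy : ∀ x ∈ closure B, U.entropyPart c 0 x = 0
  bdry_force : ∀ x ∈ frontier B, (∀ t ∈ I, ∀ i, U.u i t x = 0) ∨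
    ∀ t ∈ I, ∀ i, surfaceForce n (fun j => U.τ c j i t) (fun k j => U.μ c k j i t) x = 0
  bdry_moment : ∀ x ∈ frontier B, (∀ t ∈ I, ∀ i, normalDeriv n (U.u i t) x = 0) ∨
    ∀ t ∈ I, ∀ i, surfaceMoment n (fun k j => U.μ c k j i t) x = 0
  bdry_heat : ∀ x ∈ frontier B, (∀ t ∈ I, U.θ t x = 0) ∨
    ∀ t ∈ I, ∑ i, U.q c i t x * n x i = 0
  bdry_charge : ∀ x ∈ frontier B, (∀ t ∈ I, U.φ t x = 0) ∨
    ∀ t ∈ I, surfaceForce n (fun j => U.σ c j t) (fun k j => U.Q c k j t) x = 0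
  bdry_quadrupole : ∀ x ∈ frontier B, (∀ t ∈ I, normalDeriv n (U.φ t) x = 0) ∨
    ∀ t ∈ I, surfaceMoment n (fun k j => U.Q c k j t) x = 0
  grounded : ∃ x ∈ frontier B, ∀ t ∈ I, U.φ t x = 0

/-! ### Integral identities for the null problem. -/

/-- Boundary conditions are differentiated in time only at interior times, hence the neighbourhood
hypothesis. The endpoint 0 is not lost, since monotonicity of the energy needs the sign of its
derivative only on the open interval. -/
theorem dot_eq_zero_of_forall {f : ℝ → E3 → ℝ} {I : Set ℝ} {t : ℝ} (hI : I ∈ 𝓝 t) {x : E3}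
    (h : ∀ s ∈ I, f s x = 0) : dot f t x = 0 := by
  have : (fun s => f s x) =ᶠ[𝓝 t] fun _ => 0 := by
    filter_upwards [hI] with s hs using h s hs
  rw [dot, this.deriv_eq, deriv_const]

theorem normalDeriv_dot_eq_zero {n : E3 → E3} {f : ℝ → E3 → ℝ} {I : Set ℝ} {t : ℝ} (hI : I ∈ 𝓝 t)
    {x : E3} (hf : SpaceTimeC 2 f t x) (h : ∀ s ∈ I, normalDeriv n (f s) x = 0) :
    normalDeriv n (dot f t) x = 0 := by
  have h1 : HasDerivAt (fun s => normalDeriv n (f s) x) (normalDeriv n (dot f t) x) t :=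
    HasDerivAt.fun_sum fun i _ => (hf.hasDerivAt_pd i).const_mul _
  have h2 : (fun s => normalDeriv n (f s) x) =ᶠ[𝓝 t] fun _ => 0 := by
    filter_upwards [hI] with s hs using h s hs
  exact h1.unique ((hasDerivAt_const t (0 : ℝ)).congr_of_eventuallyEq h2)

theorem surfaceForce_zero_moment (n : E3 → E3) (S : Fin 3 → E3 → ℝ) (x : E3) :
    surfaceForce n S (fun _ _ _ => 0) x = ∑ j, S j x * n x j := by
  simp [surfaceForce, surfDeriv, pd]

theorem integrableOn_of_spaceTimeC {B : Set E3} (hBb : Bornology.IsBounded B) {k : ℕ}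
    {f : ℝ → E3 → ℝ} {t : ℝ} (hf : ∀ x ∈ closure B, SpaceTimeC k f t x) :
    IntegrableOn (f t) B := by
  have : ContinuousOn (f t) (closure B) :=
    fun x hx => (hf x hx).slice.continuousAt.continuousWithinAt
  exact (this.integrableOn_compact hBb.isCompact_closure).mono_set subset_closure

namespace Fields.SmoothAt
variable (c : Coefficients) {U : Fields} {t : ℝ} {x : E3}

theorem smooth_dissipation (h : U.SmoothAt t x) :
    SpaceTimeC 2 (fun s y => c.dissipation (dot U.θ s y) (U.tempGrad s y)) t x := by
  simp only [c.dissipation_eq, sq]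
  exact ((((h.θ.dot.mul h.θ.dot).const_mul _).add
    ((h.θ.dot.mul (.lin c.a56 fun i => h.θ.pd i)).const_mul _)).add
    (.bilin c.a66 (fun i => h.θ.pd i) (fun i => h.θ.pd i))).const_mul _

theorem smooth_elecPower (h : U.SmoothAt t x) : SpaceTimeC 2 (U.elecPower c) t x :=
  ((SpaceTimeC.sum fun i _ => (h.smooth_σ c i).mul ((h.smooth_E i).of_le (by norm_num))).add
    (.sum fun i _ => .sum fun j _ => (h.smooth_Q c i j).mul (h.smooth_V i j))).neg

theorem smooth_energyDensity (h : U.SmoothAt t x) (hβ : c.beta ≠ 0) :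
    SpaceTimeC 2 (U.energyDensity c) t x := by
  have hd : U.energyDensity c = fun s y => U.energyDensity c s y := rfl
  simp only [U.energyDensity_eq c hβ] at hd
  rw [hd]
  have se : ∀ p : Fin 3 × Fin 3, SpaceTimeC 2 (fun s y => U.strain s y p) t x :=
    fun p => (h.smooth_e p.1 p.2).of_le (by norm_num)
  have sκ : ∀ p : Fin 3 × Fin 3 × Fin 3, SpaceTimeC 2 (fun s y => U.strainGrad s y p) t x :=
    fun p => h.smooth_κ p.1 p.2.1 p.2.2
  have sE : ∀ p, SpaceTimeC 2 (fun s y => U.elec s y p) t x :=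
    fun p => (h.smooth_E p).of_le (by norm_num)
  have sV : ∀ p : Fin 3 × Fin 3, SpaceTimeC 2 (fun s y => U.elecGrad s y p) t x :=
    fun p => h.smooth_V p.1 p.2
  have sg : ∀ p, SpaceTimeC 2 (fun s y => U.tempGrad s y p) t x := fun p => h.θ.pd p
  have su : ∀ i, SpaceTimeC 2 (dot (U.u i)) t x :=
    fun i => ((h.u i).dot (k := 3)).of_le (by norm_num)
  have sθ : SpaceTimeC 2 U.θ t x := h.θ.of_le (by norm_num)
  have sχ := h.smooth_χ c
  exact ((((((((((((((SpaceTimeC.sum fun i _ => (su i).mul (su i)).const_mul _).add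
    ((SpaceTimeC.bilin c.B11 se se).const_mul _)).add
    ((SpaceTimeC.bilin c.B22 sκ sκ).const_mul _)).add
    (SpaceTimeC.bilin c.B12 se sκ)).add
    ((SpaceTimeC.bilin c.a33 sE sE).const_mul _)).add
    ((SpaceTimeC.bilin c.B77 sV sV).const_mul _)).add
    (SpaceTimeC.bilin c.B37 sE sV)).add
    (SpaceTimeC.bilin c.B13 se sE)).add
    (SpaceTimeC.bilin c.B23 sκ sE)).add
    (SpaceTimeC.bilin c.B17 se sV)).add
    (SpaceTimeC.bilin c.B27 sκ sV)).sub
    ((sχ.mul sχ).const_mul _)).add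
    ((((sθ.mul sθ).const_mul _).sub
      ((sθ.mul (.lin c.a56 sg)).const_mul _)).add
      ((SpaceTimeC.bilin c.a66 sg sg).const_mul _)))

theorem smooth_storedEnergy (h : U.SmoothAt t x) (hβ : c.beta ≠ 0) :
    SpaceTimeC 2 (U.storedEnergy c) t x := by
  have hd : U.storedEnergy c = fun s y => U.energyDensity c s y - U.elecPower c s y := by
    funext s y
    simp [energyDensity]
  rw [hd]
  exact (h.smooth_energyDensity c hβ).sub (h.smooth_elecPower c)

end Fields.SmoothAt

namespace IsNullSolution

variable {c : Coefficients} {B : Set E3} {n : E3 → E3} {I : Set ℝ} {U : Fields} {t : ℝ}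

/-- Balance of mechanical power: Green's formula with the velocity component as test function. At
each boundary point either the velocity or the traction vanishes, and likewise for the normal
derivative and the moment. -/
theorem integral_mechanical (h : IsNullSolution c B n I U) (hB : IsRegularRegion B n)
    (ht : t ∈ I) (hI : I ∈ 𝓝 t) (i : Fin 3) :
    ∫ x in B, (c.rho * dot (dot (U.u i)) t x * dot (U.u i) t x
      + ∑ j, U.τ c j i t x * pd j (dot (U.u i) t) x
      + ∑ k, ∑ j, U.μ c k j i t x * pd j (pd k (dot (U.u i) t)) x) = 0 := by
  have hs := h.smooth t ht
  rw [← hB.integral_green (S := fun j => U.τ c j i t) (M := fun k j => U.μ c k j i t)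
    (w := dot (U.u i) t)]
  · exact setIntegral_congr_fun hB.isOpen.measurableSet fun x hx => by
      simp only [h.motion t ht x hx i]
  · exact fun j x hx => (((hs x hx).smooth_τ c j i).of_le (m := 1) (by norm_num)).slice
  · exact fun k j x hx => ((hs x hx).smooth_μ c k j i).slice
  · exact fun x hx => ((((hs x hx).u i).dot (k := 3)).of_le (m := 2) (by norm_num)).slice
  · intro x hx
    rcases h.bdry_force x hx with h1 | h1
    · rw [dot_eq_zero_of_forall hI fun s hs => h1 s hs i, mul_zero]
    · rw [h1 t ht i, zero_mul]
  · intro x hx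
    rcases h.bdry_moment x hx with h1 | h1
    · rw [normalDeriv_dot_eq_zero hI (((hs x (frontier_subset_closure hx)).u i).of_le
        (by norm_num)) fun s hs => h1 s hs i, mul_zero]
    · rw [h1 t ht i, zero_mul]

/-- The test function need only inherit the homogeneous conditions on φ, so that both φ, at every
time, and φ̇, at interior times, are admissible. -/
theorem integral_electric (h : IsNullSolution c B n I U) (hB : IsRegularRegion B n)
    (ht : t ∈ I) {w : E3 → ℝ} (hw : ∀ x ∈ closure B, ContDiffAt ℝ 2 w x)
    (h0 : ∀ x ∈ frontier B, (∀ s ∈ I, U.φ s x = 0) → w x = 0)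
    (h1 : ∀ x ∈ frontier B, (∀ s ∈ I, normalDeriv n (U.φ s) x = 0) → normalDeriv n w x = 0) :
    ∫ x in B, (∑ j, U.σ c j t x * pd j w x + ∑ k, ∑ j, U.Q c k j t x * pd j (pd k w) x) = 0 := by
  have hs := h.smooth t ht
  rw [← hB.integral_green (S := fun j => U.σ c j t) (M := fun k j => U.Q c k j t) (w := w)]
  · exact setIntegral_congr_fun hB.isOpen.measurableSet fun x hx => by
      simp only [h.electric t ht x hx, zero_mul, zero_add]
  · exact fun j x hx => (((hs x hx).smooth_σ c j).of_le (m := 1) (by norm_num)).slice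
  · exact fun k j x hx => ((hs x hx).smooth_Q c k j).slice
  · exact hw
  · intro x hx
    rcases h.bdry_charge x hx with h2 | h2
    · rw [h0 x hx h2, mul_zero]
    · rw [h2 t ht, zero_mul]
  · intro x hx
    rcases h.bdry_quadrupole x hx with h2 | h2
    · rw [h1 x hx h2, mul_zero]
    · rw [h2 t ht, zero_mul]

theorem integral_elecPower (h : IsNullSolution c B n I U) (hB : IsRegularRegion B n)
    (ht : t ∈ I) : ∫ x in B, U.elecPower c t x = 0 := by
  rw [← h.integral_electric hB ht (w := U.φ t)]
  · refine setIntegral_congr_fun hB.isOpen.measurableSet fun x hx => ?_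
    simp only [Fields.elecPower, Fields.V_eq, Fields.E, mul_neg, Finset.sum_neg_distrib]
    ring
  · exact fun x hx => ((h.smooth t ht x hx).φ.of_le (m := 2) (by norm_num)).slice
  · exact fun x _ h0 => h0 t ht
  · exact fun x _ h0 => h0 t ht

theorem integral_rate_elec (h : IsNullSolution c B n I U) (hB : IsRegularRegion B n)
    (ht : t ∈ I) (hI : I ∈ 𝓝 t) :
    ∫ x in B, (∑ j, U.σ c j t x * pd j (dot U.φ t) x
      + ∑ k, ∑ j, U.Q c k j t x * pd j (pd k (dot U.φ t)) x) = 0 := by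
  refine h.integral_electric hB ht ?_ ?_ ?_
  · exact fun x hx => (((h.smooth t ht x hx).φ.dot (k := 3)).of_le (m := 2) (by norm_num)).slice
  · exact fun x _ h0 => dot_eq_zero_of_forall hI h0
  · exact fun x hx h0 => normalDeriv_dot_eq_zero hI
      ((h.smooth t ht x (frontier_subset_closure hx)).φ.of_le (by norm_num)) h0

/-- Heat conduction is the first-order case of Green's formula, with M = 0. The test function χ
vanishes wherever θ does for all times. -/
theorem integral_thermal (h : IsNullSolution c B n I U) (hB : IsRegularRegion B n)
    (ht : t ∈ I) (hI : I ∈ 𝓝 t) :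
    ∫ x in B, (c.T0 * dot (U.entropyPart c) t x * U.χ c t x
      + ∑ j, U.q c j t x * pd j (U.χ c t) x) = 0 := by
  have hs := h.smooth t ht
  rw [← hB.integral_green (S := fun j => U.q c j t) (M := fun _ _ _ => 0) (w := U.χ c t)]
  · refine setIntegral_congr_fun hB.isOpen.measurableSet fun x hx => ?_
    have h0 : ∀ (j k : Fin 3), pd j (pd k fun _ => (0 : ℝ)) x = 0 := by
      intro j k
      have : (pd k fun _ => (0 : ℝ)) = fun _ => 0 := by funext y; simp [pd]
      rw [this]; simp [pd]
    simp only [bodyForce, h.energy t ht x hx, h0, zero_mul, Finset.sum_const_zero, sub_zero,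
      add_zero]
  · exact fun j x hx => (((hs x hx).smooth_q c j).of_le (m := 1) (by norm_num)).slice
  · exact fun _ _ _ _ => contDiffAt_const
  · exact fun x hx => ((hs x hx).smooth_χ c).slice
  · intro x hx
    rw [surfaceForce_zero_moment]
    rcases h.bdry_heat x hx with h1 | h1
    · rw [Fields.χ, h1 t ht, dot_eq_zero_of_forall hI h1]; ring
    · rw [h1 t ht, zero_mul]
  · intro x _
    simp [surfaceMoment]

/-- The dissipation identity. -/
theorem integral_rate (h : IsNullSolution c B n I U) (hB : IsRegularRegion B n)
    (hc : c.Symmetric) (hβ : c.beta ≠ 0) (hT : c.T0 ≠ 0) (ht : t ∈ I) (hI : I ∈ 𝓝 t) :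
    ∫ x in B, dot (U.energyDensity c) t x
      = -∫ x in B, c.dissipation (dot U.θ t x) (U.tempGrad t x) := by
  have hs := h.smooth t ht
  set A : Fin 3 → E3 → ℝ := fun i x => c.rho * dot (dot (U.u i)) t x * dot (U.u i) t x
      + ∑ j, U.τ c j i t x * pd j (dot (U.u i) t) x
      + ∑ k, ∑ j, U.μ c k j i t x * pd j (pd k (dot (U.u i) t)) x with hA
  set P : E3 → ℝ := fun x => ∑ j, U.σ c j t x * pd j (dot U.φ t) x
      + ∑ k, ∑ j, U.Q c k j t x * pd j (pd k (dot U.φ t)) x with hP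
  set Θ : E3 → ℝ := fun x => c.T0 * dot (U.entropyPart c) t x * U.χ c t x
      + ∑ j, U.q c j t x * pd j (U.χ c t) x with hΘ
  set D : E3 → ℝ := fun x => c.dissipation (dot U.θ t x) (U.tempGrad t x) with hD
  -- Pointwise, the energy rate is a combination of the integrands of the mechanical, electric and
  -- thermal identities, minus the dissipation.
  have hpoint : ∀ x ∈ closure B, dot (U.energyDensity c) t x
      = ∑ i, A i x + P x - 1 / c.T0 * Θ x - D x := by
    intro x hx
    have hx' := hs x hx
    have hpdχ : ∀ j, pd j (U.χ c t) x = U.tempGrad t x j + c.beta * U.rate.tempGrad t x j := by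
      intro j
      have d1 : DifferentiableAt ℝ (U.θ t) x := hx'.θ.slice.differentiableAt (by norm_num)
      have d2 : DifferentiableAt ℝ (dot U.θ t) x :=
        (hx'.θ.dot (k := 2)).slice.differentiableAt (by norm_num)
      exact (pd_fun_add j d1 (d2.const_mul _)).trans (by rw [pd_fun_const_mul j _ d2]; rfl)
    have hs' : dot (U.entropyPart c) t x = U.rate.entropyPart c t x :=
      (hx'.hasDerivAt_entropyPart c).deriv
    rw [dot, (U.hasDerivAt_energyDensity c hc hβ hT hx').deriv]
    have e1 : ∑ i, ∑ j, U.τ c i j t x * U.rate.e i j t x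
        = ∑ i, ∑ j, U.τ c j i t x * pd j (dot (U.u i) t) x := by
      simp only [Fields.e, Fields.rate, Fin.sum_univ_three]
      rw [U.τ_symm c hc 1 0, U.τ_symm c hc 2 0, U.τ_symm c hc 2 1]
      ring
    have e2 : ∑ i, ∑ j, ∑ k, U.μ c i j k t x * U.rate.κ i j k t x
        = ∑ i, ∑ k, ∑ j, U.μ c k j i t x * pd j (pd k (dot (U.u i) t)) x := by
      simp only [Fields.κ, Fields.rate, Fin.sum_univ_three]
      ring
    have e3 : ∑ i, U.σ c i t x * U.rate.E i t x + ∑ i, ∑ j, U.Q c i j t x * U.rate.V i j t x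
        = -P x := by
      simp only [hP, Fields.V_eq, Fields.E, Fields.rate, mul_neg, Finset.sum_neg_distrib]
      ring
    rw [e1, e2, e3, ← hs']
    have e4 : ∑ i, A i x = c.rho * (∑ i, dot (dot (U.u i)) t x * dot (U.u i) t x)
        + ∑ i, ∑ j, U.τ c j i t x * pd j (dot (U.u i) t) x
        + ∑ i, ∑ k, ∑ j, U.μ c k j i t x * pd j (pd k (dot (U.u i) t)) x := by
      simp only [hA, Finset.sum_add_distrib, Finset.mul_sum, mul_assoc]
    rw [e4]
    simp only [hΘ, hpdχ, hD]
    field_simp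
    ring
  have iA : ∀ i, IntegrableOn (A i) B := fun i => by
    refine integrableOn_of_spaceTimeC (k := 1) (f := fun s x =>
      c.rho * dot (dot (U.u i)) s x * dot (U.u i) s x
      + ∑ j, U.τ c j i s x * pd j (dot (U.u i) s) x
      + ∑ k, ∑ j, U.μ c k j i s x * pd j (pd k (dot (U.u i) s)) x) hB.isBounded fun x hx => ?_
    have hx' := hs x hx
    have h3 := (hx'.u i).dot (k := 3)
    exact (((((h3.dot (k := 2)).of_le (by norm_num)).const_mul _).mul (h3.of_le (by norm_num))).add
      (.sum fun j _ => ((hx'.smooth_τ c j i).of_le (by norm_num)).mul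
        ((h3.pd (k := 2) j).of_le (by norm_num)))).add
      (.sum fun k _ => .sum fun j _ => ((hx'.smooth_μ c k j i).of_le (by norm_num)).mul
        ((h3.pd (k := 2) k).pd j))
  have iP : IntegrableOn P B := by
    refine integrableOn_of_spaceTimeC (k := 1) (f := fun s x =>
      ∑ j, U.σ c j s x * pd j (dot U.φ s) x
      + ∑ k, ∑ j, U.Q c k j s x * pd j (pd k (dot U.φ s)) x) hB.isBounded fun x hx => ?_
    have hx' := hs x hx
    have h3 := hx'.φ.dot (k := 3)
    exact (SpaceTimeC.sum fun j _ => ((hx'.smooth_σ c j).of_le (by norm_num)).mul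
        ((h3.pd (k := 2) j).of_le (by norm_num))).add
      (.sum fun k _ => .sum fun j _ => ((hx'.smooth_Q c k j).of_le (by norm_num)).mul
        ((h3.pd (k := 2) k).pd j))
  have iΘ : IntegrableOn Θ B := by
    refine integrableOn_of_spaceTimeC (k := 1) (f := fun s x =>
      c.T0 * dot (U.entropyPart c) s x * U.χ c s x
      + ∑ j, U.q c j s x * pd j (U.χ c s) x) hB.isBounded fun x hx => ?_
    have hx' := hs x hx
    exact (((hx'.smooth_entropyPart c).dot.const_mul _).mul
      ((hx'.smooth_χ c).of_le (by norm_num))).add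
      (.sum fun j _ => ((hx'.smooth_q c j).of_le (by norm_num)).mul ((hx'.smooth_χ c).pd j))
  have iD : IntegrableOn D B :=
    integrableOn_of_spaceTimeC hB.isBounded fun x hx => (hs x hx).smooth_dissipation c
  rw [setIntegral_congr_fun hB.isOpen.measurableSet fun x hx => hpoint x (subset_closure hx)]
  have iS : IntegrableOn (fun x => ∑ i, A i x) B := integrable_finsetSum _ fun i _ => iA i
  have iSP : IntegrableOn (fun x => ∑ i, A i x + P x) B := iS.add iP
  have iΘ' : IntegrableOn (fun x => 1 / c.T0 * Θ x) B := iΘ.const_mul _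
  have iSPΘ : IntegrableOn (fun x => ∑ i, A i x + P x - 1 / c.T0 * Θ x) B := iSP.sub iΘ'
  rw [integral_sub iSPΘ iD, integral_sub iSP iΘ', integral_add iS iP,
    integral_finsetSum _ fun i _ => iA i, integral_const_mul,
    h.integral_thermal hB ht hI, h.integral_rate_elec hB ht hI,
    Finset.sum_congr rfl fun i _ => h.integral_mechanical hB ht hI i]
  simp

end IsNullSolution

/-! ### The time interval, vanishing criteria and signs of the energy. -/

section timeInterval
variable {t₀ : EReal} {t : ℝ}

theorem zero_mem_timeInterval (h : 0 < t₀) : (0 : ℝ) ∈ timeInterval t₀ := ⟨le_rfl, h⟩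

theorem Icc_subset_timeInterval (ht : t ∈ timeInterval t₀) : Icc 0 t ⊆ timeInterval t₀ :=
  fun _ hs => ⟨hs.1, (EReal.coe_le_coe_iff.2 hs.2).trans_lt ht.2⟩

theorem timeInterval_mem_nhds (ht : t ∈ timeInterval t₀) (h0 : 0 < t) :
    timeInterval t₀ ∈ 𝓝 t := by
  filter_upwards [lt_mem_nhds h0,
    continuous_coe_real_ereal.continuousAt.eventually (gt_mem_nhds ht.2)] with s h1 h2
  exact ⟨h1.le, h2⟩

end timeInterval

theorem pd_eq_zero_of_isOpen {B : Set E3} (hB : IsOpen B) {f : E3 → ℝ} (h : ∀ y ∈ B, f y = 0)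
    {x : E3} (hx : x ∈ B) (i : Fin 3) : pd i f x = 0 := by
  have : f =ᶠ[𝓝 x] fun _ => 0 := by
    filter_upwards [hB.mem_nhds hx] with y hy using h y hy
  rw [pd_congr this]
  simp [pd]

theorem eq_on_closure_of_eq_on {B : Set E3} {f : E3 → ℝ} {a : ℝ}
    (hf : ∀ x ∈ closure B, ContinuousAt f x) (h : ∀ x ∈ B, f x = a) :
    ∀ x ∈ closure B, f x = a :=
  EqOn.of_subset_closure (f := f) (g := fun _ => a) h
    (fun x hx => (hf x hx).continuousWithinAt) continuousOn_const subset_closure subset_rfl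

/-- The integrand vanishes almost everywhere; continuity and openness of B upgrade this to every
point. -/
theorem eq_zero_of_setIntegral_nonpos {B : Set E3} (hB : IsOpen B) {f : E3 → ℝ}
    (hf : ContinuousOn f B) (hi : IntegrableOn f B) (h0 : ∀ x ∈ B, 0 ≤ f x)
    (h : ∫ x in B, f x ≤ 0) : ∀ x ∈ B, f x = 0 := by
  have hnn : 0 ≤ᵐ[volume.restrict B] f := by
    filter_upwards [ae_restrict_mem hB.measurableSet] with x hx using h0 x hx
  have h1 : ∫ x in B, f x = 0 := le_antisymm h (integral_nonneg_of_ae hnn)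
  have h2 := (setIntegral_eq_zero_iff_of_nonneg_ae hnn hi).1 h1
  exact Measure.eqOn_open_of_ae_eq h2 hB hf continuousOn_const

@[simp] theorem bilin_zero_left {ι κ : Type*} [Fintype ι] [Fintype κ] (A : ι → κ → ℝ)
    (y : κ → ℝ) : bilin A 0 y = 0 := by simp [bilin]

@[simp] theorem bilin_zero_right {ι κ : Type*} [Fintype ι] [Fintype κ] (A : ι → κ → ℝ)
    (x : ι → ℝ) : bilin A x 0 = 0 := by simp [bilin]

@[simp] theorem lin_zero {ι : Type*} [Fintype ι] (A : ι → ℝ) : lin A 0 = 0 := by simp [lin]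

theorem Coefficients.GPosDef.nonneg {c : Coefficients} (hG : c.GPosDef) (E : Fin 3 → ℝ)
    (V : Fin 3 → Fin 3 → ℝ) (χ : ℝ) (hV : ∀ i j, V i j = V j i) : 0 ≤ c.G E V χ := by
  by_cases h : E = 0 ∧ V = 0 ∧ χ = 0
  · obtain ⟨rfl, rfl, rfl⟩ := h
    simp [Coefficients.G, Coefficients.F]
  · exact (hG E V χ hV h).le

namespace Fields
variable {c : Coefficients} {U : Fields} {t : ℝ} {x : E3}

theorem V_symm (h : U.SmoothAt t x) (i j : Fin 3) : U.V i j t x = U.V j i t x := by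
  rw [V_eq, V_eq, pd_comm j i (h.φ.of_le (m := 2) (by norm_num)).slice]

theorem κ_symm (h : U.SmoothAt t x) (i j k : Fin 3) : U.κ i j k t x = U.κ j i k t x :=
  pd_comm j i ((h.u k).of_le (m := 2) (by norm_num)).slice

theorem storedEnergy_nonneg (h : U.SmoothAt t x) (hrho : 0 < c.rho) (hβ : 0 < c.beta)
    (hW : c.WPosSemidef) (hG : c.GPosDef) (hdiss : c.DissipationInequality) :
    0 ≤ U.storedEnergy c t x := by
  have h1 := hW (fun i j => U.e i j t x) (fun i j k => U.κ i j k t x)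
    (fun i j => by simp only [e]; ring) (fun i j k => κ_symm h i j k)
  have h2 := hG.nonneg (fun i => U.E i t x) (fun i j => U.V i j t x) (U.χ c t x)
    (fun i j => V_symm h i j)
  have h3 := hdiss (-(U.θ t x) / c.beta) (U.tempGrad t x)
  have h4 : 0 ≤ ∑ i, dot (U.u i) t x * dot (U.u i) t x :=
    Finset.sum_nonneg fun i _ => mul_self_nonneg _
  unfold storedEnergy
  positivity

/-- A vanishing sum of nonnegative terms has vanishing terms. Only the kinetic energy and G are
exploited: W, being merely semi-definite, says nothing about the strain, and u̇ = 0 makes this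
unnecessary. -/
theorem eq_zero_of_storedEnergy_eq_zero (h : U.SmoothAt t x) (hrho : 0 < c.rho) (hβ : 0 < c.beta)
    (hW : c.WPosSemidef) (hG : c.GPosDef) (hdiss : c.DissipationInequality)
    (h0 : U.storedEnergy c t x = 0) :
    (∀ i, dot (U.u i) t x = 0) ∧ (∀ i, U.E i t x = 0) ∧ U.χ c t x = 0 := by
  have h1 := hW (fun i j => U.e i j t x) (fun i j k => U.κ i j k t x)
    (fun i j => by simp only [e]; ring) (fun i j k => κ_symm h i j k)
  have h2 := hG.nonneg (fun i => U.E i t x) (fun i j => U.V i j t x) (U.χ c t x)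
    (fun i j => V_symm h i j)
  have h3 := mul_nonneg (half_pos hβ).le (hdiss (-(U.θ t x) / c.beta) (U.tempGrad t x))
  have h4 : 0 ≤ ∑ i, dot (U.u i) t x * dot (U.u i) t x :=
    Finset.sum_nonneg fun i _ => mul_self_nonneg _
  have h5 := mul_nonneg (half_pos hrho).le h4
  unfold storedEnergy at h0
  constructor
  · have h6 : c.rho / 2 * (∑ i, dot (U.u i) t x * dot (U.u i) t x) = 0 := by linarith
    have h7 := (mul_eq_zero.1 h6).resolve_left (half_pos hrho).ne'
    rw [Finset.sum_eq_zero_iff_of_nonneg fun i _ => mul_self_nonneg _] at h7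
    exact fun i => mul_self_eq_zero.1 (h7 i (Finset.mem_univ i))
  · by_contra hne
    have h6 := hG (fun i => U.E i t x) (fun i j => U.V i j t x) (U.χ c t x)
      (fun i j => V_symm h i j) (fun hz => hne ⟨fun i => congrFun hz.1 i, hz.2.2⟩)
    linarith

end Fields

/-! ### Vanishing of the energy and of the null solution. -/

namespace IsNullSolution

variable {c : Coefficients} {B : Set E3} {n : E3 → E3} {I : Set ℝ} {U : Fields} {t : ℝ}

/-- At time 0 the strains, θ and ∇θ vanish, but χ = βθ̇ and the electric field may not. The entropy
condition reads a34·E + a47·V = -(a44 + γ/β²)χ; multiplied by χ/2 it turns the electro-thermal part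
of `elecPower`/2 into the χ² term of the energy. -/
theorem energyDensity_zero (h : IsNullSolution c B n I U) (hB : IsRegularRegion B n)
    (hβ : c.beta ≠ 0) {x : E3} (hx : x ∈ B) :
    U.energyDensity c 0 x = 1 / 2 * U.elecPower c 0 x := by
  have hcl : ∀ y ∈ B, y ∈ closure B := fun y hy => subset_closure hy
  have hu : ∀ i j, ∀ y ∈ B, pd j (U.u i 0) y = 0 := fun i j y hy =>
    pd_eq_zero_of_isOpen hB.isOpen (fun z hz => h.init_u z (hcl z hz) i) hy j
  have he : U.strain 0 x = 0 := by
    funext p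
    simp [Fields.strain, Fields.e, hu _ _ x hx]
  have hκ : U.strainGrad 0 x = 0 := by
    funext p
    exact pd_eq_zero_of_isOpen hB.isOpen (fun z hz => hu _ _ z hz) hx _
  have hg : U.tempGrad 0 x = 0 := by
    funext i
    exact pd_eq_zero_of_isOpen hB.isOpen (fun z hz => h.init_θ z (hcl z hz)) hx i
  have hθ := h.init_θ x (hcl x hx)
  have hs := h.init_entropy x (hcl x hx)
  have hχ : U.χ c 0 x = c.beta * dot U.θ 0 x := by rw [Fields.χ, hθ, zero_add]
  rw [U.energyDensity_eq c hβ, Fields.elecPower, U.sum_σ_mul c 0 x (fun i => U.E i 0 x),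
    U.sum_Q_mul c 0 x (fun i j => U.V i j 0 x)]
  simp only [U.elec_def, U.elecGrad_def, he, hκ, hg, hθ, bilin_zero_left, bilin_zero_right,
    lin_zero, h.init_v x (hcl x hx)]
  rw [Fields.entropyPart, he, hκ, hg, hχ] at hs
  simp only [lin_zero] at hs
  rw [hχ]
  field_simp at hs ⊢
  linear_combination (-c.beta ^ 2 * dot U.θ 0 x) * hs

theorem hasDerivAt_energy (h : IsNullSolution c B n I U) (hB : IsRegularRegion B n)
    (hβ : c.beta ≠ 0) (ht : t ∈ I) :
    HasDerivAt (fun s => ∫ x in B, U.energyDensity c s x)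
      (∫ x in B, dot (U.energyDensity c) t x) t :=
  hasDerivAt_setIntegral hB.isOpen hB.isBounded fun x hx =>
    ((h.smooth t ht x hx).smooth_energyDensity c hβ).of_le (by norm_num)

variable {t₀ : EReal}

theorem storedEnergy_eq_zero (h : IsNullSolution c B n (timeInterval t₀) U)
    (hB : IsRegularRegion B n) (hc : c.Symmetric)
    (hrho : 0 < c.rho) (hβ : 0 < c.beta) (hT : 0 < c.T0)
    (hW : c.WPosSemidef) (hG : c.GPosDef) (hdiss : c.DissipationInequality)
    (ht : t ∈ timeInterval t₀) {x : E3} (hx : x ∈ B) : U.storedEnergy c t x = 0 := by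
  have hsub := Icc_subset_timeInterval ht
  have hd : ∀ s ∈ Icc 0 t, HasDerivAt (fun s => ∫ x in B, U.energyDensity c s x)
      (∫ x in B, dot (U.energyDensity c) s x) s := fun s hs =>
    h.hasDerivAt_energy hB hβ.ne' (hsub hs)
  -- Continuity on the closed interval suffices at the endpoint 0; the dissipation identity is
  -- invoked only for s > 0.
  have hanti : AntitoneOn (fun s => ∫ x in B, U.energyDensity c s x) (Icc 0 t) := by
    refine antitoneOn_of_deriv_nonpos (convex_Icc 0 t)
      (fun s hs => (hd s hs).continuousAt.continuousWithinAt)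
      (fun s hs => (hd s (interior_subset hs)).differentiableAt.differentiableWithinAt)
      (fun s hs => ?_)
    have hs' := interior_subset hs
    rw [interior_Icc] at hs
    rw [(hd s hs').deriv, h.integral_rate hB hc hβ.ne' hT.ne' (hsub hs')
      (timeInterval_mem_nhds (hsub hs') hs.1), neg_nonpos]
    exact integral_nonneg fun y => hdiss _ _
  have h0 : ∫ x in B, U.energyDensity c 0 x = 0 := by
    rw [setIntegral_congr_fun hB.isOpen.measurableSet fun x hx => h.energyDensity_zero hB hβ.ne' hx,
      integral_const_mul, h.integral_elecPower hB (hsub ⟨le_rfl, ht.1⟩), mul_zero]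
  have hle := hanti ⟨le_rfl, ht.1⟩ ⟨ht.1, le_rfl⟩ ht.1
  simp only [h0] at hle
  have hsm := h.smooth t ht
  have hcst : ∀ y ∈ closure B, SpaceTimeC 2 (U.storedEnergy c) t y := fun y hy =>
    (hsm y hy).smooth_storedEnergy c hβ.ne'
  have i1 : IntegrableOn (U.storedEnergy c t) B := integrableOn_of_spaceTimeC hB.isBounded hcst
  have i2 : IntegrableOn (U.elecPower c t) B := integrableOn_of_spaceTimeC hB.isBounded fun y hy =>
    (hsm y hy).smooth_elecPower c
  have hsplit : ∫ x in B, U.energyDensity c t x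
      = (∫ x in B, U.storedEnergy c t x) + ∫ x in B, U.elecPower c t x := integral_add i1 i2
  rw [hsplit, h.integral_elecPower hB ht, add_zero] at hle
  exact eq_zero_of_setIntegral_nonpos hB.isOpen
    (fun y hy => (hcst y (subset_closure hy)).slice.continuousAt.continuousWithinAt) i1
    (fun y hy => (U.storedEnergy_nonneg (hsm y (subset_closure hy)) hrho hβ hW hG hdiss)) hle x hx

/-- The null problem has only the trivial solution. -/
theorem eq_zero (h : IsNullSolution c B n (timeInterval t₀) U)
    (hB : IsRegularRegion B n) (hc : c.Symmetric)
    (hrho : 0 < c.rho) (hβ : 0 < c.beta) (hT : 0 < c.T0)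
    (hW : c.WPosSemidef) (hG : c.GPosDef) (hdiss : c.DissipationInequality)
    (ht : t ∈ timeInterval t₀) {x : E3} (hx : x ∈ closure B) :
    (∀ i, U.u i t x = 0) ∧ U.θ t x = 0 ∧ U.φ t x = 0 := by
  have hsub := Icc_subset_timeInterval ht
  have hz : ∀ s ∈ timeInterval t₀, ∀ y ∈ B,
      (∀ i, dot (U.u i) s y = 0) ∧ (∀ i, U.E i s y = 0) ∧ U.χ c s y = 0 := fun s hs y hy =>
    Fields.eq_zero_of_storedEnergy_eq_zero (h.smooth s hs y (subset_closure hy)) hrho hβ hW hG hdiss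
      (h.storedEnergy_eq_zero hB hc hrho hβ hT hW hG hdiss hs hy)
  have hsm := h.smooth t ht
  have hmem : t ∈ Icc 0 t := ⟨ht.1, le_rfl⟩
  refine ⟨fun i => ?_, ?_, ?_⟩
  · refine eq_on_closure_of_eq_on (fun y hy => ((hsm y hy).u i).slice.continuousAt)
      (fun y hy => ?_) x hx
    have hd : ∀ s ∈ Icc 0 t, HasDerivAt (fun s => U.u i s y) 0 s := fun s hs => by
      have h1 := ((h.smooth s (hsub hs) y (subset_closure hy)).u i).of_le (m := 1) (by norm_num)
      have h2 := h1.hasDerivAt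
      rwa [(hz s (hsub hs) y hy).1 i] at h2
    have h3 := constant_of_has_deriv_right_zero
      (fun s hs => (hd s hs).continuousAt.continuousWithinAt)
      (fun s hs => (hd s (Ico_subset_Icc_self hs)).hasDerivWithinAt) t hmem
    rw [h3, h.init_u y (subset_closure hy) i]
  · refine eq_on_closure_of_eq_on (fun y hy => (hsm y hy).θ.slice.continuousAt)
      (fun y hy => ?_) x hx
    -- The integrating factor of θ + βθ̇ = 0.
    have hd : ∀ s ∈ Icc 0 t, HasDerivAt (fun s => Real.exp (s / c.beta) * U.θ s y) 0 s := by
      intro s hs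
      have h1 := (h.smooth s (hsub hs) y (subset_closure hy)).θ.of_le (m := 1) (by norm_num)
      have h2 := (((hasDerivAt_id s).div_const c.beta).exp).mul h1.hasDerivAt
      refine h2.congr_deriv ?_
      have h4 := (hz s (hsub hs) y hy).2.2
      rw [Fields.χ] at h4
      have h5 : U.θ s y = -(c.beta * dot U.θ s y) := by linarith
      rw [h5]
      have := hβ.ne'
      simp only [id]
      field_simp
      ring
    have h3 := constant_of_has_deriv_right_zero
      (fun s hs => (hd s hs).continuousAt.continuousWithinAt)
      (fun s hs => (hd s (Ico_subset_Icc_self hs)).hasDerivWithinAt) t hmem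
    rw [h.init_θ y (subset_closure hy), mul_zero] at h3
    exact (mul_eq_zero.1 h3).resolve_left (Real.exp_pos _).ne'
  -- Since ∇φ = 0 on the connected set B, φ is constant there and by continuity on its closure,
  -- hence equal to its value 0 at the grounded boundary point.
  · obtain ⟨p, hp, hp0⟩ := h.grounded
    obtain ⟨y₀, hy₀⟩ := hB.isConnected.nonempty
    have hcont : ∀ y ∈ closure B, ContinuousAt (U.φ t) y := fun y hy =>
      (hsm y hy).φ.slice.continuousAt
    have hconst : ∀ y ∈ B, U.φ t y = U.φ t y₀ := fun y hy => by
      refine hB.isOpen.is_const_of_fderiv_eq_zero (𝕜 := ℝ) hB.isConnected.isPreconnected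
        (fun z hz => ((hsm z (subset_closure hz)).φ.slice.differentiableAt
          (by norm_num)).differentiableWithinAt) (fun z hzB => ?_) hy hy₀
      ext v
      rw [fderiv_eq_sum_pd]
      have : ∀ i, pd i (U.φ t) z = 0 := fun i => neg_eq_zero.1 ((hz t ht z hzB).2.1 i)
      simp [this]
    have hcl := eq_on_closure_of_eq_on hcont hconst
    rw [hcl x hx, ← hcl p (frontier_subset_closure hp), hp0 t ht]

end IsNullSolution

/-! ### Linearity -/

section linearity
variable {n : E3 → E3} {S S₁ S₂ : Fin 3 → E3 → ℝ} {M M₁ M₂ : Fin 3 → Fin 3 → E3 → ℝ} {x : E3}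

theorem surfDeriv_congr {f g : E3 → ℝ} (h : f =ᶠ[𝓝 x] g) (i : Fin 3) :
    surfDeriv n i f x = surfDeriv n i g x := by
  simp only [surfDeriv, pd_congr h]

theorem surfDeriv_fun_sub {f g : E3 → ℝ} (hf : DifferentiableAt ℝ f x)
    (hg : DifferentiableAt ℝ g x) (i : Fin 3) :
    surfDeriv n i (fun y => f y - g y) x = surfDeriv n i f x - surfDeriv n i g x := by
  simp only [surfDeriv, pd_fun_sub _ hf hg, mul_sub, Finset.sum_sub_distrib]

theorem bodyForce_sub (hS₁ : ∀ j, DifferentiableAt ℝ (S₁ j) x)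
    (hS₂ : ∀ j, DifferentiableAt ℝ (S₂ j) x) (hM₁ : ∀ k j, ContDiffAt ℝ 2 (M₁ k j) x)
    (hM₂ : ∀ k j, ContDiffAt ℝ 2 (M₂ k j) x)
    (hS : ∀ j, S j =ᶠ[𝓝 x] fun y => S₁ j y - S₂ j y)
    (hM : ∀ k j, M k j =ᶠ[𝓝 x] fun y => M₁ k j y - M₂ k j y) :
    bodyForce S M x = bodyForce S₁ M₁ x - bodyForce S₂ M₂ x := by
  have h1 : ∀ j, pd j (S j) x = pd j (S₁ j) x - pd j (S₂ j) x := fun j => by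
    rw [pd_congr (hS j), pd_fun_sub j (hS₁ j) (hS₂ j)]
  have h2 : ∀ k j, pd j (pd k (M k j)) x = pd j (pd k (M₁ k j)) x - pd j (pd k (M₂ k j)) x := by
    intro k j
    have e : pd k (M k j) =ᶠ[𝓝 x] fun y => pd k (M₁ k j) y - pd k (M₂ k j) y := by
      filter_upwards [(hM k j).eventuallyEq_nhds, (hM₁ k j).eventually (by simp),
        (hM₂ k j).eventually (by simp)] with y hy h3 h4
      rw [pd_congr hy, pd_fun_sub k (h3.differentiableAt (by norm_num))
        (h4.differentiableAt (by norm_num))]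
    rw [pd_congr e, pd_fun_sub j
      ((contDiffAt_pd (k := 1) k (by exact_mod_cast hM₁ k j)).differentiableAt (by norm_num))
      ((contDiffAt_pd (k := 1) k (by exact_mod_cast hM₂ k j)).differentiableAt (by norm_num))]
  simp only [bodyForce, h1, h2, Finset.sum_sub_distrib]
  ring

theorem surfaceForce_sub (hn : ∀ i, DifferentiableAt ℝ (fun y => n y i) x)
    (hM₁ : ∀ k j, DifferentiableAt ℝ (M₁ k j) x) (hM₂ : ∀ k j, DifferentiableAt ℝ (M₂ k j) x)
    (hS : ∀ j, S j x = S₁ j x - S₂ j x)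
    (hM : ∀ k j, M k j =ᶠ[𝓝 x] fun y => M₁ k j y - M₂ k j y) :
    surfaceForce n S M x = surfaceForce n S₁ M₁ x - surfaceForce n S₂ M₂ x := by
  have h1 : ∀ k j, pd k (M k j) x = pd k (M₁ k j) x - pd k (M₂ k j) x := fun k j => by
    rw [pd_congr (hM k j), pd_fun_sub k (hM₁ k j) (hM₂ k j)]
  have h2 : ∀ j, surfDeriv n j (fun y => ∑ k, M k j y * n y k) x
      = surfDeriv n j (fun y => ∑ k, M₁ k j y * n y k) x
        - surfDeriv n j (fun y => ∑ k, M₂ k j y * n y k) x := by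
    intro j
    have e : (fun y => ∑ k, M k j y * n y k) =ᶠ[𝓝 x]
        fun y => (∑ k, M₁ k j y * n y k) - ∑ k, M₂ k j y * n y k := by
      filter_upwards [eventually_all.2 fun k => hM k j] with y hy
      simp only [hy, sub_mul, Finset.sum_sub_distrib]
    rw [surfDeriv_congr e, surfDeriv_fun_sub
      (DifferentiableAt.fun_sum fun k _ => (hM₁ k j).fun_mul (hn k))
      (DifferentiableAt.fun_sum fun k _ => (hM₂ k j).fun_mul (hn k))]
  have h3 : ∀ k j, M k j x = M₁ k j x - M₂ k j x := fun k j => (hM k j).self_of_nhds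
  simp only [surfaceForce, h1, h2, hS, h3, Finset.sum_sub_distrib, sub_mul, mul_sub]
  ring

theorem surfaceMoment_sub (hM : ∀ k j, M k j x = M₁ k j x - M₂ k j x) :
    surfaceMoment n M x = surfaceMoment n M₁ x - surfaceMoment n M₂ x := by
  simp only [surfaceMoment, hM, sub_mul, Finset.sum_sub_distrib]

theorem normalDeriv_fun_sub {f g : E3 → ℝ} (hf : DifferentiableAt ℝ f x)
    (hg : DifferentiableAt ℝ g x) :
    normalDeriv n (fun y => f y - g y) x = normalDeriv n f x - normalDeriv n g x := by
  simp only [normalDeriv, pd_fun_sub _ hf hg, mul_sub, Finset.sum_sub_distrib]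

theorem dot_fun_sub {f g : ℝ → E3 → ℝ} {t : ℝ} (hf : SpaceTimeC 1 f t x)
    (hg : SpaceTimeC 1 g t x) :
    dot (fun s y => f s y - g s y) t x = dot f t x - dot g t x :=
  (hf.hasDerivAt.sub hg.hasDerivAt).deriv

theorem dot_congr {f g : ℝ → E3 → ℝ} {t : ℝ}
    (h : (fun p : ℝ × E3 => f p.1 p.2) =ᶠ[𝓝 (t, x)] fun p => g p.1 p.2) :
    dot f t x = dot g t x := by
  have h1 : (fun s => f s x) =ᶠ[𝓝 t] fun s => g s x :=
    (by fun_prop : Continuous fun s : ℝ => (s, x)).continuousAt.eventually h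
  rw [dot, dot, h1.deriv_eq]

theorem dot_dot_fun_sub {f g : ℝ → E3 → ℝ} {t : ℝ} (hf : SpaceTimeC 2 f t x)
    (hg : SpaceTimeC 2 g t x) :
    dot (dot fun s y => f s y - g s y) t x = dot (dot f) t x - dot (dot g) t x := by
  have h : (fun p : ℝ × E3 => dot (fun s y => f s y - g s y) p.1 p.2) =ᶠ[𝓝 (t, x)]
      fun p => dot f p.1 p.2 - dot g p.1 p.2 := by
    filter_upwards [(hf.of_le (m := 1) (by norm_num)).eventually,
      (hg.of_le (m := 1) (by norm_num)).eventually] with p h1 h2 using dot_fun_sub h1 h2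
  exact (dot_congr (g := fun s y => dot f s y - dot g s y) h).trans
    (dot_fun_sub (hf.dot (k := 1)) (hg.dot (k := 1)))

end linearity

/-! ### The difference of two solutions. -/

namespace Fields

/-- The difference of two triples of fields. -/
def diff (U₁ U₂ : Fields) : Fields where
  u i t x := U₁.u i t x - U₂.u i t x
  θ t x := U₁.θ t x - U₂.θ t x
  φ t x := U₁.φ t x - U₂.φ t x

theorem SmoothAt.eventually {U : Fields} {t : ℝ} {x : E3} (h : U.SmoothAt t x) :
    ∀ᶠ p : ℝ × E3 in 𝓝 (t, x), U.SmoothAt p.1 p.2 := by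
  filter_upwards [eventually_all.2 fun i => (h.u i).eventually, h.θ.eventually, h.φ.eventually]
    with p h1 h2 h3 using ⟨h1, h2, h3⟩

theorem SmoothAt.eventually_space {U : Fields} {t : ℝ} {x : E3} (h : U.SmoothAt t x) :
    ∀ᶠ y in 𝓝 x, U.SmoothAt t y :=
  (by fun_prop : Continuous fun y : E3 => (t, y)).continuousAt.eventually h.eventually

section diff
variable (c : Coefficients) {U₁ U₂ : Fields} {t : ℝ} {x : E3}

theorem SmoothAt.diff (h₁ : U₁.SmoothAt t x) (h₂ : U₂.SmoothAt t x) :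
    (U₁.diff U₂).SmoothAt t x :=
  ⟨fun i => (h₁.u i).sub (h₂.u i), h₁.θ.sub h₂.θ, h₁.φ.sub h₂.φ⟩

theorem pd_pd_fun_sub {f g : E3 → ℝ} (hf : ContDiffAt ℝ 2 f x) (hg : ContDiffAt ℝ 2 g x)
    (i j : Fin 3) :
    pd i (pd j fun y => f y - g y) x = pd i (pd j f) x - pd i (pd j g) x := by
  have e : (pd j fun y => f y - g y) =ᶠ[𝓝 x] fun y => pd j f y - pd j g y := by
    filter_upwards [hf.eventually (by simp), hg.eventually (by simp)] with y h3 h4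
    rw [pd_fun_sub j (h3.differentiableAt (by norm_num)) (h4.differentiableAt (by norm_num))]
  rw [pd_congr e, pd_fun_sub i
    ((contDiffAt_pd (k := 1) j (by exact_mod_cast hf)).differentiableAt (by norm_num))
    ((contDiffAt_pd (k := 1) j (by exact_mod_cast hg)).differentiableAt (by norm_num))]

theorem diff_e (h₁ : U₁.SmoothAt t x) (h₂ : U₂.SmoothAt t x) (i j : Fin 3) :
    (U₁.diff U₂).e i j t x = U₁.e i j t x - U₂.e i j t x := by
  have d₁ : ∀ i, DifferentiableAt ℝ (U₁.u i t) x := fun i =>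
    (h₁.u i).slice.differentiableAt (by norm_num)
  have d₂ : ∀ i, DifferentiableAt ℝ (U₂.u i t) x := fun i =>
    (h₂.u i).slice.differentiableAt (by norm_num)
  change 1 / 2 * (pd j (fun y => U₁.u i t y - U₂.u i t y) x
    + pd i (fun y => U₁.u j t y - U₂.u j t y) x) = _
  rw [pd_fun_sub j (d₁ i) (d₂ i), pd_fun_sub i (d₁ j) (d₂ j), e, e]
  ring

theorem diff_κ (h₁ : U₁.SmoothAt t x) (h₂ : U₂.SmoothAt t x) (i j k : Fin 3) :
    (U₁.diff U₂).κ i j k t x = U₁.κ i j k t x - U₂.κ i j k t x :=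
  pd_pd_fun_sub ((h₁.u k).slice.of_le (by norm_num)) ((h₂.u k).slice.of_le (by norm_num)) j i

theorem diff_E (h₁ : U₁.SmoothAt t x) (h₂ : U₂.SmoothAt t x) (i : Fin 3) :
    (U₁.diff U₂).E i t x = U₁.E i t x - U₂.E i t x := by
  change -pd i (fun y => U₁.φ t y - U₂.φ t y) x = _
  rw [pd_fun_sub i (h₁.φ.slice.differentiableAt (by norm_num))
    (h₂.φ.slice.differentiableAt (by norm_num)), E, E]
  ring

theorem diff_V (h₁ : U₁.SmoothAt t x) (h₂ : U₂.SmoothAt t x) (i j : Fin 3) :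
    (U₁.diff U₂).V i j t x = U₁.V i j t x - U₂.V i j t x := by
  rw [V_eq, V_eq, V_eq]
  change -pd j (pd i fun y => U₁.φ t y - U₂.φ t y) x = _
  rw [pd_pd_fun_sub (h₁.φ.slice.of_le (by norm_num)) (h₂.φ.slice.of_le (by norm_num))]
  ring

theorem diff_dot_θ (h₁ : U₁.SmoothAt t x) (h₂ : U₂.SmoothAt t x) :
    dot (U₁.diff U₂).θ t x = dot U₁.θ t x - dot U₂.θ t x :=
  dot_fun_sub (h₁.θ.of_le (by norm_num)) (h₂.θ.of_le (by norm_num))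

theorem diff_pd_θ (h₁ : U₁.SmoothAt t x) (h₂ : U₂.SmoothAt t x) (i : Fin 3) :
    pd i ((U₁.diff U₂).θ t) x = pd i (U₁.θ t) x - pd i (U₂.θ t) x :=
  pd_fun_sub i (h₁.θ.slice.differentiableAt (by norm_num))
    (h₂.θ.slice.differentiableAt (by norm_num))

theorem diff_χ (h₁ : U₁.SmoothAt t x) (h₂ : U₂.SmoothAt t x) :
    (U₁.diff U₂).χ c t x = U₁.χ c t x - U₂.χ c t x := by
  rw [χ, diff_dot_θ h₁ h₂, χ, χ]
  change U₁.θ t x - U₂.θ t x + _ = _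
  ring

theorem diff_τ (h₁ : U₁.SmoothAt t x) (h₂ : U₂.SmoothAt t x) (i j : Fin 3) :
    (U₁.diff U₂).τ c i j t x = U₁.τ c i j t x - U₂.τ c i j t x := by
  simp only [τ, diff_e h₁ h₂, diff_κ h₁ h₂, diff_E h₁ h₂, diff_V h₁ h₂, diff_χ c h₁ h₂, mul_sub,
    Finset.sum_sub_distrib]
  ring

theorem diff_μ (h₁ : U₁.SmoothAt t x) (h₂ : U₂.SmoothAt t x) (i j k : Fin 3) :
    (U₁.diff U₂).μ c i j k t x = U₁.μ c i j k t x - U₂.μ c i j k t x := by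
  simp only [μ, diff_e h₁ h₂, diff_κ h₁ h₂, diff_E h₁ h₂, diff_V h₁ h₂, diff_χ c h₁ h₂, mul_sub,
    Finset.sum_sub_distrib]
  ring

theorem diff_σ (h₁ : U₁.SmoothAt t x) (h₂ : U₂.SmoothAt t x) (i : Fin 3) :
    (U₁.diff U₂).σ c i t x = U₁.σ c i t x - U₂.σ c i t x := by
  simp only [σ, diff_e h₁ h₂, diff_κ h₁ h₂, diff_E h₁ h₂, diff_V h₁ h₂, diff_χ c h₁ h₂, mul_sub,
    Finset.sum_sub_distrib]
  ring

theorem diff_Q (h₁ : U₁.SmoothAt t x) (h₂ : U₂.SmoothAt t x) (i j : Fin 3) :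
    (U₁.diff U₂).Q c i j t x = U₁.Q c i j t x - U₂.Q c i j t x := by
  simp only [Q, diff_e h₁ h₂, diff_κ h₁ h₂, diff_E h₁ h₂, diff_V h₁ h₂, diff_χ c h₁ h₂, mul_sub,
    Finset.sum_sub_distrib]
  ring

theorem diff_q (h₁ : U₁.SmoothAt t x) (h₂ : U₂.SmoothAt t x) (i : Fin 3) :
    (U₁.diff U₂).q c i t x = U₁.q c i t x - U₂.q c i t x := by
  simp only [q, diff_dot_θ h₁ h₂, diff_pd_θ h₁ h₂, mul_sub, Finset.sum_sub_distrib]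
  ring

theorem diff_entropyPart (h₁ : U₁.SmoothAt t x) (h₂ : U₂.SmoothAt t x) :
    (U₁.diff U₂).entropyPart c t x = U₁.entropyPart c t x - U₂.entropyPart c t x := by
  simp only [entropyPart, lin, strain, strainGrad, elec, elecGrad, tempGrad, diff_e h₁ h₂,
    diff_κ h₁ h₂, diff_E h₁ h₂, diff_V h₁ h₂, diff_χ c h₁ h₂, diff_dot_θ h₁ h₂, diff_pd_θ h₁ h₂,
    mul_sub, Finset.sum_sub_distrib]
  ring

theorem diff_dot_entropyPart (h₁ : U₁.SmoothAt t x) (h₂ : U₂.SmoothAt t x) :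
    dot ((U₁.diff U₂).entropyPart c) t x
      = dot (U₁.entropyPart c) t x - dot (U₂.entropyPart c) t x := by
  have h : (fun p : ℝ × E3 => (U₁.diff U₂).entropyPart c p.1 p.2) =ᶠ[𝓝 (t, x)]
      fun p => U₁.entropyPart c p.1 p.2 - U₂.entropyPart c p.1 p.2 := by
    filter_upwards [h₁.eventually, h₂.eventually] with p h3 h4 using diff_entropyPart c h3 h4
  exact (dot_congr (g := fun s y => U₁.entropyPart c s y - U₂.entropyPart c s y) h).trans
    (dot_fun_sub ((h₁.smooth_entropyPart c).of_le (by norm_num))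
      ((h₂.smooth_entropyPart c).of_le (by norm_num)))

theorem dot_η (h : U₁.SmoothAt t x) :
    dot (U₁.η c) t x = -(1 / c.rho) * dot (U₁.entropyPart c) t x := by
  have h1 : U₁.η c = fun s y => -(1 / c.rho) * (U₁.entropyPart c s y + c.alpha4) := by
    funext s y
    exact U₁.η_eq c s y
  rw [h1]
  exact ((((h.smooth_entropyPart c).of_le (m := 1) (by norm_num)).hasDerivAt.add_const
    c.alpha4).const_mul _).deriv

end diff
end Fields

/-- The boundary is covered by the closure of S and by C, so the condition P imposed on S has to be
carried to limit points of S; `hPc` is this continuity step. -/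
theorem IsSplitting.closure_or {B S C : Set E3} (h : IsSplitting B S C) {P Q : E3 → Prop}
    (hP : ∀ x ∈ S, P x) (hPc : ∀ x ∈ frontier B, x ∈ closure S → (∀ y ∈ S, P y) → P x)
    (hQ : ∀ x ∈ C, Q x) : ∀ x ∈ frontier B, P x ∨ Q x := by
  intro x hx
  have h1 := h.1.symm ▸ hx
  rcases h1 with h1 | h1
  · exact Or.inl (hPc x hx h1 hP)
  · exact Or.inr (hQ x h1)

theorem eq_zero_of_mem_closure {S : Set E3} {f : E3 → ℝ} {x : E3} (hf : ContinuousAt f x)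
    (hx : x ∈ closure S) (h : ∀ y ∈ S, f y = 0) : f x = 0 := by
  have h1 := hf.continuousWithinAt.mem_closure_image (s := S) hx
  have h2 : f '' S ⊆ {0} := by rintro _ ⟨y, hy, rfl⟩; exact h y hy
  simpa using closure_mono h2 h1

theorem IsSolution.smoothAt {c : Coefficients} {B : Set E3} {n : E3 → E3} {I : Set ℝ}
    {p : BoundaryParts} {d : Data} {U : Fields} (h : IsSolution c B n I p d U) {t : ℝ} (ht : t ∈ I)
    {x : E3} (hx : x ∈ closure B) : U.SmoothAt t x :=
  ⟨fun i => h.smooth_u i t ht x hx, h.smooth_θ t ht x hx, h.smooth_φ t ht x hx⟩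

/-- The difference of two solutions solves the null problem. -/
theorem IsSolution.isNullSolution_diff {c : Coefficients} {B : Set E3} {n : E3 → E3} {I : Set ℝ}
    {p : BoundaryParts} {d : Data} {U₁ U₂ : Fields} (hB : IsRegularRegion B n) (h0I : (0 : ℝ) ∈ I)
    (hp : p.Valid B) (hS₄ : p.S₄.Nonempty) (hrho : c.rho ≠ 0)
    (h₁ : IsSolution c B n I p d U₁) (h₂ : IsSolution c B n I p d U₂) :
    IsNullSolution c B n I (U₁.diff U₂) := by
  have s₁ : ∀ {t}, t ∈ I → ∀ {x}, x ∈ closure B → U₁.SmoothAt t x := fun ht _ hx =>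
    h₁.smoothAt ht hx
  have s₂ : ∀ {t}, t ∈ I → ∀ {x}, x ∈ closure B → U₂.SmoothAt t x := fun ht _ hx =>
    h₂.smoothAt ht hx
  have eτ : ∀ {t}, t ∈ I → ∀ {x}, x ∈ closure B → ∀ i j,
      (U₁.diff U₂).τ c i j t =ᶠ[𝓝 x] fun y => U₁.τ c i j t y - U₂.τ c i j t y :=
    fun ht x hx i j => by
      filter_upwards [(s₁ ht hx).eventually_space, (s₂ ht hx).eventually_space] with y h3 h4
        using Fields.diff_τ c h3 h4 i j
  have eμ : ∀ {t}, t ∈ I → ∀ {x}, x ∈ closure B → ∀ i j k,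
      (U₁.diff U₂).μ c i j k t =ᶠ[𝓝 x] fun y => U₁.μ c i j k t y - U₂.μ c i j k t y :=
    fun ht x hx i j k => by
      filter_upwards [(s₁ ht hx).eventually_space, (s₂ ht hx).eventually_space] with y h3 h4
        using Fields.diff_μ c h3 h4 i j k
  have eσ : ∀ {t}, t ∈ I → ∀ {x}, x ∈ closure B → ∀ i,
      (U₁.diff U₂).σ c i t =ᶠ[𝓝 x] fun y => U₁.σ c i t y - U₂.σ c i t y :=
    fun ht x hx i => by
      filter_upwards [(s₁ ht hx).eventually_space, (s₂ ht hx).eventually_space] with y h3 h4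
        using Fields.diff_σ c h3 h4 i
  have eQ : ∀ {t}, t ∈ I → ∀ {x}, x ∈ closure B → ∀ i j,
      (U₁.diff U₂).Q c i j t =ᶠ[𝓝 x] fun y => U₁.Q c i j t y - U₂.Q c i j t y :=
    fun ht x hx i j => by
      filter_upwards [(s₁ ht hx).eventually_space, (s₂ ht hx).eventually_space] with y h3 h4
        using Fields.diff_Q c h3 h4 i j
  have eq : ∀ {t}, t ∈ I → ∀ {x}, x ∈ closure B → ∀ i,
      (U₁.diff U₂).q c i t =ᶠ[𝓝 x] fun y => U₁.q c i t y - U₂.q c i t y :=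
    fun ht x hx i => by
      filter_upwards [(s₁ ht hx).eventually_space, (s₂ ht hx).eventually_space] with y h3 h4
        using Fields.diff_q c h3 h4 i
  have hfr : ∀ {x}, x ∈ frontier B → x ∈ closure B := fun hx => frontier_subset_closure hx
  have hSfr : ∀ {S C : Set E3}, IsSplitting B S C → ∀ x ∈ S, x ∈ frontier B :=
    fun h x hx => h.1 ▸ Or.inl (subset_closure hx)
  have hCfr : ∀ {S C : Set E3}, IsSplitting B S C → ∀ x ∈ C, x ∈ frontier B :=
    fun h x hx => h.1 ▸ Or.inr hx
  have hnd : ∀ {x}, x ∈ frontier B → ∀ i, DifferentiableAt ℝ (fun y => n y i) x := fun hx i =>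
    (hB.contDiffAt_normal hx i).differentiableAt (by norm_num)
  -- Continuity of the normal derivative at boundary points, which relies on the regularity of the
  -- extended normal, carries the conditions on S₂ and S₅ to their closures.
  have hndc : ∀ {f : E3 → ℝ} {x}, x ∈ frontier B → ContDiffAt ℝ 4 f x →
      ContinuousAt (normalDeriv n f) x := fun {f x} hx hf =>
    tendsto_finsetSum _ fun i _ => (hnd hx i).continuousAt.mul
      (contDiffAt_pd (k := 3) i (by exact_mod_cast hf)).continuousAt
  obtain ⟨hp1, hp2, hp3, hp4, hp5⟩ := hp
  have hdiff : ∀ {k : ℕ} {f : ℝ → E3 → ℝ} {t x}, SpaceTimeC (k + 1) f t x →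
      DifferentiableAt ℝ (f t) x := fun h => h.slice.differentiableAt (by simp)
  constructor
  · exact fun t ht x hx => (s₁ ht hx).diff (s₂ ht hx)
  · intro t ht x hxB i
    have hx := subset_closure hxB
    rw [bodyForce_sub (S₁ := fun j => U₁.τ c j i t) (S₂ := fun j => U₂.τ c j i t)
      (M₁ := fun k j => U₁.μ c k j i t) (M₂ := fun k j => U₂.μ c k j i t)
      (fun j => hdiff ((s₁ ht hx).smooth_τ c j i)) (fun j => hdiff ((s₂ ht hx).smooth_τ c j i))
      (fun k j => ((s₁ ht hx).smooth_μ c k j i).slice)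
      (fun k j => ((s₂ ht hx).smooth_μ c k j i).slice)
      (fun j => eτ ht hx j i) (fun k j => eμ ht hx k j i)]
    have e1 := h₁.motion t ht x hxB i
    have e2 := h₂.motion t ht x hxB i
    have e3 : dot (dot ((U₁.diff U₂).u i)) t x = dot (dot (U₁.u i)) t x - dot (dot (U₂.u i)) t x :=
      dot_dot_fun_sub (((s₁ ht hx).u i).of_le (by norm_num))
        (((s₂ ht hx).u i).of_le (by norm_num))
    rw [e3, bodyForce, bodyForce]
    linarith
  · intro t ht x hxB
    have hx := subset_closure hxB
    rw [bodyForce_sub (S₁ := fun j => U₁.σ c j t) (S₂ := fun j => U₂.σ c j t)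
      (M₁ := fun k j => U₁.Q c k j t) (M₂ := fun k j => U₂.Q c k j t)
      (fun j => hdiff ((s₁ ht hx).smooth_σ c j)) (fun j => hdiff ((s₂ ht hx).smooth_σ c j))
      (fun k j => ((s₁ ht hx).smooth_Q c k j).slice)
      (fun k j => ((s₂ ht hx).smooth_Q c k j).slice)
      (fun j => eσ ht hx j) (fun k j => eQ ht hx k j)]
    have e1 := h₁.electric t ht x hxB
    have e2 := h₂.electric t ht x hxB
    rw [bodyForce, bodyForce]
    linarith
  · intro t ht x hxB
    have hx := subset_closure hxB
    have e1 := h₁.energy t ht x hxB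
    have e2 := h₂.energy t ht x hxB
    rw [Fields.dot_η c (s₁ ht hx)] at e1
    rw [Fields.dot_η c (s₂ ht hx)] at e2
    have e3 : ∀ i, pd i ((U₁.diff U₂).q c i t) x = pd i (U₁.q c i t) x - pd i (U₂.q c i t) x :=
      fun i => by
        rw [pd_congr (eq ht hx i), pd_fun_sub i (hdiff ((s₁ ht hx).smooth_q c i))
          (hdiff ((s₂ ht hx).smooth_q c i))]
    simp only [e3, Finset.sum_sub_distrib]
    rw [Fields.diff_dot_entropyPart c (s₁ ht hx) (s₂ ht hx)]
    field_simp at e1 e2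
    linarith
  · exact fun x hx i => sub_eq_zero.2 ((h₁.init_u x hx i).trans (h₂.init_u x hx i).symm)
  · intro x hx i
    refine (dot_fun_sub (((s₁ h0I hx).u i).of_le (by norm_num))
      (((s₂ h0I hx).u i).of_le (by norm_num))).trans ?_
    rw [h₁.init_v x hx i, h₂.init_v x hx i, sub_self]
  · exact fun x hx => sub_eq_zero.2 ((h₁.init_θ x hx).trans (h₂.init_θ x hx).symm)
  · intro x hx
    -- The constant α⁽⁴⁾ cancels, so equal initial entropies mean equal linear parts.
    have e := (h₁.init_η x hx).trans (h₂.init_η x hx).symm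
    rw [U₁.η_eq, U₂.η_eq] at e
    rw [Fields.diff_entropyPart c (s₁ h0I hx) (s₂ h0I hx)]
    have : -(1 / c.rho) ≠ 0 := neg_ne_zero.2 (one_div_ne_zero hrho)
    have := mul_left_cancel₀ this e
    linarith
  · refine hp1.closure_or (fun x hx t ht i => ?_) (fun x hx hxS h t ht i => ?_)
      (fun x hx t ht i => ?_)
    · exact sub_eq_zero.2 ((h₁.bdry_u t ht x hx i).trans (h₂.bdry_u t ht x hx i).symm)
    · exact eq_zero_of_mem_closure
        (((s₁ ht (hfr hx)).diff (s₂ ht (hfr hx))).u i).slice.continuousAt hxS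
        fun y hy => h y hy t ht i
    · have hxf := hCfr hp1 x hx
      have hxc := hfr hxf
      rw [surfaceForce_sub (S₁ := fun j => U₁.τ c j i t) (S₂ := fun j => U₂.τ c j i t)
        (M₁ := fun k j => U₁.μ c k j i t) (M₂ := fun k j => U₂.μ c k j i t) (hnd hxf)
        (fun k j => hdiff ((s₁ ht hxc).smooth_μ c k j i))
        (fun k j => hdiff ((s₂ ht hxc).smooth_μ c k j i))
        (fun j => (eτ ht hxc j i).self_of_nhds) (fun k j => eμ ht hxc k j i)]
      exact sub_eq_zero.2 ((h₁.bdry_P t ht x hx i).trans (h₂.bdry_P t ht x hx i).symm)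
  · have e : ∀ t ∈ I, ∀ x ∈ frontier B, ∀ i, normalDeriv n ((U₁.diff U₂).u i t) x
        = normalDeriv n (U₁.u i t) x - normalDeriv n (U₂.u i t) x := fun t ht x hx i =>
      normalDeriv_fun_sub (hdiff ((s₁ ht (hfr hx)).u i)) (hdiff ((s₂ ht (hfr hx)).u i))
    refine hp2.closure_or (fun x hx t ht i => ?_) (fun x hx hxS h t ht i => ?_)
      (fun x hx t ht i => ?_)
    · rw [e t ht x (hSfr hp2 x hx) i]
      exact sub_eq_zero.2 ((h₁.bdry_Du t ht x hx i).trans (h₂.bdry_Du t ht x hx i).symm)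
    · exact eq_zero_of_mem_closure
        (hndc hx (((s₁ ht (hfr hx)).diff (s₂ ht (hfr hx))).u i).slice) hxS
        fun y hy => h y hy t ht i
    · have hxc := hfr (hCfr hp2 x hx)
      rw [surfaceMoment_sub (M₁ := fun k j => U₁.μ c k j i t) (M₂ := fun k j => U₂.μ c k j i t)
        (fun k j => (eμ ht hxc k j i).self_of_nhds)]
      exact sub_eq_zero.2 ((h₁.bdry_R t ht x hx i).trans (h₂.bdry_R t ht x hx i).symm)
  · refine hp3.closure_or (fun x hx t ht => ?_) (fun x hx hxS h t ht => ?_)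
      (fun x hx t ht => ?_)
    · exact sub_eq_zero.2 ((h₁.bdry_θ t ht x hx).trans (h₂.bdry_θ t ht x hx).symm)
    · exact eq_zero_of_mem_closure
        ((s₁ ht (hfr hx)).diff (s₂ ht (hfr hx))).θ.slice.continuousAt hxS
        fun y hy => h y hy t ht
    · have hxc := hfr (hCfr hp3 x hx)
      have e := (h₁.bdry_q t ht x hx).trans (h₂.bdry_q t ht x hx).symm
      simp only [(eq ht hxc _).self_of_nhds, sub_mul, Finset.sum_sub_distrib, e, sub_self]
  · refine hp4.closure_or (fun x hx t ht => ?_) (fun x hx hxS h t ht => ?_)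
      (fun x hx t ht => ?_)
    · exact sub_eq_zero.2 ((h₁.bdry_φ t ht x hx).trans (h₂.bdry_φ t ht x hx).symm)
    · exact eq_zero_of_mem_closure
        ((s₁ ht (hfr hx)).diff (s₂ ht (hfr hx))).φ.slice.continuousAt hxS
        fun y hy => h y hy t ht
    · have hxf := hCfr hp4 x hx
      have hxc := hfr hxf
      rw [surfaceForce_sub (S₁ := fun j => U₁.σ c j t) (S₂ := fun j => U₂.σ c j t)
        (M₁ := fun k j => U₁.Q c k j t) (M₂ := fun k j => U₂.Q c k j t) (hnd hxf)
        (fun k j => hdiff ((s₁ ht hxc).smooth_Q c k j))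
        (fun k j => hdiff ((s₂ ht hxc).smooth_Q c k j))
        (fun j => (eσ ht hxc j).self_of_nhds) (fun k j => eQ ht hxc k j)]
      exact sub_eq_zero.2 ((h₁.bdry_Λ t ht x hx).trans (h₂.bdry_Λ t ht x hx).symm)
  · have e : ∀ t ∈ I, ∀ x ∈ frontier B, normalDeriv n ((U₁.diff U₂).φ t) x
        = normalDeriv n (U₁.φ t) x - normalDeriv n (U₂.φ t) x := fun t ht x hx =>
      normalDeriv_fun_sub (hdiff (s₁ ht (hfr hx)).φ) (hdiff (s₂ ht (hfr hx)).φ)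
    refine hp5.closure_or (fun x hx t ht => ?_) (fun x hx hxS h t ht => ?_)
      (fun x hx t ht => ?_)
    · rw [e t ht x (hSfr hp5 x hx)]
      exact sub_eq_zero.2 ((h₁.bdry_Dφ t ht x hx).trans (h₂.bdry_Dφ t ht x hx).symm)
    · exact eq_zero_of_mem_closure
        (hndc hx ((s₁ ht (hfr hx)).diff (s₂ ht (hfr hx))).φ.slice) hxS
        fun y hy => h y hy t ht
    · have hxc := hfr (hCfr hp5 x hx)
      rw [surfaceMoment_sub (M₁ := fun k j => U₁.Q c k j t) (M₂ := fun k j => U₂.Q c k j t)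
        (fun k j => (eQ ht hxc k j).self_of_nhds)]
      exact sub_eq_zero.2 ((h₁.bdry_H t ht x hx).trans (h₂.bdry_H t ht x hx).symm)
  · obtain ⟨x, hx⟩ := hS₄
    exact ⟨x, hSfr hp4 x hx, fun t ht =>
      sub_eq_zero.2 ((h₁.bdry_φ t ht x hx).trans (h₂.bdry_φ t ht x hx).symm)⟩

end Thermopiezo

end

theorem theorem1 (c : Thermopiezo.Coefficients) (B : Set Thermopiezo.E3)
    (n : Thermopiezo.E3 → Thermopiezo.E3) (hB : Thermopiezo.IsRegularRegion B n)
    (t₀ : EReal) (ht₀ : 0 < t₀)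
    (p : Thermopiezo.BoundaryParts) (hp : p.Valid B) (d : Thermopiezo.Data)
    (hdiss : c.DissipationInequality)
    (hrho : 0 < c.rho) (hbeta : 0 < c.beta) (hT0 : 0 < c.T0)
    (hsymm : c.Symmetric) (hW : c.WPosSemidef) (hG : c.GPosDef)
    (hS₄ : p.S₄.Nonempty)
    (U₁ U₂ : Thermopiezo.Fields)
    (hU₁ : Thermopiezo.IsSolution c B n (Thermopiezo.timeInterval t₀) p d U₁)
    (hU₂ : Thermopiezo.IsSolution c B n (Thermopiezo.timeInterval t₀) p d U₂) :
    ∀ t ∈ Thermopiezo.timeInterval t₀, ∀ x ∈ closure B,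
      (∀ i, U₁.u i t x = U₂.u i t x) ∧ U₁.θ t x = U₂.θ t x ∧ U₁.φ t x = U₂.φ t x := by
  have hnull := hU₁.isNullSolution_diff hB (Thermopiezo.zero_mem_timeInterval ht₀) hp hS₄
    hrho.ne' hU₂
  intro t ht x hx
  obtain ⟨hu, hθ, hφ⟩ := hnull.eq_zero hB hsymm hrho hbeta hT0 hW hG hdiss ht hx
  exact ⟨fun i => sub_eq_zero.1 (hu i), sub_eq_zero.1 hθ, sub_eq_zero.1 hφ⟩
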